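/- **Setting.** Let $G=(V,\Sigma,\mathcal R,T)$ be a context-free grammar in Chomsky normal form: every rule is $A\to YZ$ with $Y,Z\in V\setminus\{T\}$, or $A\to a$ with $a\in\Sigma$, or $T\to\varepsilon$. Let $\mathcal R_B$ and $\mathcal R_T$ be the sets of binary rules $A\to YZ$ and of terminal rules $A\to a$, and let $\Gamma$ be the number of distinct right-hand sides in $\mathcal R_B$. For each distinct right-hand side $YZ$ introduce a placeholder variable $P$, and let $\mathcal R_B^\Gamma$ be the set of the $\Gamma$ rules $P\to YZ$. *Memory.* Memory words have $s\ge1$ bits. Indices of variables and placeholders and codes of terminals fit in one word each ($|V|+\Gamma\le 2^s$, $|\Sigma|\le 2^s$). A set of variables and placeholders is stored in one-hot encoding in $W=\lceil (|V|+\Gamma)/s\rceil$ words. Initially the slow memory contains the string $w=w_1\cdots w_n$, the list $\mathcal R_B^\Gamma$, the list of the rules in $\mathcal R_B$ (left-hand side and placeholder of the right-hand side), the list $\mathcal R_T$ (each list in any order, without repetitions), the index of $T$, a flag for $T\to\varepsilon$, and zeros elsewhere. The sets of variables deriving $w_{i+1}\cdots w_j$ are computed in entries $(i,j)$ of a matrix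 $X$ whose dimension is the least power of two greater than $n$. For each of the $W$ words of an entry, these words of all entries form one contiguous matrix, stored recursively quadrant by quadrant. $X^A$ denotes the bits of $X$ for the variable or placeholder $A$. *Algorithm $\mathcal A_{CYK}$.* If $n=0$, answer according to the flag for $T\to\varepsilon$. Otherwise, for each $i$ and each rule $A\to a$ in $\mathcal R_T$, set the bit of $A$ in entry $(i-1,i)$ if $w_i=a$; then run Closure on $X$; finally answer whether the bit of $T$ in entry $(0,n)$ is set. Closure on a matrix of dimension at most $2$ does nothing. On a matrix of larger dimension it runs Closure on the top-left quadrant, then on the bottom-right quadrant, and then runs Star on the whole matrix. Star on a matrix of dimension $2$ performs $X^A\leftarrow X^A\vee X^P$ in its off-diagonal entry for every rule in $\mathcal R_B$ with left-hand side $A$ and placeholder $P$. On a matrix of larger dimension, divided into $4\times4$ equal blocks $X_{kl}$, write $\mathrm{Star}(k,l)$ for Star on $\begin{bmatrix}X_{kk}&X_{kl}\\&X_{ll}\end{bmatrix}$; it performs, in this order: $\mathrm{Star}(2,3)$; $X_{13}^P\leftarrow X_{13}^P+X_{12}^Y X_{23}^Z$ for all $P\to YZ$ in $\mathcal R_B^\Gamma$;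 $\mathrm{Star}(1,3)$; $X_{24}^P\leftarrow X_{24}^P+X_{23}^Y X_{34}^Z$ for all $P\to YZ$ in $\mathcal R_B^\Gamma$; $\mathrm{Star}(2,4)$; $X_{14}^P\leftarrow X_{14}^P+X_{12}^Y X_{24}^Z$ and $X_{14}^P\leftarrow X_{14}^P+X_{13}^Y X_{34}^Z$ for all $P\to YZ$ in $\mathcal R_B^\Gamma$; $\mathrm{Star}(1,4)$. The products are Boolean matrix products, and each such update is computed in place by the recursive Matrix Multiply and Accumulate with eight half-size calls. The algorithm does not use the values of $M$ and $B$. *I/O.* The cache holds $M$ words. One I/O operation reads one block of $B\ge1$ consecutive words (starting at a multiple of $B$) from slow memory into the cache, or writes one back. An elementary operation (on at most three words) can be executed only when all words it reads or writes are in the cache; the cache is empty at the beginning, and all modified blocks have been written back at the end. The number of I/O operations executed is the minimum over all schedules of I/O operations that execute the algorithm's sequence of elementary operations. **Theorem.** For every grammar $G$ as above and every string $w\in\Sigma^*$ of length $n$, $\mathcal A_{CYK}$ accepts $w$ if and only if $w$ is in the language of $G$. Moreover there are absolute constants $c$ and $C$ such that, whenever either $B=1$ and $M\ge3$, or $B\ge1$,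 $M\ge c\,W B$ and $W\le 4|\mathcal R_B|$ (the last inequality holds for instance if every variable occurs in a binary rule, or if $W=1$ and $\mathcal R_B\neq\emptyset$), the number of I/O operations executed by $\mathcal A_{CYK}$ on $w$ is at most $$C\left(\frac1B\left(\frac{n^3\Gamma}{\sqrt M}+n^2\Gamma\log_2 M+n^2|\mathcal R_B|+n|\mathcal R_T|\right)+1\right).$$ -/

import Mathlib

universe u

/-! ### Grammars in Chomsky normal form and their size parameters -/

/-- Chomsky normal form: every rule is `A → B C` with `B`, `C` different from the start variable,
or `A → a`, or `T → ε` with `T` the start variable. -/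
def IsCNF {Sg : Type u} (G : ContextFreeGrammar.{u} Sg) : Prop :=
  ∀ r ∈ G.rules,
    (∃ Y Z : G.NT, Y ≠ G.initial ∧ Z ≠ G.initial ∧
        r.output = [Symbol.nonterminal Y, Symbol.nonterminal Z]) ∨
      (∃ a : Sg, r.output = [Symbol.terminal a]) ∨
      (r.input = G.initial ∧ r.output = [])

/-- The binary rules `A → Y Z`, as triples `(A, (Y, Z))`. -/
def binaryRules {Sg : Type u} (G : ContextFreeGrammar.{u} Sg) : Set (G.NT × (G.NT × G.NT)) :=
  {r | ContextFreeRule.mk r.1 [Symbol.nonterminal r.2.1, Symbol.nonterminal r.2.2] ∈ G.rules}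

/-- The terminal rules `A → a`, as pairs `(A, a)`. -/
def terminalRules {Sg : Type u} (G : ContextFreeGrammar.{u} Sg) : Set (G.NT × Sg) :=
  {r | ContextFreeRule.mk r.1 [Symbol.terminal r.2] ∈ G.rules}

/-- The distinct right-hand sides of the binary rules. -/
def binaryRightSides {Sg : Type u} (G : ContextFreeGrammar.{u} Sg) : Set (G.NT × G.NT) :=
  Prod.snd '' binaryRules G

/-- The number of binary rules. -/
noncomputable def numBinary {Sg : Type u} (G : ContextFreeGrammar.{u} Sg) : ℕ :=
  (binaryRules G).ncard

/-- The number of terminal rules. -/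
noncomputable def numTerminal {Sg : Type u} (G : ContextFreeGrammar.{u} Sg) : ℕ :=
  (terminalRules G).ncard

/-- The number `Γ` of distinct right-hand sides of binary rules. -/
noncomputable def numRightSides {Sg : Type u} (G : ContextFreeGrammar.{u} Sg) : ℕ :=
  (binaryRightSides G).ncard

/-- The number of `s`-bit words in the one-hot encoding of a set of variables, together with one
placeholder variable for each distinct right-hand side: `⌈(|V| + Γ) / s⌉`. -/
noncomputable def wordsPerSet {Sg : Type u} (G : ContextFreeGrammar.{u} Sg) [Fintype G.NT]
    (s : ℕ) : ℕ :=
  (Fintype.card G.NT + numRightSides G + (s - 1)) / s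

/-! ### The two-level memory -/

/-- What one elementary operation needs: the addresses of its operands and of its results. -/
structure Step where
  reads : List ℕ
  writes : List ℕ

/-- The blocks that are in the cache, and those of them that were modified since they were
loaded or last written back. Block `b` consists of the addresses `b * B, …, b * B + (B - 1)`. -/
structure Cache where
  resident : Finset ℕ
  dirty : Finset ℕ

/-- `Schedule M B c τ q`: starting with cache contents `c`, the sequence `τ` of elementary
operations can be executed with a cache of `M` words and blocks of `B` words by a schedule with
exactly `q` I/O operations, after which no modified block is left in the cache.
An I/O operation reads a block (`load`) or writes a block (`store`). -/
inductive Schedule (M B : ℕ) : Cache → List Step → ℕ → Prop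
  | done (c : Cache) : c.dirty = ∅ → Schedule M B c [] 0
  | load (c : Cache) (b : ℕ) (τ : List Step) (q : ℕ) :
      b ∉ c.resident → (insert b c.resident).card * B ≤ M →
      Schedule M B ⟨insert b c.resident, c.dirty⟩ τ q → Schedule M B c τ (q + 1)
  | store (c : Cache) (b : ℕ) (τ : List Step) (q : ℕ) :
      b ∈ c.resident →
      Schedule M B ⟨c.resident, c.dirty.erase b⟩ τ q → Schedule M B c τ (q + 1)
  | discard (c : Cache) (b : ℕ) (τ : List Step) (q : ℕ) :
      b ∉ c.dirty →
      Schedule M B ⟨c.resident.erase b, c.dirty⟩ τ q → Schedule M B c τ q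
  | exec (c : Cache) (t : Step) (τ : List Step) (q : ℕ) :
      (∀ a ∈ t.reads ++ t.writes, a / B ∈ c.resident) →
      Schedule M B ⟨c.resident, c.dirty ∪ (t.writes.map (· / B)).toFinset⟩ τ q →
      Schedule M B c (t :: τ) q

/-- The sequence `τ` of elementary operations can be executed with `q` I/O operations, starting
with an empty cache of `M` words and moving blocks of `B` words. -/
def RunsWithTransfers (M B : ℕ) (τ : List Step) (q : ℕ) : Prop :=
  Schedule M B ⟨∅, ∅⟩ τ q

/-! ### The processor

Words have `s` bits. The state consists of the contents of the memory and of the sequence of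
elementary operations executed so far. -/

structure Machine (s : ℕ) where
  mem : ℕ → BitVec s
  trace : List Step

abbrev RAM (s : ℕ) := StateM (Machine s)

namespace RAM

variable {s : ℕ}

/-- Use the word at address `a` as a number. -/
def readWord (a : ℕ) : RAM s ℕ := do
  let m ← get
  set (Machine.mk m.mem (m.trace ++ [Step.mk [a] []]))
  return (m.mem a).toNat

/-- Compare the words at addresses `a` and `b`. -/
def eqWords (a b : ℕ) : RAM s Bool := do
  let m ← get
  set (Machine.mk m.mem (m.trace ++ [Step.mk [a, b] []]))
  return m.mem a == m.mem b

/-- Test bit `a.2` of the word at address `a.1`. -/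
def testBit (a : ℕ × ℕ) : RAM s Bool := do
  let m ← get
  set (Machine.mk m.mem (m.trace ++ [Step.mk [a.1] []]))
  return (m.mem a.1).getLsbD a.2

/-- Set bit `a.2` of the word at address `a.1`. -/
def setBit (a : ℕ × ℕ) : RAM s Unit :=
  modify fun m => Machine.mk
    (Function.update m.mem a.1 (m.mem a.1 ||| BitVec.twoPow s a.2))
    (m.trace ++ [Step.mk [a.1] [a.1]])

/-- `d ← d ∨ a`, for single bits `d` and `a`. -/
def orBit (d a : ℕ × ℕ) : RAM s Unit :=
  modify fun m => Machine.mk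
    (if (m.mem a.1).getLsbD a.2 then
      Function.update m.mem d.1 (m.mem d.1 ||| BitVec.twoPow s d.2) else m.mem)
    (m.trace ++ [Step.mk [d.1, a.1] [d.1]])

/-- `d ← d ∨ (a ∧ b)`, for single bits `d`, `a` and `b`. -/
def orAndBit (d a b : ℕ × ℕ) : RAM s Unit :=
  modify fun m => Machine.mk
    (if (m.mem a.1).getLsbD a.2 && (m.mem b.1).getLsbD b.2 then
      Function.update m.mem d.1 (m.mem d.1 ||| BitVec.twoPow s d.2) else m.mem)
    (m.trace ++ [Step.mk [d.1, a.1, b.1] [d.1]])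

end RAM

/-! ### The layout of the memory -/

/-- The sizes of the parts of the input. -/
structure Sizes where
  /-- length of the input string -/
  n : ℕ
  /-- number of distinct right-hand sides of binary rules -/
  rhs : ℕ
  /-- number of binary rules -/
  bin : ℕ
  /-- number of terminal rules -/
  term : ℕ

namespace Sizes

/-- Address of the flag that tells whether `T → ε` is a rule. -/
def epsAddr : ℕ := 0

/-- Address of the index of the start variable. -/
def startAddr : ℕ := 1

/-- Address of the `i`-th character of the input string, counted from zero. -/
def strAddr (i : ℕ) : ℕ := 2 + i

/-- The binary rules `P → Y Z` with pairwise distinct right-hand sides and placeholders `P` as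
left-hand sides: three words each. -/
def rhsAddr (z : Sizes) (p : ℕ) : ℕ := 2 + z.n + 3 * p

/-- The binary rules `A → Y Z`, stored as `A` and the placeholder of `Y Z`: two words each. -/
def binAddr (z : Sizes) (r : ℕ) : ℕ := z.rhsAddr z.rhs + 2 * r

/-- The terminal rules `A → a`: two words each. -/
def termAddr (z : Sizes) (r : ℕ) : ℕ := z.binAddr z.bin + 2 * r

/-- The matrix `X` has dimension `2 ^ z.level`, the least power of two above `n`. -/
def level (z : Sizes) : ℕ := Nat.clog 2 (z.n + 1)

end Sizes

/-- Position of entry `(i, j)` of a matrix of dimension `2 ^ t` that is stored quadrant by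
quadrant, recursively. -/
def zOrder : ℕ → ℕ → ℕ → ℕ
  | 0, _, _ => 0
  | t + 1, i, j => 4 * zOrder t (i / 2) (j / 2) + 2 * (i % 2) + j % 2

/-- The bit of entry `(i, j)` of `X` that belongs to the variable (or placeholder) with index `v`:
its address, and its position in that word. The `v / s`-th words of all entries form one
contiguous matrix. -/
def Sizes.cell (z : Sizes) (s v i j : ℕ) : ℕ × ℕ :=
  (z.termAddr z.term + v / s * 4 ^ z.level + zOrder z.level i j, v % s)

/-! ### The algorithm

It depends neither on the size of the cache nor on the size of the blocks.
For `i < j ≤ n`, entry `(i, j)` of `X` represents the set of variables that derive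
`w_{i+1} … w_j`. Block `(I, J)` of level `t` of `X` consists of the entries in the rows
`I * 2 ^ t + i` and the columns `J * 2 ^ t + j` with `i, j < 2 ^ t`. -/

section Algorithm

variable {s : ℕ}

/-- Matrix Multiply and Accumulate `X^P_{IJ} ← X^P_{IJ} + X^Y_{IK} * X^Z_{KJ}` for blocks of
level `t`. -/
def mma (z : Sizes) (P Y Z : ℕ) : ℕ → ℕ → ℕ → ℕ → RAM s Unit
  | 0, I, K, J => RAM.orAndBit (z.cell s P I J) (z.cell s Y I K) (z.cell s Z K J)
  | t + 1, I, K, J => do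
      mma z P Y Z t (2 * I) (2 * K) (2 * J)
      mma z P Y Z t (2 * I) (2 * K + 1) (2 * J)
      mma z P Y Z t (2 * I) (2 * K) (2 * J + 1)
      mma z P Y Z t (2 * I) (2 * K + 1) (2 * J + 1)
      mma z P Y Z t (2 * I + 1) (2 * K) (2 * J)
      mma z P Y Z t (2 * I + 1) (2 * K + 1) (2 * J)
      mma z P Y Z t (2 * I + 1) (2 * K) (2 * J + 1)
      mma z P Y Z t (2 * I + 1) (2 * K + 1) (2 * J + 1)

/-- Iterate over the binary rules `P → Y Z` with distinct right-hand sides. -/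
def forRightSides (z : Sizes) (body : ℕ → ℕ → ℕ → RAM s Unit) : RAM s Unit :=
  (List.range z.rhs).forM fun p => do
    let P ← RAM.readWord (z.rhsAddr p)
    let Y ← RAM.readWord (z.rhsAddr p + 1)
    let Z ← RAM.readWord (z.rhsAddr p + 2)
    body P Y Z

/-- In entry `(i, j)`, update every variable by the placeholders that it is matched with. -/
def updateVariables (z : Sizes) (i j : ℕ) : RAM s Unit :=
  (List.range z.bin).forM fun r => do
    let A ← RAM.readWord (z.binAddr r)
    let P ← RAM.readWord (z.binAddr r + 1)
    RAM.orBit (z.cell s A i j) (z.cell s P i j)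

/-- Valiant's star algorithm for CYK, on the submatrix of dimension `2 ^ (t + 1)` with diagonal
blocks `(I, I)` and `(J, J)` and off-diagonal block `(I, J)`, all of level `t`. For `t + 1` these
are divided into the blocks `X₁₁, …, X₄₄` of level `t` with the block rows (and columns)
`2 * I`, `2 * I + 1`, `2 * J`, `2 * J + 1`. -/
def cykStar (z : Sizes) : ℕ → ℕ → ℕ → RAM s Unit
  | 0, I, J => updateVariables z I J
  | t + 1, I, J => do
      cykStar z t (2 * I + 1) (2 * J)
      forRightSides z fun P Y Z => mma z P Y Z t (2 * I) (2 * I + 1) (2 * J)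
      cykStar z t (2 * I) (2 * J)
      forRightSides z fun P Y Z => mma z P Y Z t (2 * I + 1) (2 * J) (2 * J + 1)
      cykStar z t (2 * I + 1) (2 * J + 1)
      forRightSides z fun P Y Z => do
        mma z P Y Z t (2 * I) (2 * I + 1) (2 * J + 1)
        mma z P Y Z t (2 * I) (2 * J) (2 * J + 1)
      cykStar z t (2 * I) (2 * J + 1)

/-- Valiant's DP-closure algorithm on the diagonal block `(I, I)` of level `t`. -/
def cykClosure (z : Sizes) : ℕ → ℕ → RAM s Unit
  | 0, _ => pure ()
  | 1, _ => pure ()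
  | t + 2, I => do
      cykClosure z (t + 1) (2 * I)
      cykClosure z (t + 1) (2 * I + 1)
      cykStar z (t + 1) (2 * I) (2 * I + 1)

/-- Compare each character of the input string with the right-hand side of each terminal rule. -/
def cykInit (z : Sizes) : RAM s Unit :=
  (List.range z.n).forM fun i =>
    (List.range z.term).forM fun r => do
      if ← RAM.eqWords (z.termAddr r + 1) (Sizes.strAddr i) then
        let A ← RAM.readWord (z.termAddr r)
        RAM.setBit (z.cell s A i (i + 1))

/-- The CYK algorithm. -/
def cyk (z : Sizes) : RAM s Bool := do
  if z.n = 0 then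
    RAM.testBit (Sizes.epsAddr, 0)
  else
    cykInit z
    cykClosure z z.level 0
    let A ← RAM.readWord Sizes.startAddr
    RAM.testBit (z.cell s A 0 z.n)

end Algorithm

/-! ### The input of the algorithm -/

/-- A representation of the grammar by words of `s` bits: indices for the variables (and for the
placeholders, which come after them), codes for the terminals, and the rules listed in any order.
Each index and each code fits in a word. -/
structure Encoding {Sg : Type u} (G : ContextFreeGrammar.{u} Sg) [Fintype G.NT] (s : ℕ) where
  s_pos : 0 < s
  var : G.NT ≃ Fin (Fintype.card G.NT)
  letter : Sg ↪ BitVec s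
  rhs : List (G.NT × G.NT)
  rhs_nodup : rhs.Nodup
  mem_rhs : ∀ x, x ∈ rhs ↔ x ∈ binaryRightSides G
  bin : List (G.NT × Fin rhs.length)
  bin_nodup : bin.Nodup
  mem_bin : ∀ x, x ∈ bin ↔ (x.1, rhs.get x.2) ∈ binaryRules G
  term : List (G.NT × Sg)
  term_nodup : term.Nodup
  mem_term : ∀ x, x ∈ term ↔ x ∈ terminalRules G
  eps : Bool
  eps_iff : eps = true ↔ ContextFreeRule.mk G.initial [] ∈ G.rules
  fits : Fintype.card G.NT + rhs.length ≤ 2 ^ s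

namespace Encoding

variable {Sg : Type u} {G : ContextFreeGrammar.{u} Sg} [Fintype G.NT] {s : ℕ}

def sizes (e : Encoding G s) (w : List Sg) : Sizes where
  n := w.length
  rhs := e.rhs.length
  bin := e.bin.length
  term := e.term.length

/-- The word that holds the index of a variable. -/
def varWord (e : Encoding G s) (A : G.NT) : BitVec s := BitVec.ofNat s (e.var A)

/-- The word that holds the index of the placeholder of the `p`-th right-hand side. -/
def placeholderWord (_e : Encoding G s) (p : ℕ) : BitVec s :=
  BitVec.ofNat s (Fintype.card G.NT + p)

/-- The words of the input: the header, the string, the distinct right-hand sides with their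
placeholders, the binary rules, and the terminal rules. -/
def inputWords (e : Encoding G s) (w : List Sg) : List (BitVec s) :=
  [BitVec.ofBool e.eps |>.setWidth s, e.varWord G.initial] ++
    w.map e.letter ++
    e.rhs.zipIdx.flatMap
      (fun x => [e.placeholderWord x.2, e.varWord x.1.1, e.varWord x.1.2]) ++
    e.bin.flatMap (fun x => [e.varWord x.1, e.placeholderWord x.2]) ++
    e.term.flatMap (fun x => [e.varWord x.1, e.letter x.2])

/-- At the beginning the slow memory holds the input, followed by zeros. -/
def initial (e : Encoding G s) (w : List Sg) : Machine s where
  mem := fun a => (e.inputWords w).getD a 0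
  trace := []

/-- The answer of the algorithm on the input string `w`. -/
def cykAnswer (e : Encoding G s) (w : List Sg) : Bool :=
  ((cyk (e.sizes w)).run (e.initial w)).1

/-- The sequence of elementary operations that the algorithm executes on the input string `w`. -/
def cykTrace (e : Encoding G s) (w : List Sg) : List Step :=
  ((cyk (e.sizes w)).run (e.initial w)).2.trace

end Encoding

/-! Two arguments run over the same program, one on the contents of the memory and one on its trace.

Correctness. The program only ever sets bits, so it suffices that every bit set is justified
(`SoundMemory`) and that every justified bit is eventually set; whatever has been established
persists (`UpClosed`), which also makes the in-place updates harmless. The heart is the invariant of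
Star in `cykStar_achieves`: when Star is called on the diagonal blocks `I < J`, the placeholders in
block `(I, J)` already hold all products whose split point lies in the gap strictly between these
two blocks. Each product computed between two recursive calls supplies the split points by which the
gap of a subblock exceeds the gap of its parent. At dimension 2 the gap consists of all possible
split points, so passing from placeholders to left-hand sides completes the entry. On the grammar
side, a nonempty string is derived either by a terminal rule or by a binary rule that splits it into
two nonempty parts (`IsCNF.yields_cases`).

I/O. It is enough to exhibit one good schedule. Write-backs at most double the number of loads
(`Fetch.schedule`), so only loads are counted, by triples `Costs` that compose along the program.
Let `k₀` be a level with `4 ^ k₀` of the order of `M`, at which three blocks fit in the cache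
together. A product at a level `t ≤ k₀` costs `O(4 ^ t / B)` loads; above `k₀` every level
multiplies this by 8. Star obeys `F (t + 1) = 4 * F t + 3 * scan + 4 * Γ * μ t`, with `scan` the
cost of one pass over a rule list and `μ t` that of one product. Each level up to `k₀` then
contributes a term of order `Γ * 4 ^ level / B`, which gives the logarithm, and the levels above
`k₀` form a geometric sum of order `Γ * 8 ^ level / (2 ^ k₀ * B)`, which gives the cubic term
(`cykClosure_costs_of_le`).

For large blocks of memory the recursion is cut off at the level `k` with `4 ^ k` about `B`: there
all words of the matrix blocks concerned are loaded at once, and `W ≤ 4 * bin` charges these loads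
to the binary rules. Since the rule lists are scanned about `n ^ 2` times, a scan must cost `O(bin /
B)` without an additive constant; `Cursor.exists_cost_le` achieves this by pinning a short list and
streaming a long one. -/

/-! ### Executions measured by loads only -/

/-- `Fetch M B S τ S' q`: starting with the blocks `S` in a cache of `M` words, the operations `τ`
can be executed with `q` loads of blocks of `B` words so that the blocks `S'` are cached at the
end. -/
inductive Fetch (M B : ℕ) : Finset ℕ → List Step → Finset ℕ → ℕ → Prop
  | nil (S : Finset ℕ) : Fetch M B S [] S 0
  | load {S S' : Finset ℕ} {τ : List Step} {q : ℕ} (b : ℕ) :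
      (insert b S).card * B ≤ M → Fetch M B (insert b S) τ S' q → Fetch M B S τ S' (q + 1)
  | drop {S S' : Finset ℕ} {τ : List Step} {q : ℕ} (b : ℕ) :
      Fetch M B (S.erase b) τ S' q → Fetch M B S τ S' q
  | exec {S S' : Finset ℕ} {t : Step} {τ : List Step} {q : ℕ} :
      (∀ a ∈ t.reads ++ t.writes, a / B ∈ S) → Fetch M B S τ S' q → Fetch M B S (t :: τ) S' q

namespace Fetch

variable {M B : ℕ} {S S' S'' : Finset ℕ} {τ τ' : List Step} {q q' : ℕ}

theorem append (h : Fetch M B S τ S' q) (h' : Fetch M B S' τ' S'' q') :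
    Fetch M B S (τ ++ τ') S'' (q + q') := by
  induction h with
  | nil => simpa using h'
  | load b hb _ ih => rw [Nat.add_right_comm]; exact .load b hb (ih h')
  | drop b _ ih => exact .drop b (ih h')
  | exec ht _ ih => exact .exec ht (ih h')

theorem drop_sdiff (E : Finset ℕ) (h : Fetch M B (S \ E) τ S' q) : Fetch M B S τ S' q := by
  induction E using Finset.induction_on generalizing S with
  | empty => simpa using h
  | insert b E _ ih =>
    refine .drop b (ih ?_)
    rwa [show S.erase b \ E = S \ insert b E by
      ext; simp only [Finset.mem_sdiff, Finset.mem_erase, Finset.mem_insert]; tauto]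

theorem load_union (E : Finset ℕ) (hM : (S ∪ E).card * B ≤ M) (h : Fetch M B (S ∪ E) τ S' q) :
    Fetch M B S τ S' (q + E.card) := by
  induction E using Finset.induction_on generalizing S with
  | empty => simpa using h
  | insert b E hb ih =>
    rw [Finset.card_insert_of_notMem hb, ← add_assoc]
    have hu : insert b S ∪ E = S ∪ insert b E := by
      ext; simp only [Finset.mem_union, Finset.mem_insert]; tauto
    refine .load b (le_trans (Nat.mul_le_mul_right _ (Finset.card_le_card ?_)) hM) (ih ?_ ?_)
    · rw [← hu]; exact Finset.subset_union_left
    · rwa [hu]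
    · rwa [hu]

/-- Dropping is free and comes first, so only the missing blocks are paid for and only the target
set has to fit. -/
theorem change (hM : S'.card * B ≤ M) : Fetch M B S [] S' (S' \ S).card := by
  have hu : S \ (S \ S') ∪ S' \ S = S' := by
    ext x; simp only [Finset.mem_union, Finset.mem_sdiff]; tauto
  refine drop_sdiff (S \ S') ?_
  have := load_union (S := S \ (S \ S')) (τ := []) (S' := S') (q := 0) (M := M) (B := B) (S' \ S)
    (by rwa [hu]) (by rw [hu]; exact .nil _)
  simpa using this

/-- Amortization: every cached block owes at most one future write-back, which accounts for
`S.card`, and each load pays for itself and for the write-back of its block. The dirty set may be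
any subset of the cached blocks, so it need not be tracked by `Fetch`. -/
theorem schedule (h : Fetch M B S τ S' q) :
    ∀ d ⊆ S, ∃ n ≤ 2 * q + S.card, Schedule M B ⟨S, d⟩ τ n := by
  induction h with
  | nil S =>
    have key : ∀ d ⊆ S, Schedule M B ⟨S, d⟩ [] d.card := by
      intro d
      induction d using Finset.induction_on with
      | empty => intro _; exact .done _ rfl
      | insert b d hb ih =>
        intro hd
        rw [Finset.card_insert_of_notMem hb]
        refine .store _ b _ _ (hd (Finset.mem_insert_self _ _)) ?_
        simpa [Finset.erase_insert hb] using ih (fun x hx => hd (Finset.mem_insert_of_mem hx))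
    intro d hd
    exact ⟨_, by have := Finset.card_le_card hd; omega, key _ hd⟩
  | @load S S' τ q b hb _ ih =>
    intro d hd
    obtain ⟨n, hn, hs⟩ := ih d (hd.trans (Finset.subset_insert _ _))
    by_cases hbS : b ∈ S
    · rw [Finset.insert_eq_of_mem hbS] at hs hn
      exact ⟨n, by omega, hs⟩
    · rw [Finset.card_insert_of_notMem hbS] at hn
      exact ⟨n + 1, by omega, .load _ b _ _ hbS hb hs⟩
  | @drop S S' τ q b _ ih =>
    intro d hd
    obtain ⟨n, hn, hs⟩ := ih (d.erase b) (Finset.erase_subset_erase b hd)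
    by_cases hbS : b ∈ S
    · have := Finset.card_erase_add_one hbS
      -- The block is written back before being discarded even if it is clean; the decrease of
      -- `S.card` pays for this.
      exact ⟨n + 1, by omega,
        .store _ b _ _ hbS (.discard _ b _ _ (Finset.notMem_erase b d) hs)⟩
    · have hbd : b ∉ d := fun h => hbS (hd h)
      rw [Finset.erase_eq_of_notMem hbS] at hs hn
      rw [Finset.erase_eq_of_notMem hbd] at hs
      exact ⟨n, hn, hs⟩
  | @exec S S' t τ q ht _ ih =>
    intro d hd
    obtain ⟨n, hn, hs⟩ := ih (d ∪ (t.writes.map (· / B)).toFinset) (by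
      refine Finset.union_subset hd fun x hx => ?_
      simp only [List.mem_toFinset, List.mem_map] at hx
      obtain ⟨a, ha, rfl⟩ := hx
      exact ht a (List.mem_append_right _ ha))
    exact ⟨n, hn, .exec _ t _ _ ht hs⟩

end Fetch

/-! ### Cost triples for programs -/

/-- Started on a memory that agrees with `inp` below the address `base`, and with the blocks `S`
in the cache, the program `p` can be executed with at most `r` loads, leaves the memory below
`base` unchanged, leaves the blocks `S'` in the cache and returns a value that satisfies `Q`. -/
def Costs {s : ℕ} (M B base : ℕ) (inp : ℕ → BitVec s) {α : Type} (S : Finset ℕ) (p : RAM s α)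
    (S' : Finset ℕ) (r : ℝ) (Q : α → Prop) : Prop :=
  ∀ m : Machine s, (∀ a < base, m.mem a = inp a) →
    (∀ a < base, (p m).2.mem a = inp a) ∧ Q (p m).1 ∧
      ∃ τ q, (p m).2.trace = m.trace ++ τ ∧ Fetch M B S τ S' q ∧ (q : ℝ) ≤ r

namespace Costs

variable {s M B base : ℕ} {inp : ℕ → BitVec s} {α β : Type} {S S' S'' D : Finset ℕ}
  {p : RAM s α} {f : α → RAM s β} {r r' : ℝ} {Q : α → Prop} {Q' : β → Prop}

theorem pure (a : α) (ha : Q a) : Costs M B base inp S (pure a : RAM s α) S 0 Q := fun m hm =>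
  ⟨hm, ha, [], 0, (List.append_nil _).symm, .nil _, by simp⟩

theorem bind (h : Costs M B base inp S p S' r Q)
    (h' : ∀ a, Q a → Costs M B base inp S' (f a) S'' r' Q') :
    Costs M B base inp S (p >>= f) S'' (r + r') Q' := by
  intro m hm
  obtain ⟨h1, h2, τ, q, h3, h4, h5⟩ := h m hm
  obtain ⟨k1, k2, τ', q', k3, k4, k5⟩ := h' _ h2 _ h1
  refine ⟨k1, k2, τ ++ τ', q + q', ?_, h4.append k4, by push_cast; linarith⟩
  change ((f (p m).1) (p m).2).2.trace = _
  rw [k3, h3, List.append_assoc]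

theorem mono (h : Costs M B base inp S p S' r Q) (hr : r ≤ r') :
    Costs M B base inp S p S' r' Q := fun m hm => by
  obtain ⟨h1, h2, τ, q, h3, h4, h5⟩ := h m hm
  exact ⟨h1, h2, τ, q, h3, h4, h5.trans hr⟩

theorem before (h : Costs M B base inp S' p S'' r Q) (hM : S'.card * B ≤ M)
    (hr : ((S' \ S).card : ℝ) ≤ r') : Costs M B base inp S p S'' (r' + r) Q := fun m hm => by
  obtain ⟨h1, h2, τ, q, h3, h4, h5⟩ := h m hm
  exact ⟨h1, h2, τ, (S' \ S).card + q, h3, (Fetch.change hM).append h4, by push_cast; linarith⟩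

theorem after (h : Costs M B base inp S p S' r Q) (hM : S''.card * B ≤ M)
    (hr : ((S'' \ S').card : ℝ) ≤ r') : Costs M B base inp S p S'' (r + r') Q := fun m hm => by
  obtain ⟨h1, h2, τ, q, h3, h4, h5⟩ := h m hm
  refine ⟨h1, h2, τ, q + (S'' \ S').card, h3, ?_, by push_cast; linarith⟩
  simpa using h4.append (Fetch.change hM)

theorem after_subset (h : Costs M B base inp S p S' r Q) (hM : S''.card * B ≤ M)
    (hs : S'' ⊆ S') : Costs M B base inp S p S'' r Q := by
  simpa using h.after (r' := 0) hM (by simp [Finset.sdiff_eq_empty_iff_subset.2 hs])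

/-- Load a set of blocks for the duration of a program. -/
theorem with_blocks (E : Finset ℕ) (h : Costs M B base inp (D ∪ E) p (D ∪ E) r Q)
    (hM : (D ∪ E).card * B ≤ M) : Costs M B base inp D p D (E.card + r) Q := by
  refine (h.before hM ?_).after_subset ?_ Finset.subset_union_left
  · exact_mod_cast Finset.card_le_card (by intro x; simp; tauto)
  · exact le_trans (Nat.mul_le_mul_right _ (Finset.card_le_card Finset.subset_union_left)) hM

/-- The cached set and the cost may vary with the iteration, so that potential differences can
telescope over a loop. -/
theorem forM_range {N : ℕ} {body : ℕ → RAM s PUnit} {T : ℕ → Finset ℕ} {c : ℕ → ℝ}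
    (h : ∀ i < N, Costs M B base inp (T i) (body i) (T (i + 1)) (c i) fun _ => True) :
    Costs M B base inp (T 0) ((List.range N).forM body) (T N) (∑ i ∈ Finset.range N, c i)
      fun _ => True := by
  induction N with
  | zero => simpa using Costs.pure _ trivial
  | succ N ih =>
    have e : (List.range (N + 1)).forM body = (List.range N).forM body >>= fun _ => body N := by
      change forM (List.range (N + 1)) body = forM (List.range N) body >>= fun _ => body N
      rw [List.range_succ, List.forM_append]
      simp
    rw [e, Finset.sum_range_succ]
    exact (ih fun i hi => h i (by omega)).bind fun _ _ => h N (by omega)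

theorem forM_range_const {N : ℕ} {body : ℕ → RAM s PUnit} {c : ℝ}
    (h : ∀ i < N, Costs M B base inp S (body i) S c fun _ => True) :
    Costs M B base inp S ((List.range N).forM body) S (N * c) fun _ => True := by
  simpa using forM_range (T := fun _ => S) (c := fun _ => c) h

theorem readWord (a : ℕ) (ha : a / B ∈ S) :
    Costs M B base inp S (RAM.readWord a : RAM s ℕ) S 0
      fun v => a < base → v = (inp a).toNat := fun m hm =>
  ⟨hm, fun h => congrArg BitVec.toNat (hm a h), [⟨[a], []⟩], 0, rfl,
    .exec (by simpa using ha) (.nil _), by simp⟩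

theorem eqWords (a b : ℕ) (ha : a / B ∈ S) (hb : b / B ∈ S) :
    Costs M B base inp S (RAM.eqWords a b : RAM s Bool) S 0 fun _ => True := fun m hm =>
  ⟨hm, trivial, [⟨[a, b], []⟩], 0, rfl, .exec (by simp [ha, hb]) (.nil _), by simp⟩

theorem testBit (a : ℕ × ℕ) (ha : a.1 / B ∈ S) :
    Costs M B base inp S (RAM.testBit a : RAM s Bool) S 0 fun _ => True := fun m hm =>
  ⟨hm, trivial, [⟨[a.1], []⟩], 0, rfl, .exec (by simp [ha]) (.nil _), by simp⟩

theorem setBit (a : ℕ × ℕ) (hb : base ≤ a.1) (ha : a.1 / B ∈ S) :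
    Costs M B base inp S (RAM.setBit a : RAM s PUnit) S 0 fun _ => True := fun m hm =>
  ⟨fun x hx => by
      change Function.update m.mem a.1 _ x = _
      rw [Function.update_of_ne (by omega)]; exact hm x hx,
    trivial, [⟨[a.1], [a.1]⟩], 0, rfl, .exec (by simp [ha]) (.nil _), by simp⟩

theorem orBit (d a : ℕ × ℕ) (hb : base ≤ d.1) (hd : d.1 / B ∈ S) (ha : a.1 / B ∈ S) :
    Costs M B base inp S (RAM.orBit d a : RAM s PUnit) S 0 fun _ => True := fun m hm =>
  ⟨fun x hx => by
      change (if _ then Function.update m.mem d.1 _ else m.mem) x = _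
      split_ifs
      · rw [Function.update_of_ne (by omega)]; exact hm x hx
      · exact hm x hx,
    trivial, [⟨[d.1, a.1], [d.1]⟩], 0, rfl, .exec (by simp [ha, hd]) (.nil _), by simp⟩

theorem orAndBit (d a b : ℕ × ℕ) (hb : base ≤ d.1) (hd : d.1 / B ∈ S) (ha : a.1 / B ∈ S)
    (hbS : b.1 / B ∈ S) :
    Costs M B base inp S (RAM.orAndBit d a b : RAM s PUnit) S 0 fun _ => True := fun m hm =>
  ⟨fun x hx => by
      change (if _ then Function.update m.mem d.1 _ else m.mem) x = _
      split_ifs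
      · rw [Function.update_of_ne (by omega)]; exact hm x hx
      · exact hm x hx,
    trivial, [⟨[d.1, a.1, b.1], [d.1]⟩], 0, rfl, .exec (by simp [ha, hd, hbS]) (.nil _), by simp⟩

end Costs

/-! ### The recursive layout and the blocks it occupies -/

/-- `zOrder` interleaves the binary digits of `i` and `j`, and division by `4 ^ k` removes the `k`
lowest pairs of digits. Hence an aligned block of level `k` is a run of `4 ^ k` consecutive
positions. -/
theorem zOrder_div_pow (t k i j : ℕ) :
    zOrder (t + k) i j / 4 ^ k = zOrder t (i / 2 ^ k) (j / 2 ^ k) := by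
  induction k generalizing i j with
  | zero => simp
  | succ k ih =>
    have h : zOrder (t + (k + 1)) i j / 4 = zOrder (t + k) (i / 2) (j / 2) := by
      change (4 * zOrder (t + k) (i / 2) (j / 2) + 2 * (i % 2) + j % 2) / 4 = _
      omega
    rw [pow_succ', ← Nat.div_div_eq_div_mul, h, ih, Nat.div_div_eq_div_mul,
      Nat.div_div_eq_div_mul, ← pow_succ']

theorem zOrder_lt (t i j : ℕ) : zOrder t i j < 4 ^ t := by
  have h := zOrder_div_pow 0 t i j
  rw [Nat.zero_add] at h
  exact (Nat.div_eq_zero_iff_lt (by positivity)).1 h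

/-- The blocks of `B` words that contain the addresses `a, …, a + (m - 1)`. -/
def blocksOf (B a m : ℕ) : Finset ℕ := (Finset.Ico a (a + m)).image (· / B)

theorem mem_blocksOf {B a m x : ℕ} (h : a ≤ x) (h' : x < a + m) : x / B ∈ blocksOf B a m :=
  Finset.mem_image_of_mem _ (Finset.mem_Ico.2 ⟨h, h'⟩)

theorem card_blocksOf_le (B a m : ℕ) : (blocksOf B a m).card ≤ m :=
  Finset.card_image_le.trans (by simp)

/-- An unaligned interval can meet a partial block at either end. For `B = 1` the sharper
`card_blocksOf_le` is used instead, because a cache of three words leaves no slack. -/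
theorem card_blocksOf_le_div {B : ℕ} (hB : 0 < B) (a m : ℕ) :
    (blocksOf B a m).card ≤ m / B + 2 := by
  have h : blocksOf B a m ⊆ Finset.Icc (a / B) (a / B + (m / B + 1)) := by
    intro x hx
    simp only [blocksOf, Finset.mem_image, Finset.mem_Ico] at hx
    obtain ⟨y, ⟨h1, h2⟩, rfl⟩ := hx
    rw [Finset.mem_Icc]
    refine ⟨Nat.div_le_div_right h1, ?_⟩
    rw [Nat.div_le_iff_le_mul_add_pred hB]
    have ha := Nat.div_add_mod a B
    have hm := Nat.div_add_mod m B
    have h3 := Nat.mod_lt a hB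
    have h4 := Nat.mod_lt m hB
    have : B * (a / B + (m / B + 1)) = B * (a / B) + B * (m / B) + B := by ring
    omega
  refine (Finset.card_le_card h).trans ?_
  simp; omega

/-- A new block is needed only when the quotient by `B` increases; the right-hand side telescopes
along a sequential scan. -/
theorem div_succ_sub_div (B y : ℕ) (S : Finset ℕ) :
    ((insert ((y + 1) / B) S \ insert (y / B) S).card : ℝ) ≤
      (((y + 1) / B : ℕ) : ℝ) - ((y / B : ℕ) : ℝ) := by
  have hle : y / B ≤ (y + 1) / B := Nat.div_le_div_right (Nat.le_succ y)
  rw [← Nat.cast_sub hle]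
  norm_cast
  rcases hle.eq_or_lt with h | h
  · simp [h]
  · refine le_trans (Finset.card_le_card (t := {(y + 1) / B}) ?_) (by simp; omega)
    intro x; simp; tauto

namespace Sizes

variable (z : Sizes) (s B : ℕ)

/-- The address where the matrix `X` starts. -/
def matrixAddr : ℕ := z.termAddr z.term

/-- The blocks of memory that contain the `u`-th words of the entries in block `(I, J)` of level
`k` of `X`. -/
def entryBlocks (u k I J : ℕ) : Finset ℕ :=
  blocksOf B (z.matrixAddr + u * 4 ^ z.level + 4 ^ k * zOrder (z.level - k) I J) (4 ^ k)

/-- The set `D` contains all blocks of memory with bits of the variable `v` in block `(I, J)` of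
level `k` of `X`. -/
def HoldsVar (D : Finset ℕ) (v k I J : ℕ) : Prop :=
  ∀ i j, i / 2 ^ k = I → j / 2 ^ k = J → (z.cell s v i j).1 / B ∈ D

/-- The set `D` contains all blocks of memory with block `(I, J)` of level `k` of `X`, if there are
`W` words in each entry. -/
def Holds (W : ℕ) (D : Finset ℕ) (k I J : ℕ) : Prop :=
  ∀ v, v / s < W → z.HoldsVar s B D v k I J

variable {z s B} {D D' : Finset ℕ} {v k I J W : ℕ}

theorem matrixAddr_le_cell (v i j : ℕ) : z.matrixAddr ≤ (z.cell s v i j).1 := by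
  simp only [cell, matrixAddr]; omega

theorem HoldsVar.mono (h : z.HoldsVar s B D v k I J) (hD : D ⊆ D') :
    z.HoldsVar s B D' v k I J := fun i j hi hj => hD (h i j hi hj)

theorem Holds.mono (h : z.Holds s B W D k I J) (hD : D ⊆ D') : z.Holds s B W D' k I J :=
  fun v hv => (h v hv).mono hD

theorem HoldsVar.sub {t I' J' : ℕ} (h : z.HoldsVar s B D v (t + 1) I J) (hI : I' / 2 = I)
    (hJ : J' / 2 = J) : z.HoldsVar s B D v t I' J' := fun i j hi hj =>
  h i j (by rw [pow_succ, ← Nat.div_div_eq_div_mul, hi, hI])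
    (by rw [pow_succ, ← Nat.div_div_eq_div_mul, hj, hJ])

theorem Holds.sub {t I' J' : ℕ} (h : z.Holds s B W D (t + 1) I J) (hI : I' / 2 = I)
    (hJ : J' / 2 = J) : z.Holds s B W D t I' J' := fun v hv => (h v hv).sub hI hJ

theorem holdsVar_entryBlocks (hk : k ≤ z.level) :
    z.HoldsVar s B (z.entryBlocks B (v / s) k I J) v k I J := by
  intro i j hi hj
  have h := zOrder_div_pow (z.level - k) k i j
  rw [Nat.sub_add_cancel hk, hi, hj] at h
  have h1 := Nat.div_add_mod (zOrder z.level i j) (4 ^ k)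
  have h2 := Nat.mod_lt (zOrder z.level i j) (show 0 < 4 ^ k by positivity)
  rw [h] at h1
  apply mem_blocksOf <;> simp only [cell, matrixAddr] <;> omega

/-- The blocks of memory that contain block `(I, J)` of level `k` of `X`, with `W` words in each
entry. -/
def fullBlocks (z : Sizes) (B W k I J : ℕ) : Finset ℕ :=
  (Finset.range W).biUnion fun u => z.entryBlocks B u k I J

theorem holds_fullBlocks (hk : k ≤ z.level) :
    z.Holds s B W (z.fullBlocks B W k I J) k I J := fun _ hv =>
  (holdsVar_entryBlocks hk).mono
    (Finset.subset_biUnion_of_mem (fun u => z.entryBlocks B u k I J) (Finset.mem_range.2 hv))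

theorem card_fullBlocks_le (hB : 0 < B) :
    (z.fullBlocks B W k I J).card ≤ W * (4 ^ k / B + 2) := by
  unfold fullBlocks
  simpa using Finset.card_biUnion_le_card_mul (Finset.range W)
    (fun u => z.entryBlocks B u k I J) _ fun u _ => card_blocksOf_le_div hB _ _

/-- All blocks of memory that contain a part of `X`, with `W` words in each entry. -/
def allBlocks (z : Sizes) (B W : ℕ) : Finset ℕ := blocksOf B z.matrixAddr (W * 4 ^ z.level)

theorem holds_allBlocks : z.Holds s B W (z.allBlocks B W) k I J := by
  intro _ hv i j _ _
  have h1 := zOrder_lt z.level i j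
  have h2 : (_ + 1) * 4 ^ z.level ≤ W * 4 ^ z.level := Nat.mul_le_mul_right _ hv
  rw [add_mul, one_mul] at h2
  apply mem_blocksOf <;> simp only [cell, matrixAddr] <;> omega

end Sizes

/-! ### Amortized scans of the rule lists -/

/-- A strategy for keeping a part of the list of rules in the addresses `lo, …, hi - 1` in the
cache: the blocks `rest` always, and the blocks `pin y` when `y` is the next address to be read.
Reading the address `y` costs `pot (y + 1) - pot y`, and a scan costs at most `cost`. -/
structure Cursor (B e lo hi : ℕ) where
  rest : Finset ℕ
  pin : ℕ → Finset ℕ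
  pot : ℕ → ℝ
  cost : ℝ
  rest_subset : ∀ y, rest ⊆ pin y
  card_pin : ∀ y, (pin y).card ≤ e
  step : ∀ y, lo ≤ y → y < hi →
    ((insert (y / B) (pin (y + 1)) \ pin y).card : ℝ) ≤ pot (y + 1) - pot y
  scan : ∀ y y', lo ≤ y → y ≤ y' → y' ≤ hi →
    ((pin y \ rest).card : ℝ) + (pot y' - pot y) ≤ cost

namespace Cursor

variable {s M B base e lo hi : ℕ} {inp : ℕ → BitVec s} {D : Finset ℕ} {r : ℝ}
  (c : Cursor B e lo hi)

theorem cost_nonneg (h : lo ≤ hi) : 0 ≤ c.cost := by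
  have := c.scan lo lo le_rfl le_rfl h
  rw [sub_self, add_zero] at this
  exact le_trans (Nat.cast_nonneg _) this

theorem card_rest : c.rest.card ≤ e := (Finset.card_le_card (c.rest_subset 0)).trans (c.card_pin 0)

theorem fits_of_card_le {E : Finset ℕ} {n : ℕ} (h : n * B ≤ M) (hE : E.card ≤ n) :
    E.card * B ≤ M := le_trans (Nat.mul_le_mul_right _ hE) h

theorem card_union_pin (D : Finset ℕ) (y : ℕ) : (D ∪ c.pin y).card ≤ D.card + e :=
  (Finset.card_union_le _ _).trans (Nat.add_le_add_left (c.card_pin y) _)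

/-- The block of `y` is loaded together with the blocks to be pinned afterwards; the extra slot in
`hM` is for a block that is needed only during the access. -/
theorem access {α : Type} {p : RAM s α} {Q : α → Prop} {y : ℕ} (hM : (D.card + e + 1) * B ≤ M)
    (h1 : lo ≤ y) (h2 : y < hi)
    (h : Costs M B base inp (D ∪ insert (y / B) (c.pin (y + 1))) p
      (D ∪ insert (y / B) (c.pin (y + 1))) r Q) :
    Costs M B base inp (D ∪ c.pin y) p (D ∪ c.pin (y + 1)) (c.pot (y + 1) - c.pot y + r) Q := by
  refine (h.before (fits_of_card_le hM ?_) (le_trans ?_ (c.step y h1 h2))).after_subset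
    (fits_of_card_le hM ((c.card_union_pin _ _).trans (Nat.le_succ _))) ?_
  · refine (Finset.card_union_le _ _).trans ?_
    have := Finset.card_insert_le (y / B) (c.pin (y + 1))
    have := c.card_pin (y + 1)
    omega
  · exact_mod_cast Finset.card_le_card (by intro x; simp; tauto)
  · intro x; simp; tauto

theorem readWord {y : ℕ} (hM : (D.card + e + 1) * B ≤ M) (h1 : lo ≤ y) (h2 : y < hi) :
    Costs M B base inp (D ∪ c.pin y) (RAM.readWord y : RAM s ℕ) (D ∪ c.pin (y + 1))
      (c.pot (y + 1) - c.pot y) fun v => y < base → v = (inp y).toNat := by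
  simpa using c.access hM h1 h2 (Costs.readWord y (by simp))

/-- The potential differences telescope, so all records together cost one scan, plus `r` for the
work on each of them. -/
theorem scan_records {N a w : ℕ} {body : ℕ → RAM s PUnit} (hM : (D.card + e + 1) * B ≤ M)
    (h1 : lo ≤ a) (h2 : a + w * N ≤ hi)
    (h : ∀ p < N, Costs M B base inp (D ∪ c.pin (a + w * p)) (body p)
      (D ∪ c.pin (a + w * (p + 1))) (c.pot (a + w * (p + 1)) - c.pot (a + w * p) + r)
      fun _ => True) :
    Costs M B base inp (D ∪ c.rest) ((List.range N).forM body) (D ∪ c.rest)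
      (c.cost + N * r) fun _ => True := by
  have hfit : ∀ y, (D ∪ c.pin y).card * B ≤ M := fun y =>
    fits_of_card_le hM ((c.card_union_pin _ _).trans (Nat.le_succ _))
  have key := Costs.forM_range (T := fun p => D ∪ c.pin (a + w * p)) h
  rw [Finset.sum_add_distrib, Finset.sum_range_sub (fun p => c.pot (a + w * p))] at key
  have hsub := Finset.union_subset_union_right (s := D) (c.rest_subset (a + w * N))
  refine ((key.before (S := D ∪ c.rest) (hfit _) (r' := ((c.pin a \ c.rest).card : ℝ))
    ?_).after_subset (le_trans (Nat.mul_le_mul_right _ (Finset.card_le_card hsub)) (hfit _))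
    hsub).mono ?_
  · exact_mod_cast Finset.card_le_card (by intro x; simp; tauto)
  · have := c.scan a (a + w * N) h1 (by omega) h2
    simp only [Finset.sum_const, Finset.card_range, nsmul_eq_mul, Nat.mul_zero, Nat.add_zero]
    linarith

end Cursor

/-! ### Recurrences for the number of loads -/

section Cost

variable {s M B e W : ℕ} {z : Sizes} {inp : ℕ → BitVec s} {D : Finset ℕ}

/-- The recursion never leaves the three blocks it starts with. -/
theorem mma_costs_of_holds {P Y Z t I K J : ℕ} (hP : z.HoldsVar s B D P t I J)
    (hY : z.HoldsVar s B D Y t I K) (hZ : z.HoldsVar s B D Z t K J) :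
    Costs M B z.matrixAddr inp D (mma z P Y Z t I K J) D 0 fun _ => True := by
  induction t generalizing I K J with
  | zero =>
    exact .orAndBit _ _ _ (Sizes.matrixAddr_le_cell _ _ _) (hP _ _ (by simp) (by simp))
      (hY _ _ (by simp) (by simp)) (hZ _ _ (by simp) (by simp))
  | succ t ih =>
    have hr : ∀ a b c, a / 2 = I → b / 2 = K → c / 2 = J →
        Costs M B z.matrixAddr inp D (mma z P Y Z t a b c) D 0 fun _ => True :=
      fun a b c ha hb hc => ih (hP.sub ha hc) (hY.sub ha hb) (hZ.sub hb hc)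
    unfold mma
    refine Costs.mono ((hr _ _ _ ?_ ?_ ?_).bind fun _ _ => (hr _ _ _ ?_ ?_ ?_).bind fun _ _ =>
      (hr _ _ _ ?_ ?_ ?_).bind fun _ _ => (hr _ _ _ ?_ ?_ ?_).bind fun _ _ =>
      (hr _ _ _ ?_ ?_ ?_).bind fun _ _ => (hr _ _ _ ?_ ?_ ?_).bind fun _ _ =>
      (hr _ _ _ ?_ ?_ ?_).bind fun _ _ => hr _ _ _ ?_ ?_ ?_) (by simp) <;> omega

theorem mma_costs_load {β : ℕ} {P Y Z t I K J : ℕ} (ht : t ≤ z.level)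
    (hβ : ∀ a, (blocksOf B a (4 ^ t)).card ≤ β) (hM : (D.card + 3 * β) * B ≤ M) :
    Costs M B z.matrixAddr inp D (mma z P Y Z t I K J) D (3 * β) fun _ => True := by
  set E := z.entryBlocks B (P / s) t I J ∪ (z.entryBlocks B (Y / s) t I K ∪
    z.entryBlocks B (Z / s) t K J) with hE
  have hc : E.card ≤ 3 * β := by
    refine (Finset.card_union_le _ _).trans ?_
    have h1 := Finset.card_union_le (z.entryBlocks B (Y / s) t I K) (z.entryBlocks B (Z / s) t K J)
    have h2 : (z.entryBlocks B (P / s) t I J).card ≤ β := hβ _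
    have h3 : (z.entryBlocks B (Y / s) t I K).card ≤ β := hβ _
    have h4 : (z.entryBlocks B (Z / s) t K J).card ≤ β := hβ _
    omega
  refine (Costs.with_blocks E (mma_costs_of_holds
    ((Sizes.holdsVar_entryBlocks ht).mono ?_) ((Sizes.holdsVar_entryBlocks ht).mono ?_)
    ((Sizes.holdsVar_entryBlocks ht).mono ?_)) ?_).mono ?_
  · intro x hx; simp only [hE, Finset.mem_union]; tauto
  · intro x hx; simp only [hE, Finset.mem_union]; tauto
  · intro x hx; simp only [hE, Finset.mem_union]; tauto
  · exact Cursor.fits_of_card_le hM ((Finset.card_union_le _ _).trans (by omega))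
  · rw [add_zero]; exact_mod_cast hc

theorem mma_costs_succ {P Y Z t : ℕ} {μ : ℝ}
    (h : ∀ I K J, Costs M B z.matrixAddr inp D (mma z P Y Z t I K J) D μ fun _ => True)
    (I K J : ℕ) :
    Costs M B z.matrixAddr inp D (mma z P Y Z (t + 1) I K J) D (8 * μ) fun _ => True := by
  unfold mma
  exact Costs.mono ((h _ _ _).bind fun _ _ => (h _ _ _).bind fun _ _ => (h _ _ _).bind fun _ _ =>
    (h _ _ _).bind fun _ _ => (h _ _ _).bind fun _ _ => (h _ _ _).bind fun _ _ =>
    (h _ _ _).bind fun _ _ => h _ _ _) (by linarith)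

/-- The words in the lists of binary rules are indices whose bit is in one of the first `W` words
of a set of variables. -/
def ValidRules (z : Sizes) (inp : ℕ → BitVec s) (W : ℕ) : Prop :=
  ∀ a, z.rhsAddr 0 ≤ a → a < z.termAddr 0 → (inp a).toNat / s < W

variable (c : Cursor B e (z.rhsAddr 0) (z.termAddr 0))

/-- The pinned blocks change during the scan, so the cost of the body is required at every position
`y`. `ValidRules` guarantees that the indices read from the list point into the `W` words that may
be cached. -/
theorem forRightSides_costs {f : ℝ} {body : ℕ → ℕ → ℕ → RAM s Unit}
    (hV : ValidRules z inp W) (hM : (D.card + e + 1) * B ≤ M)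
    (h : ∀ P Y Z, P / s < W → Y / s < W → Z / s < W → ∀ y,
      Costs M B z.matrixAddr inp (D ∪ c.pin y) (body P Y Z) (D ∪ c.pin y) f fun _ => True) :
    Costs M B z.matrixAddr inp (D ∪ c.rest) (forRightSides z body) (D ∪ c.rest)
      (c.cost + z.rhs * f) fun _ => True := by
  refine c.scan_records (a := z.rhsAddr 0) (w := 3) hM le_rfl
    (by simp only [Sizes.rhsAddr, Sizes.termAddr, Sizes.binAddr]; omega) fun p hp => ?_
  have e0 : z.rhsAddr p = z.rhsAddr 0 + 3 * p := by simp only [Sizes.rhsAddr]; omega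
  have hlt : z.rhsAddr 0 + 3 * p + 3 ≤ z.termAddr 0 := by
    simp only [Sizes.rhsAddr, Sizes.termAddr, Sizes.binAddr]; omega
  have hle : z.termAddr 0 ≤ z.matrixAddr := by
    simp only [Sizes.matrixAddr, Sizes.termAddr]; omega
  rw [e0]
  refine Costs.mono ((c.readWord (y := z.rhsAddr 0 + 3 * p) hM (by omega) (by omega)).bind
    fun P hP => (c.readWord (y := z.rhsAddr 0 + 3 * p + 1) hM (by omega) (by omega)).bind
    fun Y hY => (c.readWord (y := z.rhsAddr 0 + 3 * p + 2) hM (by omega) (by omega)).bind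
    fun Z hZ => h P Y Z ?_ ?_ ?_ (z.rhsAddr 0 + 3 * p + 2 + 1)) ?_
  · rw [hP (by omega)]; exact hV _ (by omega) (by omega)
  · rw [hY (by omega)]; exact hV _ (by omega) (by omega)
  · rw [hZ (by omega)]; exact hV _ (by omega) (by omega)
  · rw [show z.rhsAddr 0 + 3 * (p + 1) = z.rhsAddr 0 + 3 * p + 2 + 1 by ring]; linarith

theorem updateVariables_costs {f : ℝ} {i j : ℕ}
    (hV : ValidRules z inp W) (hM : (D.card + e + 1) * B ≤ M)
    (h : ∀ A P, A / s < W → P / s < W → ∀ y,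
      Costs M B z.matrixAddr inp (D ∪ c.pin y) (RAM.orBit (z.cell s A i j) (z.cell s P i j))
        (D ∪ c.pin y) f fun _ => True) :
    Costs M B z.matrixAddr inp (D ∪ c.rest) (updateVariables z i j) (D ∪ c.rest)
      (c.cost + z.bin * f) fun _ => True := by
  refine c.scan_records (a := z.binAddr 0) (w := 2) hM
    (by simp only [Sizes.rhsAddr, Sizes.binAddr]; omega)
    (by simp only [Sizes.rhsAddr, Sizes.termAddr, Sizes.binAddr]; omega) fun p hp => ?_
  have e0 : z.binAddr p = z.binAddr 0 + 2 * p := by simp only [Sizes.binAddr]; omega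
  have hge : z.rhsAddr 0 ≤ z.binAddr 0 := by simp only [Sizes.rhsAddr, Sizes.binAddr]; omega
  have hlt : z.binAddr 0 + 2 * p + 2 ≤ z.termAddr 0 := by
    simp only [Sizes.rhsAddr, Sizes.termAddr, Sizes.binAddr]; omega
  have hle : z.termAddr 0 ≤ z.matrixAddr := by
    simp only [Sizes.matrixAddr, Sizes.termAddr]; omega
  rw [e0]
  refine Costs.mono ((c.readWord (y := z.binAddr 0 + 2 * p) hM (by omega) (by omega)).bind
    fun A hA => (c.readWord (y := z.binAddr 0 + 2 * p + 1) hM (by omega) (by omega)).bind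
    fun P hP => h A P ?_ ?_ (z.binAddr 0 + 2 * p + 1 + 1)) ?_
  · rw [hA (by omega)]; exact hV _ (by omega) (by omega)
  · rw [hP (by omega)]; exact hV _ (by omega) (by omega)
  · rw [show z.binAddr 0 + 2 * (p + 1) = z.binAddr 0 + 2 * p + 1 + 1 by ring]; linarith

theorem cursor_cost_nonneg : 0 ≤ c.cost :=
  c.cost_nonneg (by simp only [Sizes.rhsAddr, Sizes.termAddr, Sizes.binAddr]; omega)

/-- Four recursive calls, three scans, and four products per right-hand side, the last scan doing
two. The middle index of each product lies in one of the two diagonal blocks, so only the blocks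
`(I, I)`, `(I, J)` and `(J, J)` are touched. -/
theorem cykStar_costs_succ {t : ℕ} {F μ : ℝ} (hV : ValidRules z inp W)
    (hM : (D.card + e + 1) * B ≤ M) {I J : ℕ}
    (hF : ∀ I' J', I' / 2 = I → J' / 2 = J →
      Costs M B z.matrixAddr inp (D ∪ c.rest) (cykStar z t I' J') (D ∪ c.rest) F fun _ => True)
    (hμ : ∀ P Y Z, P / s < W → Y / s < W → Z / s < W → ∀ I' K' J', I' / 2 = I → J' / 2 = J →
      (K' / 2 = I ∨ K' / 2 = J) → ∀ y,
      Costs M B z.matrixAddr inp (D ∪ c.pin y) (mma z P Y Z t I' K' J') (D ∪ c.pin y) μ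
        fun _ => True) :
    Costs M B z.matrixAddr inp (D ∪ c.rest) (cykStar z (t + 1) I J) (D ∪ c.rest)
      (4 * F + 3 * c.cost + 4 * z.rhs * μ) fun _ => True := by
  unfold cykStar
  refine Costs.mono ((hF _ _ ?_ ?_).bind fun _ _ =>
    (forRightSides_costs c hV hM fun P Y Z hP hY hZ y =>
      hμ P Y Z hP hY hZ _ _ _ ?_ ?_ ?_ y).bind fun _ _ => (hF _ _ ?_ ?_).bind fun _ _ =>
    (forRightSides_costs c hV hM fun P Y Z hP hY hZ y =>
      hμ P Y Z hP hY hZ _ _ _ ?_ ?_ ?_ y).bind fun _ _ => (hF _ _ ?_ ?_).bind fun _ _ =>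
    (forRightSides_costs c hV hM fun P Y Z hP hY hZ y =>
      (hμ P Y Z hP hY hZ _ _ _ ?_ ?_ ?_ y).bind fun _ _ =>
        hμ P Y Z hP hY hZ _ _ _ ?_ ?_ ?_ y).bind fun _ _ => hF _ _ ?_ ?_) (by linarith)
  all_goals omega

/-- With the matrix blocks cached only the scans cost anything. Their number satisfies `N 0 = 1` and
`N (t + 1) = 4 * N t + 3`, that is, `N t = 2 * 4 ^ t - 1`. -/
theorem cykStar_costs_of_holds {t I J : ℕ} (hV : ValidRules z inp W)
    (hM : (D.card + e + 1) * B ≤ M) (hI : z.Holds s B W D t I I) (hIJ : z.Holds s B W D t I J)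
    (hJ : z.Holds s B W D t J J) :
    Costs M B z.matrixAddr inp (D ∪ c.rest) (cykStar z t I J) (D ∪ c.rest)
      (4 ^ t * (2 * c.cost) - c.cost) fun _ => True := by
  induction t generalizing I J with
  | zero =>
    refine (updateVariables_costs c (f := 0) hV hM fun A P hA hP y =>
      .orBit _ _ (Sizes.matrixAddr_le_cell _ _ _) ?_ ?_).mono (by simp; linarith)
    · exact Finset.mem_union_left _ (hIJ A hA _ _ (by simp) (by simp))
    · exact Finset.mem_union_left _ (hIJ P hP _ _ (by simp) (by simp))
  | succ t ih =>
    refine (cykStar_costs_succ c (μ := 0) hV hM (fun I' J' h1 h2 => ih (hI.sub h1 h1)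
      (hIJ.sub h1 h2) (hJ.sub h2 h2)) fun P Y Z hP hY hZ I' K' J' h1 h2 h3 y =>
      mma_costs_of_holds ?_ ?_ ?_).mono (by rw [pow_succ]; linarith)
    · exact ((hIJ P hP).sub h1 h2).mono Finset.subset_union_left
    · rcases h3 with h3 | h3
      · exact ((hI Y hY).sub h1 h3).mono Finset.subset_union_left
      · exact ((hIJ Y hY).sub h1 h3).mono Finset.subset_union_left
    · rcases h3 with h3 | h3
      · exact ((hIJ Z hZ).sub h3 h2).mono Finset.subset_union_left
      · exact ((hJ Z hZ).sub h3 h2).mono Finset.subset_union_left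

theorem cykClosure_costs_of_holds {t I : ℕ} (hV : ValidRules z inp W)
    (hM : (D.card + e + 1) * B ≤ M) (hI : z.Holds s B W D t I I) :
    Costs M B z.matrixAddr inp (D ∪ c.rest) (cykClosure z t I) (D ∪ c.rest)
      (4 ^ t * (2 * c.cost)) fun _ => True := by
  have hc := cursor_cost_nonneg c
  induction t generalizing I with
  | zero => exact (Costs.pure _ trivial).mono (by positivity)
  | succ t ih =>
    rcases t with _ | t
    · exact (Costs.pure _ trivial).mono (by positivity)
    · refine Costs.mono ((ih (hI.sub ?_ ?_)).bind fun _ _ => (ih (hI.sub ?_ ?_)).bind fun _ _ =>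
        cykStar_costs_of_holds c hV hM (hI.sub ?_ ?_) (hI.sub ?_ ?_) (hI.sub ?_ ?_)) ?_
      any_goals omega
      have : 0 ≤ 4 ^ (t + 1) * (2 * c.cost) := by positivity
      rw [pow_succ 4 (t + 1)]; linarith

theorem cykStar_costs {k : ℕ} {F μ : ℕ → ℝ} (hV : ValidRules z inp W) (hM : (e + 1) * B ≤ M)
    (hF : ∀ I J, Costs M B z.matrixAddr inp c.rest (cykStar z k I J) c.rest (F k) fun _ => True)
    (hμ : ∀ t, k ≤ t → t ≤ z.level → ∀ D : Finset ℕ, D.card ≤ e → ∀ P Y Z I K J,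
      Costs M B z.matrixAddr inp D (mma z P Y Z t I K J) D (μ t) fun _ => True)
    (hstep : ∀ t, k ≤ t → 4 * F t + 3 * c.cost + 4 * z.rhs * μ t ≤ F (t + 1)) {t : ℕ}
    (hkt : k ≤ t) (ht : t ≤ z.level) (I J : ℕ) :
    Costs M B z.matrixAddr inp c.rest (cykStar z t I J) c.rest (F t) fun _ => True := by
  induction t, hkt using Nat.le_induction generalizing I J with
  | base => exact hF I J
  | succ t hkt ih =>
    have h := cykStar_costs_succ c (D := ∅) (F := F t) (μ := μ t) hV (by simpa using hM)
      (I := I) (J := J)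
      (fun I' J' _ _ => by simpa using ih (by omega) I' J')
      (fun P Y Z _ _ _ I' K' J' _ _ _ y => hμ t hkt (by omega) _
        (by simpa using c.card_pin y) P Y Z I' K' J')
    simpa using h.mono (hstep t hkt)

theorem cykClosure_costs {k : ℕ} {F G : ℕ → ℝ}
    (hF : ∀ t, k ≤ t → t ≤ z.level → ∀ I J,
      Costs M B z.matrixAddr inp c.rest (cykStar z t I J) c.rest (F t) fun _ => True)
    (hG : ∀ I, Costs M B z.matrixAddr inp c.rest (cykClosure z k I) c.rest (G k) fun _ => True)
    (hG0 : ∀ t, 0 ≤ G t) (hstep : ∀ t, k ≤ t → 2 * G t + F t ≤ G (t + 1)) {t : ℕ}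
    (hkt : k ≤ t) (ht : t ≤ z.level) (I : ℕ) :
    Costs M B z.matrixAddr inp c.rest (cykClosure z t I) c.rest (G t) fun _ => True := by
  induction t, hkt using Nat.le_induction generalizing I with
  | base => exact hG I
  | succ t hkt ih =>
    rcases t with _ | t
    -- Closure does nothing at dimension 2, so the general recurrence does not apply; this case
    -- arises only for `k = 0`.
    · exact (Costs.pure _ trivial).mono (hG0 _)
    · exact Costs.mono ((ih (by omega) _).bind fun _ _ => (ih (by omega) _).bind fun _ _ =>
        hF _ hkt (by omega) _ _) ((by linarith : _ ≤ _).trans (hstep _ hkt))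

end Cost

/-! ### Three scanning strategies -/

namespace Cursor

/-- Load each word only for the operation that reads it. -/
noncomputable def single (lo hi : ℕ) : Cursor 1 0 lo hi where
  rest := ∅
  pin _ := ∅
  pot y := y
  cost := (hi : ℝ) - lo
  rest_subset _ := subset_rfl
  card_pin _ := by simp
  step y _ _ := by simp
  scan y y' h1 _ h3 := by
    have h1' : (lo : ℝ) ≤ y := by exact_mod_cast h1
    have h3' : (y' : ℝ) ≤ hi := by exact_mod_cast h3
    simp; linarith

/-- Keep the whole list in the cache. -/
noncomputable def whole (B e lo hi : ℕ) (h : (blocksOf B lo (hi - lo)).card ≤ e) : Cursor B e lo hi where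
  rest := blocksOf B lo (hi - lo)
  pin _ := blocksOf B lo (hi - lo)
  pot _ := 0
  cost := 0
  rest_subset _ := subset_rfl
  card_pin _ := h
  step y h1 h2 := by
    rw [Finset.insert_eq_of_mem (mem_blocksOf h1 (by omega))]; simp
  scan _ _ _ _ _ := by simp

/-- Keep the block that contains the last word that was read. -/
noncomputable def stream (B e lo hi : ℕ) (hB : 0 < B) (he : 1 ≤ e) (hlo : 1 ≤ lo) : Cursor B e lo hi where
  rest := ∅
  pin y := {(y - 1) / B}
  pot y := ((y - 1) / B : ℕ)
  cost := ((hi : ℝ) - lo) / B + 2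
  rest_subset _ := Finset.empty_subset _
  card_pin _ := by simpa using he
  step y h1 _ := by
    obtain ⟨y, rfl⟩ : ∃ x, y = x + 1 := ⟨y - 1, by omega⟩
    simpa using div_succ_sub_div B y ∅
  scan y y' h1 h2 h3 := by
    have hB' : (0 : ℝ) < B := by exact_mod_cast hB
    have a1 : (((y' - 1) / B : ℕ) : ℝ) ≤ ((y' : ℝ) - 1) / B := by
      refine Nat.cast_div_le.trans (le_of_eq ?_)
      rw [Nat.cast_sub (by omega)]; simp
    have a2 : ((y : ℝ) - 1) / B ≤ (((y - 1) / B : ℕ) : ℝ) + 1 := by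
      rw [div_le_iff₀ hB']
      have := Nat.lt_div_mul_add (a := y - 1) hB
      have h4 : ((y - 1 : ℕ) : ℝ) ≤ ((y - 1) / B : ℕ) * B + B := by exact_mod_cast this.le
      rw [Nat.cast_sub (by omega)] at h4
      push_cast at h4 ⊢; linarith
    have a3 : ((y' : ℝ) - 1) / B - ((y : ℝ) - 1) / B ≤ ((hi : ℝ) - lo) / B := by
      rw [← sub_div]
      have h1' : (lo : ℝ) ≤ y := by exact_mod_cast h1
      have h3' : (y' : ℝ) ≤ hi := by exact_mod_cast h3
      exact div_le_div_of_nonneg_right (by linarith) hB'.le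
    simp only [Finset.sdiff_empty, Finset.card_singleton, Nat.cast_one]
    linarith

/-- If `R < B`, the list has fewer than `5 * B` words and lies in at most `4 + 2` blocks, which stay
pinned, and scanning is free. Otherwise streaming costs at most `5 * R / B + 2`, and `2 ≤ 2 * R /
B`. In both cases no additive constant remains. -/
theorem exists_cost_le {B lo hi R : ℕ} (hB : 0 < B) (hlo : 1 ≤ lo) (h : hi ≤ lo + 5 * R) :
    ∃ c : Cursor B 6 lo hi, c.cost ≤ 7 * R / B := by
  have hB' : (0 : ℝ) < B := by exact_mod_cast hB
  by_cases hR : R < B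
  · refine ⟨whole B 6 lo hi ((card_blocksOf_le_div hB _ _).trans ?_), ?_⟩
    · have : (hi - lo) / B < 5 := by rw [Nat.div_lt_iff_lt_mul hB]; omega
      omega
    · simp only [whole]; positivity
  · refine ⟨stream B 6 lo hi hB (by norm_num) hlo, ?_⟩
    have h1 : (hi : ℝ) ≤ lo + 5 * R := by exact_mod_cast h
    have h2 : (B : ℝ) ≤ R := by exact_mod_cast (not_lt.1 hR)
    simp only [stream]
    rw [div_add' _ _ _ hB'.ne']
    gcongr; linarith

variable {s M B base e lo hi : ℕ} {inp : ℕ → BitVec s} {D : Finset ℕ}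
  (c : Cursor B e lo hi)

/-- A terminal rule is read against the direction of the scan: its letter at `y + 1` is compared
first, and its variable at `y` is read only after a match. Both blocks are therefore held during the
whole operation. -/
theorem access_two {α : Type} {p : RAM s α} {Q : α → Prop} {y : ℕ}
    (hM : (D.card + 2 * e + 2) * B ≤ M) (h1 : lo ≤ y) (h2 : y + 1 < hi)
    (h : ∀ S, D ⊆ S → y / B ∈ S → (y + 1) / B ∈ S → Costs M B base inp S p S 0 Q) :
    Costs M B base inp (D ∪ c.pin y) p (D ∪ c.pin (y + 2)) (c.pot (y + 2) - c.pot y) Q := by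
  set E := insert (y / B) (c.pin (y + 1))
  set E' := insert ((y + 1) / B) (c.pin (y + 2))
  have hE : E.card ≤ e + 1 := (Finset.card_insert_le _ _).trans (by simpa using c.card_pin _)
  have hE' : E'.card ≤ e + 1 := (Finset.card_insert_le _ _).trans (by simpa using c.card_pin _)
  have key := h (D ∪ (E ∪ E')) Finset.subset_union_left (by simp [E]) (by simp [E'])
  refine ((key.before (S := D ∪ c.pin y) (fits_of_card_le hM ?_)
    (r' := c.pot (y + 2) - c.pot y) ?_).after_subset (fits_of_card_le hM ?_) ?_).mono (by simp)
  · have h3 := Finset.card_union_le D (E ∪ E')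
    have h4 := Finset.card_union_le E E'
    omega
  · have h3 := c.step y h1 (by omega)
    have h4 := c.step (y + 1) (by omega) h2
    have h5 : (D ∪ (E ∪ E')) \ (D ∪ c.pin y) ⊆ (E \ c.pin y) ∪ (E' \ c.pin (y + 1)) := by
      intro x; simp [E, E']; tauto
    have h6 : (((D ∪ (E ∪ E')) \ (D ∪ c.pin y)).card : ℝ) ≤
        (E \ c.pin y).card + (E' \ c.pin (y + 1)).card := by
      exact_mod_cast (Finset.card_le_card h5).trans (Finset.card_union_le _ _)
    linarith
  · have := c.card_union_pin D (y + 2); omega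
  · intro x; simp [E, E']; tauto

end Cursor

/-! ### Solving the recurrences -/

/-- The number of operations on blocks in the bound on the number of I/O operations. -/
noncomputable def ioBound (z : Sizes) (M B : ℕ) : ℝ :=
  ((z.n : ℝ) ^ 3 * z.rhs / √(M : ℝ) + (z.n : ℝ) ^ 2 * z.rhs * Real.logb 2 M
    + (z.n : ℝ) ^ 2 * z.bin + (z.n : ℝ) * z.term) / B

theorem Sizes.two_pow_level_le {z : Sizes} (hn : z.n ≠ 0) : 2 ^ z.level ≤ 2 * z.n := by
  have h : 2 ^ (z.level - 1) < z.n + 1 := Nat.pow_pred_clog_lt_self (by norm_num) (by omega)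
  have h0 : z.level ≠ 0 := (Nat.clog_pos (by norm_num) (by omega)).ne'
  rw [← Nat.succ_pred_eq_of_ne_zero h0, Nat.pow_succ, Nat.pred_eq_sub_one]
  omega

theorem Sizes.lt_two_pow_level (z : Sizes) : z.n < 2 ^ z.level :=
  Nat.le_pow_clog (by norm_num) (z.n + 1)

/-- Chooses the cutoff: the largest level at which `d` words for each entry of a block still fit in
the cache. -/
theorem exists_pow_four_le {d M : ℕ} (hd : 0 < d) (h : d ≤ M) :
    ∃ k, d * 4 ^ k ≤ M ∧ M < 4 * d * 4 ^ k := by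
  have h0 : M / d ≠ 0 := (Nat.div_pos h hd).ne'
  refine ⟨Nat.log 4 (M / d), ?_, ?_⟩
  · rw [mul_comm]; exact (Nat.le_div_iff_mul_le hd).1 (Nat.pow_log_le_self 4 h0)
  · have := Nat.lt_pow_succ_log_self (b := 4) (by norm_num) (M / d)
    rw [Nat.div_lt_iff_lt_mul hd, pow_succ] at this
    linarith

section Phases

variable {s M B e W : ℕ} {z : Sizes} {inp : ℕ → BitVec s}

/-- Beyond `k₀` each level splits a product into eight, starting from `4 ^ k₀ = 8 ^ k₀ / 2 ^ k₀`. -/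
theorem mma_costs_of_le {k k₀ : ℕ} {D : Finset ℕ} (hB : 0 < B)
    (h : ∀ t, k ≤ t → t ≤ k₀ → t ≤ z.level → ∀ P Y Z I K J,
      Costs M B z.matrixAddr inp D (mma z P Y Z t I K J) D (9 * 4 ^ t / B) fun _ => True)
    (hk : k ≤ k₀) {t : ℕ} (hkt : k ≤ t) (ht : t ≤ z.level) (P Y Z I K J : ℕ) :
    Costs M B z.matrixAddr inp D (mma z P Y Z t I K J) D
      (9 * (if t ≤ k₀ then 4 ^ t else 8 ^ t / 2 ^ k₀) / B) fun _ => True := by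
  have key : ∀ t, k₀ ≤ t → t ≤ z.level → ∀ I K J,
      Costs M B z.matrixAddr inp D (mma z P Y Z t I K J) D
        (9 * (8 ^ t / 2 ^ k₀) / B) fun _ => True := by
    intro t ht
    induction t, ht using Nat.le_induction with
    | base =>
      intro hl I K J
      refine (h k₀ hk le_rfl hl P Y Z I K J).mono (le_of_eq ?_)
      rw [show (8 : ℝ) = 4 * 2 by norm_num, mul_pow]
      field_simp
    | succ t ht ih =>
      intro hl I K J
      refine (mma_costs_succ (ih (by omega)) I K J).mono (le_of_eq ?_)
      rw [pow_succ]; ring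
  split_ifs with hle
  · exact h t hkt hle ht P Y Z I K J
  · exact key t (by omega) ht I K J

/-- Here `k` is the base level, with blocks of at least `B` entries, and `k₀` is the cutoff above
which products no longer fit in the cache. A base call may cost `a * bin`: as `B ≤ 4 ^ k`, this is
`a * bin / B` for each of the `4 ^ k` entries. -/
theorem cykClosure_costs_of_le {k k₀ a : ℕ} (hB : 0 < B) (hV : ValidRules z inp W)
    (hM : (e + 1) * B ≤ M) (hBk : B ≤ 4 ^ k) (hk : k ≤ k₀) (hkl : k ≤ z.level)
    (c : Cursor B e (z.rhsAddr 0) (z.termAddr 0)) (hc : c.cost ≤ 7 * z.bin / B)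
    (hμ : ∀ t, k ≤ t → t ≤ k₀ → t ≤ z.level → ∀ D : Finset ℕ, D.card ≤ e → ∀ P Y Z I K J,
      Costs M B z.matrixAddr inp D (mma z P Y Z t I K J) D (9 * 4 ^ t / B) fun _ => True)
    (hF : ∀ I J, Costs M B z.matrixAddr inp c.rest (cykStar z k I J) c.rest (a * z.bin)
      fun _ => True)
    (hG : ∀ I, Costs M B z.matrixAddr inp c.rest (cykClosure z k I) c.rest (a * z.bin)
      fun _ => True) :
    Costs M B z.matrixAddr inp c.rest (cykClosure z z.level 0) c.rest
      (4 ^ z.level * ((a + 7) * z.bin / B + 9 * z.rhs / B * (k₀ + 1))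
        + 8 ^ z.level * (9 * z.rhs / B / 2 ^ k₀)) fun _ => True := by
  have hB' : (0 : ℝ) < B := by exact_mod_cast hB
  have hB1 : (1 : ℝ) ≤ B := by exact_mod_cast hB
  have hBk' : (B : ℝ) ≤ 4 ^ k := by exact_mod_cast hBk
  have hc0 := cursor_cost_nonneg c
  set α : ℝ := (a + 7) * z.bin / B with hα
  set g : ℝ := 9 * z.rhs / B with hg
  have hα0 : 0 ≤ α := by positivity
  have hg0 : 0 ≤ g := by positivity
  have hbase : (a * z.bin : ℝ) ≤ 4 ^ k * α - c.cost := by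
    have h1 : (a + 7) * (z.bin : ℝ) ≤ 4 ^ k * α := by
      rw [hα, mul_div_assoc', le_div_iff₀ hB', mul_comm]
      gcongr
    have h2 : 7 * (z.bin : ℝ) / B ≤ 7 * z.bin := div_le_self (by positivity) hB1
    linarith
  have hstar : ∀ t, k ≤ t → t ≤ z.level → ∀ I J,
      Costs M B z.matrixAddr inp c.rest (cykStar z t I J) c.rest
        (4 ^ t * (α + g * (k₀ + 1)) + 8 ^ t * (g / 2 ^ k₀)) fun _ => True := by
    intro t hkt ht I J
    refine (cykStar_costs c
      -- Explicit solution of the Star recurrence. The term `- c.cost` absorbs the three scans; a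
      -- level `t ≤ k₀` adds `4 ^ (t + 1) * g`, counted by the minimum; above `k₀` the last term
      -- grows by `8 ^ (t + 1) - 4 * 8 ^ t = 4 * 8 ^ t`, which is what the products cost.
      (F := fun t => 4 ^ t * α - c.cost + 4 ^ t * g * (min t (k₀ + 1) : ℕ) + 8 ^ t * (g / 2 ^ k₀))
      (μ := fun t => 9 * (if t ≤ k₀ then 4 ^ t else 8 ^ t / 2 ^ k₀) / B)
      hV hM (fun I J => (hF I J).mono ?_)
      (fun t hkt ht D hD P Y Z I K J => mma_costs_of_le hB
        (fun t h1 h2 h3 => hμ t h1 h2 h3 D hD) hk hkt ht P Y Z I K J) ?_ hkt ht I J).mono ?_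
    · have : 0 ≤ 4 ^ k * g * (min k (k₀ + 1) : ℕ) := by positivity
      have : 0 ≤ 8 ^ k * (g / 2 ^ k₀) := by positivity
      linarith
    · intro t _
      have hm : 4 * (z.rhs : ℝ) * (9 * (if t ≤ k₀ then 4 ^ t else 8 ^ t / 2 ^ k₀) / B) =
          4 * g * (if t ≤ k₀ then 4 ^ t else 8 ^ t / 2 ^ k₀) := by rw [hg]; ring
      rw [hm, pow_succ, pow_succ]
      have h8 : 0 ≤ 8 ^ t * (g / 2 ^ k₀) := by positivity
      split_ifs with hle
      · rw [min_eq_left (by omega), min_eq_left (by omega)]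
        push_cast; linarith
      · rw [min_eq_right (by omega), min_eq_right (by omega)]
        have : 4 * g * (8 ^ t / 2 ^ k₀) = 4 * (8 ^ t * (g / 2 ^ k₀)) := by ring
        linarith
    · have : ((min t (k₀ + 1) : ℕ) : ℝ) ≤ k₀ + 1 := by exact_mod_cast min_le_right _ _
      have : 4 ^ t * g * (min t (k₀ + 1) : ℕ) ≤ 4 ^ t * g * (k₀ + 1) := by gcongr
      linarith
  refine cykClosure_costs c (F := fun t => 4 ^ t * (α + g * (k₀ + 1)) + 8 ^ t * (g / 2 ^ k₀))
    (G := fun t => 4 ^ t * (α + g * (k₀ + 1)) + 8 ^ t * (g / 2 ^ k₀)) hstar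
    (fun I => (hG I).mono ?_) (fun t => by positivity) ?_ hkl le_rfl 0
  · have : 0 ≤ 4 ^ k * (g * (k₀ + 1)) := by positivity
    have : 0 ≤ 8 ^ k * (g / 2 ^ k₀) := by positivity
    linarith
  · intro t _
    have : 0 ≤ 4 ^ t * (α + g * (k₀ + 1)) := by positivity
    have : 0 ≤ 8 ^ t * (g / 2 ^ k₀) := by positivity
    rw [pow_succ, pow_succ]; linarith

theorem four_pow_level_le (hn : z.n ≠ 0) : (4 : ℝ) ^ z.level ≤ 4 * (z.n : ℝ) ^ 2 := by
  have h : (2 : ℝ) ^ z.level ≤ 2 * z.n := by exact_mod_cast z.two_pow_level_le hn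
  calc (4 : ℝ) ^ z.level = (2 ^ z.level) ^ 2 := by rw [← pow_mul, mul_comm, pow_mul]; norm_num
    _ ≤ (2 * z.n) ^ 2 := by gcongr
    _ = _ := by ring

theorem eight_pow_level_le (hn : z.n ≠ 0) : (8 : ℝ) ^ z.level ≤ 8 * (z.n : ℝ) ^ 3 := by
  have h : (2 : ℝ) ^ z.level ≤ 2 * z.n := by exact_mod_cast z.two_pow_level_le hn
  calc (8 : ℝ) ^ z.level = (2 ^ z.level) ^ 3 := by rw [← pow_mul, mul_comm, pow_mul]; norm_num
    _ ≤ (2 * z.n) ^ 3 := by gcongr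
    _ = _ := by ring

theorem logb_two_nonneg (M : ℕ) : 0 ≤ Real.logb 2 (M : ℝ) := by
  rcases Nat.eq_zero_or_pos M with rfl | h
  · simp
  · exact Real.logb_nonneg (by norm_num) (by exact_mod_cast h)

/-- The factor 64 covers both cutoffs used below (12 and 60) and is a square, so that `√M ≤ 8 * 2 ^
k₀`. The constant 676 is `576 + 72 + 28`, from the cubic, the logarithmic and the binary-rule term.
-/
theorem closure_bound_le {k₀ a : ℕ} (hB : 0 < B) (hn : z.n ≠ 0) (hM2 : 2 ≤ M) (hk : 4 ^ k₀ ≤ M)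
    (hM : M ≤ 64 * 4 ^ k₀) :
    4 ^ z.level * ((a + 7) * z.bin / B + 9 * z.rhs / B * (k₀ + 1))
        + 8 ^ z.level * (9 * z.rhs / B / 2 ^ k₀) ≤ (4 * a + 676) * ioBound z M B := by
  have hB' : (0 : ℝ) < B := by exact_mod_cast hB
  have hM0 : (0 : ℝ) < M := by exact_mod_cast (by omega : 0 < M)
  have hk' : (4 : ℝ) ^ k₀ ≤ M := by exact_mod_cast hk
  have hlog : (k₀ : ℝ) + 1 ≤ 2 * Real.logb 2 M := by
    have h1 : 1 ≤ Real.logb 2 (M : ℝ) := by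
      rw [Real.le_logb_iff_rpow_le (by norm_num) hM0]; simpa using (by exact_mod_cast hM2)
    have h2 : (k₀ : ℝ) ≤ Real.logb 2 (M : ℝ) := by
      rw [Real.le_logb_iff_rpow_le (by norm_num) hM0, Real.rpow_natCast]
      exact (pow_le_pow_left₀ (by norm_num) (by norm_num) _).trans hk'
    linarith
  have hsq : 1 / (2 : ℝ) ^ k₀ ≤ 8 / √(M : ℝ) := by
    rw [div_le_div_iff₀ (by positivity) (Real.sqrt_pos.2 hM0), one_mul, Real.sqrt_le_left (by positivity)]
    calc (M : ℝ) ≤ 64 * 4 ^ k₀ := by exact_mod_cast hM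
      _ = (8 * 2 ^ k₀) ^ 2 := by
        rw [mul_pow, ← pow_mul, mul_comm k₀, pow_mul]; norm_num
  have h4 := four_pow_level_le hn
  have h8 := eight_pow_level_le hn
  calc (4 : ℝ) ^ z.level * ((a + 7) * z.bin / B + 9 * z.rhs / B * (k₀ + 1))
        + 8 ^ z.level * (9 * z.rhs / B / 2 ^ k₀)
      ≤ 4 * (z.n : ℝ) ^ 2 * ((a + 7) * z.bin / B + 9 * z.rhs / B * (2 * Real.logb 2 M))
        + 8 * (z.n : ℝ) ^ 3 * (9 * z.rhs / B * (8 / √(M : ℝ))) := by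
        rw [div_eq_mul_one_div (9 * (z.rhs : ℝ) / B)]
        gcongr
    _ = (576 * ((z.n : ℝ) ^ 3 * z.rhs / √(M : ℝ)) + 72 * ((z.n : ℝ) ^ 2 * z.rhs * Real.logb 2 M)
        + (4 * a + 28) * ((z.n : ℝ) ^ 2 * z.bin)) / B := by
        field_simp; ring
    _ ≤ (4 * a + 676) * ioBound z M B := by
        rw [ioBound, ← mul_div_assoc (4 * (a : ℝ) + 676)]
        have h1 : 0 ≤ (z.n : ℝ) ^ 3 * z.rhs / √(M : ℝ) := by positivity
        have h2 : 0 ≤ (z.n : ℝ) ^ 2 * z.rhs * Real.logb 2 M :=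
          mul_nonneg (by positivity) (logb_two_nonneg M)
        have h3 : 0 ≤ (z.n : ℝ) ^ 2 * z.bin := by positivity
        have h4 : 0 ≤ (z.n : ℝ) * z.term := by positivity
        have ha : (0 : ℝ) ≤ a := by positivity
        refine div_le_div_of_nonneg_right ?_ hB'.le
        linarith [mul_nonneg ha h1, mul_nonneg ha h2, mul_nonneg ha h3, mul_nonneg ha h4]

end Phases

section Phases

variable {s M B e W : ℕ} {z : Sizes} {inp : ℕ → BitVec s}

theorem termAddr_zero_le (h : z.rhs ≤ z.bin) : z.termAddr 0 ≤ z.rhsAddr 0 + 5 * z.bin := by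
  simp only [Sizes.rhsAddr, Sizes.termAddr, Sizes.binAddr]; omega

/-- Words are loaded one by one, nothing is pinned, and the recursion goes down to single entries: a
Star of dimension 2 costs a scan of at most `5 * bin` words and two loads per rule. The value `a =
116` is far from tight here; it gives the same `1140 = 4 * 116 + 676` as in
`cykClosure_costs_blocks`. -/
theorem cykClosure_costs_single (hV : ValidRules z inp W) (hM : 3 ≤ M) (hn : z.n ≠ 0)
    (hΓ : z.rhs ≤ z.bin) :
    Costs M 1 z.matrixAddr inp ∅ (cykClosure z z.level 0) ∅ (1140 * ioBound z M 1)
      fun _ => True := by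
  obtain ⟨k₀, h1, h2⟩ := exists_pow_four_le (d := 3) (by norm_num) hM
  have hcost : (Cursor.single (z.rhsAddr 0) (z.termAddr 0)).cost ≤ 5 * z.bin := by
    have : ((z.termAddr 0 : ℕ) : ℝ) ≤ (z.rhsAddr 0 : ℕ) + 5 * z.bin := by
      exact_mod_cast termAddr_zero_le hΓ
    simp only [Cursor.single]; linarith
  have h := cykClosure_costs_of_le (k := 0) (k₀ := k₀) (a := 116) (M := M) (B := 1) (e := 0)
    one_pos hV (by omega) (by simp) (Nat.zero_le _) (Nat.zero_le _)
    (Cursor.single (z.rhsAddr 0) (z.termAddr 0)) (by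
      have : (0 : ℝ) ≤ z.bin := by positivity
      push_cast; linarith) ?_ ?_ ?_
  · exact h.mono ((closure_bound_le (M := M) (k₀ := k₀) one_pos hn (by omega) (by omega)
      (by omega)).trans (by norm_num))
  · intro t _ ht hl D hD P Y Z I K J
    refine (mma_costs_load hl (fun a => card_blocksOf_le 1 a _) ?_).mono ?_
    · have := Nat.pow_le_pow_right (n := 4) (by norm_num) ht
      omega
    · have : (0 : ℝ) < 4 ^ t := by positivity
      push_cast; linarith
  · intro I J
    have := updateVariables_costs (Cursor.single (z.rhsAddr 0) (z.termAddr 0)) (M := M) (D := ∅)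
      (f := 2) (i := I) (j := J) hV (by simp; omega) fun A P _ _ y => by
        refine (Costs.with_blocks {(z.cell s A I J).1 / 1, (z.cell s P I J).1 / 1}
          (.orBit _ _ (Sizes.matrixAddr_le_cell _ _ _) (by simp) (by simp)) ?_).mono ?_
        · have := Finset.card_le_two (a := (z.cell s A I J).1 / 1) (b := (z.cell s P I J).1 / 1)
          simp only [Cursor.single, Finset.empty_union, Nat.mul_one]
          omega
        · rw [add_zero]; exact_mod_cast Finset.card_le_two
    simp only [Finset.empty_union] at this
    have hb : (0 : ℝ) ≤ z.bin := by positivity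
    exact this.mono (by push_cast; linarith)
  · intro I
    exact (Costs.pure _ trivial).mono (by positivity)

theorem card_allBlocks_le (hB : 0 < B) (hn : z.n ≠ 0) (hW : W ≤ 4 * z.bin) :
    ((z.allBlocks B W).card : ℝ) ≤ 16 * ((z.n : ℝ) ^ 2 * z.bin / B) + 2 := by
  have h1 : ((z.allBlocks B W).card : ℝ) ≤ ((W * 4 ^ z.level / B : ℕ) : ℝ) + 2 := by
    exact_mod_cast card_blocksOf_le_div hB _ _
  have h2 : ((W * 4 ^ z.level / B : ℕ) : ℝ) ≤ ((W * 4 ^ z.level : ℕ) : ℝ) / B := Nat.cast_div_le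
  have hW' : (W : ℝ) ≤ 4 * z.bin := by exact_mod_cast hW
  have h3 : ((W * 4 ^ z.level : ℕ) : ℝ) / B ≤ 4 * z.bin * (4 * (z.n : ℝ) ^ 2) / B := by
    push_cast
    have := four_pow_level_le (z := z) hn
    gcongr
  have h4 : 4 * z.bin * (4 * (z.n : ℝ) ^ 2) / B = 16 * ((z.n : ℝ) ^ 2 * z.bin / B) := by ring
  linarith

theorem card_allBlocks_mul_le (hB : 0 < B) (h : 4 ^ z.level ≤ 4 * B) :
    (z.allBlocks B W).card * B ≤ 4 * (W * B) + 2 * B := by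
  have h1 : (z.allBlocks B W).card ≤ W * 4 ^ z.level / B + 2 := card_blocksOf_le_div hB _ _
  have h2 := Nat.div_mul_le_self (W * 4 ^ z.level) B
  have h3 : W * 4 ^ z.level ≤ W * (4 * B) := Nat.mul_le_mul_left _ h
  have h4 := Nat.mul_le_mul_right B h1
  rw [add_mul] at h4
  linarith

/-- Each of the `W` runs has fewer than `4 * B` words, hence meets at most `3 + 2` blocks. -/
theorem card_fullBlocks_le_five {k I J : ℕ} (hB : 0 < B) (hk : 4 ^ k < 4 * B) :
    (z.fullBlocks B W k I J).card ≤ 5 * W := by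
  refine (Sizes.card_fullBlocks_le hB).trans ?_
  have : 4 ^ k / B < 4 := (Nat.div_lt_iff_lt_mul hB).2 hk
  rw [mul_comm]
  exact Nat.mul_le_mul_right _ (by omega)

theorem ioBound_nonneg (z : Sizes) (M B : ℕ) : 0 ≤ ioBound z M B := by
  have := mul_nonneg (by positivity : 0 ≤ (z.n : ℝ) ^ 2 * z.rhs) (logb_two_nonneg M)
  unfold ioBound; positivity

theorem sq_mul_bin_le_ioBound (z : Sizes) (M B : ℕ) :
    (z.n : ℝ) ^ 2 * z.bin / B ≤ ioBound z M B := by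
  have := mul_nonneg (by positivity : 0 ≤ (z.n : ℝ) ^ 2 * z.rhs) (logb_two_nonneg M)
  have h2 : 0 ≤ (z.n : ℝ) ^ 3 * z.rhs / √(M : ℝ) := by positivity
  have h3 : 0 ≤ (z.n : ℝ) * z.term := by positivity
  unfold ioBound
  exact div_le_div_of_nonneg_right (by linarith) (Nat.cast_nonneg _)

theorem mul_term_le_ioBound (z : Sizes) (M B : ℕ) :
    (z.n : ℝ) * z.term / B ≤ ioBound z M B := by
  have := mul_nonneg (by positivity : 0 ≤ (z.n : ℝ) ^ 2 * z.rhs) (logb_two_nonneg M)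
  have h2 : 0 ≤ (z.n : ℝ) ^ 3 * z.rhs / √(M : ℝ) := by positivity
  have h3 : 0 ≤ (z.n : ℝ) ^ 2 * z.bin := by positivity
  unfold ioBound
  exact div_le_div_of_nonneg_right (by linarith) (Nat.cast_nonneg _)

theorem exists_pow_four_ge {B : ℕ} (hB : 0 < B) : ∃ k, B ≤ 4 ^ k ∧ 4 ^ k < 4 * B := by
  refine ⟨Nat.clog 4 B, Nat.le_pow_clog (by norm_num) B, ?_⟩
  rcases Nat.lt_or_ge 1 B with h1 | h1
  · have h0 := Nat.clog_pos (b := 4) (by norm_num) h1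
    have := Nat.pow_pred_clog_lt_self (b := 4) (by norm_num) h1
    rw [← Nat.succ_pred_eq_of_ne_zero h0.ne', pow_succ]
    omega
  · interval_cases B; simp

/-- The base level `k` has `B ≤ 4 ^ k < 4 * B`. Going further down would load whole blocks of memory
for the sake of a few words; at level `k` the cache can still hold all `W` words of the three matrix
blocks of a Star. -/
theorem cykClosure_costs_blocks (hV : ValidRules z inp W) (hB : 0 < B) (hW : 0 < W)
    (hM : 1000 * W * B ≤ M) (hWR : W ≤ 4 * z.bin) (hn : z.n ≠ 0) (hΓ : z.rhs ≤ z.bin) :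
    ∃ D : Finset ℕ, D.card ≤ 6 ∧ Costs M B z.matrixAddr inp D (cykClosure z z.level 0) D
      (1140 * ioBound z M B + 2) fun _ => True := by
  obtain ⟨c, hc⟩ := Cursor.exists_cost_le (lo := z.rhsAddr 0) (hi := z.termAddr 0) hB
    (by simp only [Sizes.rhsAddr]; omega) (termAddr_zero_le hΓ)
  obtain ⟨k, hk1, hk2⟩ := exists_pow_four_ge hB
  have hB' : (0 : ℝ) < B := by exact_mod_cast hB
  have hBW : B ≤ W * B := Nat.le_mul_of_pos_left _ hW
  have hWR' : (W : ℝ) ≤ 4 * z.bin := by exact_mod_cast hWR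
  have hk2' : (4 : ℝ) ^ k ≤ 4 * B := by exact_mod_cast hk2.le
  rw [mul_assoc] at hM
  refine ⟨c.rest, c.card_rest, ?_⟩
  have hrest : c.rest.card * B ≤ 6 * B := Nat.mul_le_mul_right _ c.card_rest
  have hwith : ∀ {E : Finset ℕ} {p : RAM s Unit} {r : ℝ}, E.card * B ≤ 15 * (W * B) + 2 * B →
      ((E.card + 6 + 1) * B ≤ M → Costs M B z.matrixAddr inp (E ∪ c.rest) p (E ∪ c.rest) r
        fun _ => True) →
      Costs M B z.matrixAddr inp c.rest p c.rest (E.card + r) fun _ => True := by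
    intro E p r hE h
    refine Costs.with_blocks E ?_ ?_
    · rw [Finset.union_comm]
      exact h (by linarith)
    · refine (Nat.mul_le_mul_right _ (Finset.card_union_le _ _)).trans ?_
      linarith
  have hcost : 4 ^ k * (2 * c.cost) ≤ 56 * (z.bin : ℝ) := by
    have h1 : c.cost * B ≤ 7 * z.bin := (le_div_iff₀ hB').1 hc
    have h2 : 4 ^ k * (2 * c.cost) ≤ 4 * B * (2 * c.cost) :=
      mul_le_mul_of_nonneg_right hk2' (by linarith [cursor_cost_nonneg c])
    linarith
  by_cases hkl : k ≤ z.level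
  -- For `B ≤ 4 ^ t`, a product needs three runs of `4 ^ t / B + 2` blocks next to six pinned
  -- blocks: at most `3 * 4 ^ t + 6 * B + 6 * B ≤ 15 * 4 ^ t` words.
  · obtain ⟨k₀, h1, h2⟩ := exists_pow_four_le (d := 15) (M := M) (by norm_num) (by linarith)
    have hkk : k ≤ k₀ := by
      by_contra hlt
      have := Nat.pow_le_pow_right (n := 4) (by norm_num) (show k₀ + 1 ≤ k by omega)
      rw [pow_succ] at this
      omega
    -- `116 = 60 + 56`: loading `15 * W ≤ 60 * bin` blocks, and the scans bounded by `hcost`.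
    have h := cykClosure_costs_of_le (k := k) (k₀ := k₀) (a := 116) (M := M) hB hV (by linarith)
      hk1 hkk hkl c hc ?_ ?_ ?_
    · exact h.mono (le_trans (closure_bound_le (M := M) (k₀ := k₀) hB hn (by omega) (by omega) (by omega))
        (by push_cast; linarith))
    · intro t hkt ht hl D hD P Y Z I K J
      have hBt : B ≤ 4 ^ t := hk1.trans (Nat.pow_le_pow_right (by norm_num) hkt)
      have hMt : 15 * 4 ^ t ≤ M :=
        (Nat.mul_le_mul_left _ (Nat.pow_le_pow_right (by norm_num) ht)).trans h1
      refine (mma_costs_load hl (fun a => card_blocksOf_le_div hB a _) ?_).mono ?_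
      · have h3 := Nat.div_mul_le_self (4 ^ t) B
        have h4 := Nat.mul_le_mul_right B hD
        linarith
      · have h3 : ((4 ^ t / B : ℕ) : ℝ) ≤ ((4 ^ t : ℕ) : ℝ) / B := Nat.cast_div_le
        have h4 : (1 : ℝ) ≤ 4 ^ t / B := by
          rw [one_le_div hB']; exact_mod_cast hBt
        rw [mul_div_assoc]
        push_cast at h3 ⊢; linarith
    · intro I J
      have hE : (z.fullBlocks B W k I I ∪ (z.fullBlocks B W k I J ∪ z.fullBlocks B W k J J)).card
          ≤ 15 * W := by
        have h3 := Finset.card_union_le (z.fullBlocks B W k I I)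
          (z.fullBlocks B W k I J ∪ z.fullBlocks B W k J J)
        have h4 := Finset.card_union_le (z.fullBlocks B W k I J) (z.fullBlocks B W k J J)
        have h5 := card_fullBlocks_le_five (z := z) (W := W) (I := I) (J := I) hB hk2
        have h6 := card_fullBlocks_le_five (z := z) (W := W) (I := I) (J := J) hB hk2
        have h7 := card_fullBlocks_le_five (z := z) (W := W) (I := J) (J := J) hB hk2
        omega
      refine (hwith (E := z.fullBlocks B W k I I ∪
          (z.fullBlocks B W k I J ∪ z.fullBlocks B W k J J)) ?_ fun hM =>
        cykStar_costs_of_holds c hV hM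
        ((Sizes.holds_fullBlocks hkl).mono ?_) ((Sizes.holds_fullBlocks hkl).mono ?_)
        ((Sizes.holds_fullBlocks hkl).mono ?_)).mono ?_
      · exact (Nat.mul_le_mul_right B hE).trans (by linarith)
      · exact Finset.subset_union_left
      · exact Finset.subset_union_left.trans Finset.subset_union_right
      · exact Finset.subset_union_right.trans Finset.subset_union_right
      · have : ((z.fullBlocks B W k I I ∪
          (z.fullBlocks B W k I J ∪ z.fullBlocks B W k J J)).card : ℝ) ≤ 15 * W := by
          exact_mod_cast hE
        have := cursor_cost_nonneg c
        push_cast; linarith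
    · intro I
      have hE := card_fullBlocks_le_five (z := z) (W := W) (I := I) (J := I) hB hk2
      refine (hwith ?_ fun hM => cykClosure_costs_of_holds c hV hM
        (Sizes.holds_fullBlocks hkl)).mono ?_
      · exact (Nat.mul_le_mul_right B hE).trans (by linarith)
      · have : ((z.fullBlocks B W k I I).card : ℝ) ≤ 5 * W := by exact_mod_cast hE
        push_cast; linarith
  -- The whole matrix is smaller than a base block, so it is loaded once and stays in the cache.
  · have hl : 4 ^ z.level ≤ 4 * B :=
      (Nat.pow_le_pow_right (by norm_num) (by omega : z.level ≤ k)).trans hk2.le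
    refine (hwith ?_ fun hM => cykClosure_costs_of_holds c hV hM
      (D := z.allBlocks B W) Sizes.holds_allBlocks).mono ?_
    · exact (card_allBlocks_mul_le hB hl).trans (by linarith)
    · have h1 := card_allBlocks_le hB hn hWR
      have h2 := sq_mul_bin_le_ioBound z M B
      have h3 : 4 ^ z.level * (2 * c.cost) ≤ 4 * (z.n : ℝ) ^ 2 * (2 * (7 * z.bin / B)) := by
        have := four_pow_level_le (z := z) hn
        have := cursor_cost_nonneg c
        gcongr
      have h4 : 4 * (z.n : ℝ) ^ 2 * (2 * (7 * z.bin / B)) = 56 * ((z.n : ℝ) ^ 2 * z.bin / B) := by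
        ring
      have h5 := ioBound_nonneg z M B
      linarith

theorem cykInit_costs_single (hM : 3 ≤ M) :
    Costs M 1 z.matrixAddr inp ∅ (cykInit z) ∅ (4 * ioBound z M 1) fun _ => True := by
  refine (Costs.forM_range_const fun i _ => Costs.forM_range_const (c := 4) fun r _ => ?_).mono
    (r := z.n * (z.term * 4)) ?_
  -- Two loads for the comparison, then one to read the variable and one to set its bit.
  · refine Costs.mono (r := 2 + 2) (Costs.bind (Q := fun _ => True) (S' := ∅)
      ((Costs.with_blocks {(z.termAddr r + 1) / 1, Sizes.strAddr i / 1}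
        (.eqWords _ _ (by simp) (by simp)) ?_).mono ?_) fun b _ => ?_) (by norm_num)
    · have := Finset.card_le_two (a := (z.termAddr r + 1) / 1) (b := Sizes.strAddr i / 1)
      rw [Finset.empty_union]; omega
    · rw [add_zero]; exact_mod_cast Finset.card_le_two
    · cases b
      · exact (Costs.pure _ trivial).mono (by norm_num)
      · refine Costs.mono (r := 1 + 1) (Costs.bind
          ((Costs.with_blocks {z.termAddr r / 1} (.readWord _ (by simp)) ?_).mono (by simp))
          fun A _ => (Costs.with_blocks {(z.cell s A i (i + 1)).1 / 1}
            (.setBit _ (Sizes.matrixAddr_le_cell _ _ _) (by simp)) ?_).mono (by simp))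
          (by norm_num)
        all_goals simp; omega
  · have := mul_term_le_ioBound z M 1
    simp only [Nat.cast_one, div_one] at this
    linarith

/-- The first words of the terminal rules are indices whose bit is in one of the first `W` words
of a set of variables. -/
def ValidTerms (z : Sizes) (inp : ℕ → BitVec s) (W : ℕ) : Prop :=
  ∀ r < z.term, (inp (z.termAddr r)).toNat / s < W

/-- While character `i` is processed, its block and the blocks `X i` with the entry `(i, i + 1)`
stay cached, so matching rules cause no loads of their own. The movement of `X` is charged to the
potential `ξ`, that of the string position to `n / B + 1`, and each character pays one scan of the
terminal rules. -/
theorem cykInit_costs_of_blocks (hT : ValidTerms z inp W) (hB : 0 < B) {χ : ℕ}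
    (hM : (χ + 20) * B ≤ M) (c : Cursor B 6 (z.termAddr 0) (z.termAddr z.term))
    {X : ℕ → Finset ℕ} {ξ : ℕ → ℝ} (hχ : ∀ i, (X i).card ≤ χ)
    (hξ : ∀ i, ((X (i + 1) \ X i).card : ℝ) ≤ ξ (i + 1) - ξ i)
    (hX : ∀ i v, v / s < W → (z.cell s v i (i + 1)).1 / B ∈ X i) :
    ∃ S, Costs M B z.matrixAddr inp ∅ (cykInit z) S
      (χ + 7 + (z.n * c.cost + (z.n / B + 1) + (ξ z.n - ξ 0))) fun _ => True := by
  set D : ℕ → Finset ℕ := fun i => insert (Sizes.strAddr i / B) (X i) with hD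
  have hDc : ∀ i, (D i).card ≤ χ + 1 := fun i =>
    (Finset.card_insert_le _ _).trans (Nat.succ_le_succ (hχ i))
  have hDr : ∀ i, (D i ∪ c.rest).card ≤ χ + 7 := fun i =>
    (Finset.card_union_le _ _).trans (by have := hDc i; have := c.card_rest; omega)
  have hfit : ∀ i, (D i ∪ c.rest).card * B ≤ M := fun i =>
    Cursor.fits_of_card_le hM ((hDr i).trans (by omega))
  set d : ℕ → ℝ := fun i => ((Sizes.strAddr i / B : ℕ) : ℝ) + ξ i with hd
  have hstep : ∀ i, (((D (i + 1) ∪ c.rest) \ (D i ∪ c.rest)).card : ℝ) ≤ d (i + 1) - d i := by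
    intro i
    have h1 := div_succ_sub_div B (Sizes.strAddr i) ∅
    have h2 := hξ i
    have h3 : (D (i + 1) ∪ c.rest) \ (D i ∪ c.rest) ⊆
        (insert ((Sizes.strAddr i + 1) / B) ∅ \ insert (Sizes.strAddr i / B) ∅) ∪
          (X (i + 1) \ X i) := by
      intro x
      simp only [hD, Sizes.strAddr, Finset.mem_sdiff, Finset.mem_union, Finset.mem_insert,
        Finset.notMem_empty, add_assoc]
      tauto
    have h4 : (((D (i + 1) ∪ c.rest) \ (D i ∪ c.rest)).card : ℝ) ≤
        (insert ((Sizes.strAddr i + 1) / B) ∅ \ insert (Sizes.strAddr i / B) ∅ : Finset ℕ).card +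
          (X (i + 1) \ X i).card := by
      exact_mod_cast (Finset.card_le_card h3).trans (Finset.card_union_le _ _)
    have h5 : Sizes.strAddr (i + 1) = Sizes.strAddr i + 1 := rfl
    simp only [hd, h5]
    linarith
  have key := Costs.forM_range (M := M) (B := B) (base := z.matrixAddr) (inp := inp) (N := z.n)
    (T := fun i => D i ∪ c.rest)
    (c := fun i => c.cost + (d (i + 1) - d i)) (body := fun i =>
    (List.range z.term).forM fun r => do
      if ← RAM.eqWords (z.termAddr r + 1) (Sizes.strAddr i) then
        let A ← RAM.readWord (z.termAddr r)
        RAM.setBit (z.cell s A i (i + 1))) fun i _ => by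
    refine Costs.after (S' := D i ∪ c.rest) ?_ (hfit _) (hstep i)
    refine (c.scan_records (a := z.termAddr 0) (w := 2) (r := 0)
      (le_trans (Nat.mul_le_mul_right _ (by have := hDc i; omega)) hM)
      le_rfl (by simp only [Sizes.termAddr]; omega) fun r hr => ?_).mono (by simp)
    have e0 : z.termAddr r = z.termAddr 0 + 2 * r := by simp only [Sizes.termAddr]; omega
    have hlt : z.termAddr 0 + 2 * r + 2 ≤ z.termAddr z.term := by
      simp only [Sizes.termAddr]; omega
    have hv := hT r hr
    rw [e0] at hv ⊢
    refine (c.access_two (y := z.termAddr 0 + 2 * r)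
      (le_trans (Nat.mul_le_mul_right _ (by have := hDc i; omega)) hM)
      (by omega) (by omega) fun S hS h0 h1 => ?_).mono (by rw [mul_add, add_zero, mul_one,
        ← add_assoc])
    refine Costs.mono (r := 0 + (0 + 0)) ((Costs.eqWords _ _ h1
      (hS (Finset.mem_insert_self _ _))).bind fun b _ => ?_) (by simp)
    cases b
    · exact (Costs.pure _ trivial).mono (by simp)
    · refine (Costs.readWord _ h0).bind fun A hA => .setBit _ (Sizes.matrixAddr_le_cell _ _ _)
        (hS (Finset.mem_insert_of_mem (hX i A ?_)))
      rw [hA (by simp only [Sizes.matrixAddr]; omega)]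
      exact hv
  refine ⟨_, (key.before (hfit 0) (r' := χ + 7) ?_).mono ?_⟩
  · rw [Finset.sdiff_empty]; exact_mod_cast hDr 0
  · rw [Finset.sum_add_distrib, Finset.sum_range_sub]
    have hB' : (0 : ℝ) < B := by exact_mod_cast hB
    have h1 : ((Sizes.strAddr z.n / B : ℕ) : ℝ) ≤ z.n / B + (((2 / B : ℕ) : ℝ) + 1) := by
      have h2 : Sizes.strAddr z.n / B ≤ z.n / B + 2 / B + 1 := by
        have := Nat.add_div (a := z.n) (b := 2) hB
        rw [Sizes.strAddr, add_comm 2, this]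
        split_ifs <;> omega
      have h3 : ((z.n / B : ℕ) : ℝ) ≤ (z.n : ℝ) / B := Nat.cast_div_le
      have h4 : ((Sizes.strAddr z.n / B : ℕ) : ℝ) ≤ (z.n / B : ℕ) + (2 / B : ℕ) + 1 := by
        exact_mod_cast h2
      linarith
    simp only [hd, Sizes.strAddr, Finset.sum_const, Finset.card_range, nsmul_eq_mul,
      Nat.add_zero] at h1 ⊢
    linarith

/-- The entries `(i, i + 1)` move along the superdiagonal and enter a new row of base blocks only
about `n / 2 ^ k` times. Each change loads at most `10 * W` blocks, in total `O(n ^ 2 * bin / B)`,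
because `2 ^ k ≤ 2 * n` and `B ≤ 4 ^ k`. -/
theorem cykInit_costs_blocks (hT : ValidTerms z inp W) (hB : 0 < B) (hW : 0 < W)
    (hM : 1000 * W * B ≤ M) (hWR : W ≤ 4 * z.bin) (hn : z.n ≠ 0) :
    ∃ S, Costs M B z.matrixAddr inp ∅ (cykInit z) S (300 * ioBound z M B + 10)
      fun _ => True := by
  obtain ⟨c, hc⟩ := Cursor.exists_cost_le (lo := z.termAddr 0) (hi := z.termAddr z.term)
    (R := z.term) hB (by simp only [Sizes.termAddr, Sizes.binAddr, Sizes.rhsAddr]; omega)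
    (by simp only [Sizes.termAddr]; omega)
  obtain ⟨k, hk1, hk2⟩ := exists_pow_four_ge hB
  have hB' : (0 : ℝ) < B := by exact_mod_cast hB
  have hBW : B ≤ W * B := Nat.le_mul_of_pos_left _ hW
  have hWR' : (W : ℝ) ≤ 4 * z.bin := by exact_mod_cast hWR
  have hR1 : (1 : ℝ) ≤ z.bin := by exact_mod_cast (show 1 ≤ z.bin by omega)
  have hn1 : (1 : ℝ) ≤ z.n := by exact_mod_cast (show 1 ≤ z.n by omega)
  rw [mul_assoc] at hM
  have i1 := sq_mul_bin_le_ioBound z M B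
  have i2 := mul_term_le_ioBound z M B
  have i3 : z.n * c.cost ≤ 7 * ((z.n : ℝ) * z.term / B) := by
    calc z.n * c.cost ≤ z.n * (7 * z.term / B) := by gcongr
      _ = _ := by ring
  have i4 : (z.n : ℝ) / B ≤ (z.n : ℝ) ^ 2 * z.bin / B := by
    refine div_le_div_of_nonneg_right ?_ hB'.le
    calc (z.n : ℝ) = z.n * 1 * 1 := by ring
      _ ≤ z.n * z.n * z.bin := by gcongr
      _ = _ := by ring
  have i5 := ioBound_nonneg z M B
  by_cases hkl : k ≤ z.level
  · have hpow : (2 : ℝ) ^ k ≤ 2 * z.n := by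
      have : (2 : ℝ) ^ z.level ≤ 2 * z.n := by exact_mod_cast z.two_pow_level_le hn
      exact (pow_le_pow_right₀ (by norm_num) hkl).trans this
    have hBk : (B : ℝ) ≤ 2 ^ k * 2 ^ k := by
      rw [← mul_pow]; norm_num; exact_mod_cast hk1
    -- The entry `(i, i + 1)` lies in a diagonal base block or, at the end of a block row, in the
    -- block to its right.
    let X : ℕ → Finset ℕ := fun i => z.fullBlocks B W k (i / 2 ^ k) (i / 2 ^ k) ∪
      z.fullBlocks B W k (i / 2 ^ k) (i / 2 ^ k + 1)
    have hχ : ∀ i, (X i).card ≤ 10 * W := by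
      intro i
      have h1 := card_fullBlocks_le_five (z := z) (W := W) (I := i / 2 ^ k) (J := i / 2 ^ k) hB hk2
      have h2 := card_fullBlocks_le_five (z := z) (W := W) (I := i / 2 ^ k) (J := i / 2 ^ k + 1)
        hB hk2
      refine (Finset.card_union_le _ _).trans (by omega)
    have hξ : ∀ i, ((X (i + 1) \ X i).card : ℝ) ≤ 10 * W * (((i + 1) / 2 ^ k : ℕ) : ℝ) -
        10 * W * ((i / 2 ^ k : ℕ) : ℝ) := by
      intro i
      have hle : i / 2 ^ k ≤ (i + 1) / 2 ^ k := Nat.div_le_div_right (Nat.le_succ i)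
      rcases hle.eq_or_lt with heq | hlt
      · simp [X, heq]
      · have h1 := card_fullBlocks_le_five (z := z) (W := W) (I := (i + 1) / 2 ^ k)
          (J := (i + 1) / 2 ^ k) hB hk2
        have h2 := card_fullBlocks_le_five (z := z) (W := W) (I := (i + 1) / 2 ^ k)
          (J := (i + 1) / 2 ^ k + 1) hB hk2
        rw [← mul_sub, ← Nat.cast_sub hle]
        have h3 : 10 * W * 1 ≤ 10 * W * ((i + 1) / 2 ^ k - i / 2 ^ k) :=
          Nat.mul_le_mul_left _ (by omega)
        have h4 : (X (i + 1)).card ≤ _ := Finset.card_union_le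
          (z.fullBlocks B W k ((i + 1) / 2 ^ k) ((i + 1) / 2 ^ k))
          (z.fullBlocks B W k ((i + 1) / 2 ^ k) ((i + 1) / 2 ^ k + 1))
        exact_mod_cast (Finset.card_le_card Finset.sdiff_subset).trans (by omega)
    have hX : ∀ i v, v / s < W → (z.cell s v i (i + 1)).1 / B ∈ X i := by
      intro i v hv
      simp only [X, Finset.mem_union]
      have h1 : i / 2 ^ k ≤ (i + 1) / 2 ^ k := Nat.div_le_div_right (Nat.le_succ i)
      have h2 : (i + 1) / 2 ^ k ≤ i / 2 ^ k + 1 := by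
        rw [← Nat.add_div_right _ (by positivity : 0 < 2 ^ k)]
        exact Nat.div_le_div_right (by have := Nat.one_le_two_pow (n := k); omega)
      rcases h1.eq_or_lt with heq | hlt
      · exact .inl (Sizes.holds_fullBlocks hkl v hv _ _ rfl heq.symm)
      · exact .inr (Sizes.holds_fullBlocks hkl v hv _ _ rfl (by omega))
    obtain ⟨S, h⟩ := cykInit_costs_of_blocks (M := M) hT hB (by linarith) c
      (ξ := fun i => 10 * W * ((i / 2 ^ k : ℕ) : ℝ)) hχ hξ hX
    refine ⟨S, h.mono ?_⟩
    have h1 : (W : ℝ) ≤ 16 * ((z.n : ℝ) ^ 2 * z.bin / B) := by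
      rw [← mul_div_assoc, le_div_iff₀ hB']
      calc (W : ℝ) * B ≤ 4 * z.bin * (2 * z.n * (2 * z.n)) := by
            gcongr
            exact hBk.trans (by gcongr)
        _ = _ := by ring
    have h2 : (W : ℝ) * ((z.n / 2 ^ k : ℕ) : ℝ) ≤ 8 * ((z.n : ℝ) ^ 2 * z.bin / B) := by
      have h3 : ((z.n / 2 ^ k : ℕ) : ℝ) ≤ z.n / 2 ^ k := by
        exact Nat.cast_div_le.trans (by push_cast; exact le_rfl)
      have h4 : (z.n : ℝ) / 2 ^ k ≤ 2 * z.n ^ 2 / B := by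
        rw [div_le_div_iff₀ (by positivity) hB']
        calc (z.n : ℝ) * B ≤ z.n * (2 ^ k * 2 ^ k) := by gcongr
          _ ≤ z.n * (2 * z.n * 2 ^ k) := by gcongr
          _ = _ := by ring
      calc (W : ℝ) * ((z.n / 2 ^ k : ℕ) : ℝ) ≤ 4 * z.bin * (2 * z.n ^ 2 / B) := by
            gcongr; exact h3.trans h4
        _ = _ := by ring
    simp only [Nat.zero_div, Nat.cast_zero, mul_zero, sub_zero]
    push_cast
    linarith
  · have hl : 4 ^ z.level ≤ 4 * B :=
      (Nat.pow_le_pow_right (by norm_num) (by omega : z.level ≤ k)).trans hk2.le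
    have hfit := card_allBlocks_mul_le (W := W) hB hl
    obtain ⟨S, h⟩ := cykInit_costs_of_blocks (M := M) hT hB (χ := (z.allBlocks B W).card) (by linarith) c
      (X := fun _ => z.allBlocks B W) (ξ := fun _ => 0) (fun _ => le_rfl) (by simp)
      fun i v hv => Sizes.holds_allBlocks (k := 0) v hv _ _ rfl rfl
    refine ⟨S, h.mono ?_⟩
    have h1 := card_allBlocks_le hB hn hWR
    linarith

end Phases

/-! ### Correctness: bits of the matrix and invariants -/

theorem zOrder_injective {t i j i' j' : ℕ} (hi : i < 2 ^ t) (hj : j < 2 ^ t) (hi' : i' < 2 ^ t)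
    (hj' : j' < 2 ^ t) (h : zOrder t i j = zOrder t i' j') : i = i' ∧ j = j' := by
  induction t generalizing i j i' j' with
  | zero => simp at hi hj hi' hj'; omega
  | succ t ih =>
    rw [pow_succ] at hi hj hi' hj'
    simp only [zOrder] at h
    have := ih (i := i / 2) (j := j / 2) (i' := i' / 2) (j' := j' / 2) (by omega) (by omega)
      (by omega) (by omega) (by omega)
    omega

/-- The bounds on the indices matter: `zOrder` ignores all higher digits. -/
theorem Sizes.cell_injective {z : Sizes} {s v i j v' i' j' : ℕ} (hi : i < 2 ^ z.level)
    (hj : j < 2 ^ z.level) (hi' : i' < 2 ^ z.level) (hj' : j' < 2 ^ z.level)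
    (h : z.cell s v i j = z.cell s v' i' j') : v = v' ∧ i = i' ∧ j = j' := by
  simp only [cell, Prod.mk.injEq] at h
  obtain ⟨h1, h2⟩ := h
  have l1 := zOrder_lt z.level i j
  have l2 := zOrder_lt z.level i' j'
  have h3 : v / s * 4 ^ z.level + zOrder z.level i j =
      v' / s * 4 ^ z.level + zOrder z.level i' j' := by omega
  have hpos : 0 < 4 ^ z.level := by positivity
  have hd : v / s = v' / s := by
    have := congrArg (· / 4 ^ z.level) h3
    simpa [Nat.add_div_of_dvd_right (Dvd.intro_left _ rfl), Nat.div_eq_of_lt l1,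
      Nat.div_eq_of_lt l2, hpos.ne'] using this
  rw [hd] at h3
  exact ⟨by rw [← Nat.div_add_mod v s, hd, h2, Nat.div_add_mod],
    zOrder_injective hi hj hi' hj' (by omega)⟩

/-- The bit for the variable `v` in entry `(i, j)` of `X` is set. -/
def HasBit {s : ℕ} (z : Sizes) (mem : ℕ → BitVec s) (v i j : ℕ) : Prop :=
  (mem (z.cell s v i j).1).getLsbD (z.cell s v i j).2 = true

/-- Every bit that is set in the first memory is set in the second one. -/
def BitsLE {s : ℕ} (mem mem' : ℕ → BitVec s) : Prop :=
  ∀ a b, (mem a).getLsbD b = true → (mem' a).getLsbD b = true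

namespace BitsLE

variable {s : ℕ} {x y w : ℕ → BitVec s}

theorem refl (x : ℕ → BitVec s) : BitsLE x x := fun _ _ h => h

theorem trans (h : BitsLE x y) (h' : BitsLE y w) : BitsLE x w := fun a b hab => h' a b (h a b hab)

theorem hasBit {z : Sizes} {v i j : ℕ} (h : BitsLE x y) (hb : HasBit z x v i j) :
    HasBit z y v i j := h _ _ hb

end BitsLE

namespace Sizes

variable (z : Sizes) {s : ℕ} (inp : ℕ → BitVec s)

/-- The placeholder of the `p`-th right-hand side, according to the input words `inp`. -/
def rhsPlaceholder (p : ℕ) : ℕ := (inp (z.rhsAddr p)).toNat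

/-- The first variable of the `p`-th right-hand side. -/
def rhsFst (p : ℕ) : ℕ := (inp (z.rhsAddr p + 1)).toNat

/-- The second variable of the `p`-th right-hand side. -/
def rhsSnd (p : ℕ) : ℕ := (inp (z.rhsAddr p + 2)).toNat

/-- The left-hand side of the `r`-th binary rule. -/
def binLhs (r : ℕ) : ℕ := (inp (z.binAddr r)).toNat

/-- The placeholder of the right-hand side of the `r`-th binary rule. -/
def binPlaceholder (r : ℕ) : ℕ := (inp (z.binAddr r + 1)).toNat

/-- The left-hand side of the `r`-th terminal rule. -/
def termLhs (r : ℕ) : ℕ := (inp (z.termAddr r)).toNat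

/-- The `r`-th terminal rule derives the `i`-th character of the input string. -/
def Matches (r i : ℕ) : Prop := inp (z.termAddr r + 1) = inp (strAddr i)

end Sizes

/-- The relation `D v i j` (the variable or placeholder `v` derives the characters `i, …, j - 1`)
obeys the rules listed in the input words `inp`, and all indices there are below `V`. -/
structure RuleSemantics {s : ℕ} (z : Sizes) (inp : ℕ → BitVec s) (V : ℕ)
    (D : ℕ → ℕ → ℕ → Prop) : Prop where
  s_pos : 0 < s
  lt : ∀ {v i j}, D v i j → i < j
  rhsPlaceholder_lt : ∀ p < z.rhs, z.rhsPlaceholder inp p < V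
  rhsFst_lt : ∀ p < z.rhs, z.rhsFst inp p < V
  rhsSnd_lt : ∀ p < z.rhs, z.rhsSnd inp p < V
  binLhs_lt : ∀ r < z.bin, z.binLhs inp r < V
  binPlaceholder_lt : ∀ r < z.bin, z.binPlaceholder inp r < V
  termLhs_lt : ∀ r < z.term, z.termLhs inp r < V
  mul : ∀ p < z.rhs, ∀ {i k j}, D (z.rhsFst inp p) i k → D (z.rhsSnd inp p) k j →
    D (z.rhsPlaceholder inp p) i j
  bin : ∀ r < z.bin, ∀ {i j}, D (z.binPlaceholder inp r) i j → D (z.binLhs inp r) i j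
  term : ∀ r < z.term, ∀ i < z.n, z.Matches inp r i → D (z.termLhs inp r) i (i + 1)
  complete : ∀ {v i j}, D v i j →
    (∃ r < z.term, i < z.n ∧ j = i + 1 ∧ v = z.termLhs inp r ∧ z.Matches inp r i) ∨
    (∃ p < z.rhs, v = z.rhsPlaceholder inp p ∧
      ∃ k, D (z.rhsFst inp p) i k ∧ D (z.rhsSnd inp p) k j) ∨
    ∃ r < z.bin, v = z.binLhs inp r ∧ ∃ p < z.rhs, z.binPlaceholder inp r = z.rhsPlaceholder inp p ∧
      ∃ k, D (z.rhsFst inp p) i k ∧ D (z.rhsSnd inp p) k j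

/-- The input is intact, and every bit that is set is justified by `D`. -/
structure SoundMemory {s : ℕ} (z : Sizes) (inp : ℕ → BitVec s) (V : ℕ) (D : ℕ → ℕ → ℕ → Prop)
    (mem : ℕ → BitVec s) : Prop where
  input : ∀ a < z.matrixAddr, mem a = inp a
  sound : ∀ v < V, ∀ i < 2 ^ z.level, ∀ j < 2 ^ z.level, HasBit z mem v i j → D v i j

/-- Started on a sound memory with the property `pre`, the program `p` ends with a sound memory
with the property `post`, in which no bit was cleared. -/
def Achieves {s : ℕ} (z : Sizes) (inp : ℕ → BitVec s) (V : ℕ) (D : ℕ → ℕ → ℕ → Prop)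
    {α : Type} (p : RAM s α) (pre post : (ℕ → BitVec s) → Prop) : Prop :=
  ∀ m : Machine s, SoundMemory z inp V D m.mem → pre m.mem →
    SoundMemory z inp V D (p m).2.mem ∧ BitsLE m.mem (p m).2.mem ∧ post (p m).2.mem

/-- A property of the memory that is preserved when bits are set. -/
def UpClosed {s : ℕ} (pre : (ℕ → BitVec s) → Prop) : Prop :=
  ∀ x y, BitsLE x y → pre x → pre y

/-- Block `(I, J)` of level `t` contains all bits that it should. -/
def FullBlock {s : ℕ} (z : Sizes) (V : ℕ) (D : ℕ → ℕ → ℕ → Prop) (t I J : ℕ)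
    (mem : ℕ → BitVec s) : Prop :=
  ∀ v < V, ∀ i j, i / 2 ^ t = I → j / 2 ^ t = J → D v i j → HasBit z mem v i j

/-- Block `(I, J)` of level `t` of `P` contains the products `Y * Z` with intermediate indices in
the interval from `lo` to `hi - 1`. -/
def HasProducts {s : ℕ} (z : Sizes) (D : ℕ → ℕ → ℕ → Prop) (P Y Z t I J lo hi : ℕ)
    (mem : ℕ → BitVec s) : Prop :=
  ∀ i k j, i / 2 ^ t = I → j / 2 ^ t = J → lo ≤ k → k < hi → D Y i k → D Z k j → HasBit z mem P i j

/-- The bits for the terminal rules are set. -/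
def HasTerminals {s : ℕ} (z : Sizes) (inp mem : ℕ → BitVec s) : Prop :=
  ∀ i < z.n, ∀ r < z.term, z.Matches inp r i → HasBit z mem (z.termLhs inp r) i (i + 1)

section UpClosed

variable {s : ℕ} {z : Sizes} {inp : ℕ → BitVec s} {V : ℕ} {D : ℕ → ℕ → ℕ → Prop}
  {pre pre' : (ℕ → BitVec s) → Prop}

theorem UpClosed.and (h : UpClosed pre) (h' : UpClosed pre') :
    UpClosed fun m => pre m ∧ pre' m := fun x y hxy hx => ⟨h x y hxy hx.1, h' x y hxy hx.2⟩

theorem upClosed_true : UpClosed fun _ : ℕ → BitVec s => True := fun _ _ _ h => h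

theorem upClosed_fullBlock {t I J : ℕ} : UpClosed (s := s) (FullBlock z V D t I J) :=
  fun _ _ hxy h v hv i j hi hj hD => hxy.hasBit (h v hv i j hi hj hD)

theorem upClosed_hasProducts {P Y Z t I J lo hi : ℕ} :
    UpClosed (s := s) (HasProducts z D P Y Z t I J lo hi) :=
  fun _ _ hxy h i k j hi hj h1 h2 hY hZ => hxy.hasBit (h i k j hi hj h1 h2 hY hZ)

theorem upClosed_hasTerminals : UpClosed (HasTerminals z inp) :=
  fun _ _ hxy h i hi r hr hm => hxy.hasBit (h i hi r hr hm)

end UpClosed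

/-! ### Correctness of the closure algorithm -/

section Correct

variable {s : ℕ} {z : Sizes} {inp : ℕ → BitVec s} {V : ℕ} {D : ℕ → ℕ → ℕ → Prop}
  {pre : (ℕ → BitVec s) → Prop}

/-- Injectivity of `cell` ensures that no other bit of the matrix changes, and the matrix lies
behind the input. -/
theorem SoundMemory.update {mem : ℕ → BitVec s} (h : SoundMemory z inp V D mem) (hs : 0 < s)
    {v i j : ℕ} (hi : i < 2 ^ z.level) (hj : j < 2 ^ z.level) (hD : D v i j) :
    let mem' := Function.update mem (z.cell s v i j).1
      (mem (z.cell s v i j).1 ||| BitVec.twoPow s (z.cell s v i j).2)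
    SoundMemory z inp V D mem' ∧ BitsLE mem mem' ∧ HasBit z mem' v i j := by
  intro mem'
  have hbit : ∀ a b, (mem' a).getLsbD b = true ↔
      (mem a).getLsbD b = true ∨ (a, b) = z.cell s v i j := by
    intro a b
    have hlt : (z.cell s v i j).2 < s := Nat.mod_lt _ hs
    by_cases ha : a = (z.cell s v i j).1
    · subst ha
      simp only [mem', Function.update_self, BitVec.getLsbD_or, BitVec.getLsbD_twoPow, hlt,
        decide_true, Bool.true_and, Bool.or_eq_true, decide_eq_true_eq, Prod.ext_iff, true_and]
      rw [eq_comm (a := b)]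
    · simp [mem', Prod.ext_iff, ha]
  refine ⟨⟨fun a ha => ?_, fun v' hv' i' hi' j' hj' hb => ?_⟩, fun a b hab => ?_, ?_⟩
  · have := Sizes.matrixAddr_le_cell (z := z) (s := s) v i j
    rw [show mem' a = mem a from Function.update_of_ne (by omega) _ _]
    exact h.input a ha
  · rcases (hbit _ _).1 hb with hb | hb
    · exact h.sound v' hv' i' hi' j' hj' hb
    · obtain ⟨rfl, rfl, rfl⟩ := Sizes.cell_injective hi' hj' hi hj hb
      exact hD
  · exact (hbit a b).2 (.inl hab)
  · exact (hbit _ _).2 (.inr rfl)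

theorem Achieves.forM_range {N : ℕ} {body : ℕ → RAM s PUnit} {post : ℕ → (ℕ → BitVec s) → Prop}
    (hpre : UpClosed pre) (hpost : ∀ i < N, UpClosed (post i))
    (h : ∀ i < N, Achieves z inp V D (body i) pre (post i)) :
    Achieves z inp V D ((List.range N).forM body) pre fun m => ∀ i < N, post i m := by
  induction N with
  | zero => exact fun m hm _ => ⟨hm, .refl _, by simp⟩
  | succ N ih =>
    have e : (List.range (N + 1)).forM body = (List.range N).forM body >>= fun _ => body N := by
      change forM (List.range (N + 1)) body = forM (List.range N) body >>= fun _ => body N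
      rw [List.range_succ, List.forM_append]
      simp
    rw [e]
    intro m hm hp
    obtain ⟨i1, l1, p1⟩ := ih (fun i hi => hpost i (by omega)) (fun i hi => h i (by omega)) m hm hp
    obtain ⟨i2, l2, p2⟩ := h N (by omega) _ i1 (hpre _ _ l1 hp)
    refine ⟨i2, l1.trans l2, fun i hi => ?_⟩
    rcases Nat.lt_succ_iff_lt_or_eq.1 hi with hi | rfl
    · exact hpost i (by omega) _ _ l2 (p1 i hi)
    · exact p2

theorem forRightSides_achieves {body : ℕ → ℕ → ℕ → RAM s Unit}
    {post : ℕ → (ℕ → BitVec s) → Prop} (hpre : UpClosed pre) (hpost : ∀ p < z.rhs, UpClosed (post p))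
    (h : ∀ p < z.rhs, Achieves z inp V D
      (body (z.rhsPlaceholder inp p) (z.rhsFst inp p) (z.rhsSnd inp p)) pre (post p)) :
    Achieves z inp V D (forRightSides z body) pre fun m => ∀ p < z.rhs, post p m := by
  refine .forM_range hpre hpost fun p hp m hm hpr => ?_
  have hlt : z.rhsAddr p + 2 < z.matrixAddr := by
    simp only [Sizes.matrixAddr, Sizes.termAddr, Sizes.binAddr, Sizes.rhsAddr]; omega
  have h1 := hm.input (z.rhsAddr p) (by omega)
  have h2 := hm.input (z.rhsAddr p + 1) (by omega)
  have h3 := hm.input (z.rhsAddr p + 2) (by omega)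
  -- The state after the three reads: same memory, longer trace.
  have key := h p hp
    ⟨m.mem, m.trace ++ [⟨[z.rhsAddr p], []⟩] ++ [⟨[z.rhsAddr p + 1], []⟩] ++
      [⟨[z.rhsAddr p + 2], []⟩]⟩ hm hpr
  simp only [Sizes.rhsPlaceholder, Sizes.rhsFst, Sizes.rhsSnd, ← h1, ← h2, ← h3] at key
  exact key

end Correct

section Correct

variable {s : ℕ} {z : Sizes} {inp : ℕ → BitVec s} {V : ℕ} {D : ℕ → ℕ → ℕ → Prop}
  {pre : (ℕ → BitVec s) → Prop}

theorem succ_mul_two_pow_le {t I I' l : ℕ} (h : (I + 1) * 2 ^ (t + 1) ≤ l) (hI : I' / 2 = I) :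
    (I' + 1) * 2 ^ t ≤ l := by
  refine le_trans ?_ h
  rw [pow_succ', ← mul_assoc]
  exact Nat.mul_le_mul_right _ (by omega)

theorem div_two_pow_succ (i t : ℕ) : i / 2 ^ (t + 1) = i / 2 ^ t / 2 := by
  rw [pow_succ, Nat.div_div_eq_div_mul]

theorem FullBlock.sub {t I J I' J' : ℕ} {mem : ℕ → BitVec s} (h : FullBlock z V D (t + 1) I J mem)
    (hI : I' / 2 = I) (hJ : J' / 2 = J) : FullBlock z V D t I' J' mem := fun v hv i j hi hj hD =>
  h v hv i j (by rw [div_two_pow_succ, hi, hI]) (by rw [div_two_pow_succ, hj, hJ]) hD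

theorem FullBlock.join {t I J : ℕ} {mem : ℕ → BitVec s}
    (h : ∀ I' J', I' / 2 = I → J' / 2 = J → FullBlock z V D t I' J' mem) :
    FullBlock z V D (t + 1) I J mem := fun v hv i j hi hj hD =>
  h _ _ (by rw [← hi, div_two_pow_succ]) (by rw [← hj, div_two_pow_succ]) v hv i j rfl rfl hD

theorem Achieves.seq {α β : Type} {p : RAM s α} {q : RAM s β} {mid post : (ℕ → BitVec s) → Prop}
    (hpre : UpClosed pre) (hmid : UpClosed mid) (hp : Achieves z inp V D p pre mid)
    (hq : Achieves z inp V D q pre post) :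
    Achieves z inp V D (p >>= fun _ => q) pre fun m => mid m ∧ post m := by
  intro m hm h
  obtain ⟨i1, l1, p1⟩ := hp m hm h
  obtain ⟨i2, l2, p2⟩ := hq _ i1 (hpre _ _ l1 h)
  exact ⟨i2, l1.trans l2, hmid _ _ l2 p1, p2⟩

theorem Achieves.imp {α : Type} {p : RAM s α} {pre' post post' : (ℕ → BitVec s) → Prop}
    (h : Achieves z inp V D p pre post) (h1 : ∀ m, pre' m → pre m) (h2 : ∀ m, post m → post' m) :
    Achieves z inp V D p pre' post' := fun m hm hp => by
  obtain ⟨a, b, c⟩ := h m hm (h1 _ hp)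
  exact ⟨a, b, h2 _ c⟩

/-- Fullness of the two factors survives all eight calls because bits are never cleared; soundness
of the result only needs that the factors are sound. The eight calls cover the four quadrants of the
target and both halves of the range of split points. -/
theorem mma_achieves (hs : 0 < s) {P Y Z : ℕ} (hY : Y < V) (hZ : Z < V)
    (hmul : ∀ i k j, D Y i k → D Z k j → D P i j) {t I K J : ℕ}
    (hI : (I + 1) * 2 ^ t ≤ 2 ^ z.level) (hK : (K + 1) * 2 ^ t ≤ 2 ^ z.level)
    (hJ : (J + 1) * 2 ^ t ≤ 2 ^ z.level) :
    Achieves z inp V D (mma z P Y Z t I K J)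
      (fun m => FullBlock z V D t I K m ∧ FullBlock z V D t K J m)
      (HasProducts z D P Y Z t I J (K * 2 ^ t) ((K + 1) * 2 ^ t)) := by
  induction t generalizing I K J with
  | zero =>
    rintro m hm ⟨h1, h2⟩
    simp only [pow_zero, mul_one, Nat.succ_le_iff] at hI hJ hK
    change SoundMemory z inp V D (if _ then _ else _) ∧ BitsLE _ (if _ then _ else _) ∧
      HasProducts _ _ _ _ _ _ _ _ _ _ (if _ then _ else _)
    split_ifs with hb
    · rw [Bool.and_eq_true] at hb
      obtain ⟨k1, k2, k3⟩ := hm.update hs (v := P) hI hJ (hmul _ _ _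
        (hm.sound Y hY I hI K hK hb.1) (hm.sound Z hZ K hK J hJ hb.2))
      refine ⟨k1, k2, fun i k j hi hj _ _ _ _ => ?_⟩
      simp only [pow_zero, Nat.div_one] at hi hj
      subst hi hj
      exact k3
    · refine ⟨hm, .refl _, fun i k j hi hj hk1 hk2 hDY hDZ => absurd ?_ hb⟩
      simp only [pow_zero, Nat.div_one, mul_one] at hi hj hk1 hk2
      obtain rfl : k = K := by omega
      subst hi hj
      rw [Bool.and_eq_true]
      exact ⟨h1 Y hY _ _ (by simp) (by simp) hDY, h2 Z hZ _ _ (by simp) (by simp) hDZ⟩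
  | succ t ih =>
    have hr : ∀ I' K' J', I' / 2 = I → K' / 2 = K → J' / 2 = J →
        Achieves z inp V D (mma z P Y Z t I' K' J')
          (fun m => FullBlock z V D (t + 1) I K m ∧ FullBlock z V D (t + 1) K J m)
          (HasProducts z D P Y Z t I' J' (K' * 2 ^ t) ((K' + 1) * 2 ^ t)) :=
      fun I' K' J' h1 h2 h3 => (ih (succ_mul_two_pow_le hI h1) (succ_mul_two_pow_le hK h2)
        (succ_mul_two_pow_le hJ h3)).imp (fun m h => ⟨h.1.sub h1 h2, h.2.sub h2 h3⟩) fun _ h => h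
    have hpre : UpClosed (s := s) fun m =>
        FullBlock z V D (t + 1) I K m ∧ FullBlock z V D (t + 1) K J m :=
      upClosed_fullBlock.and upClosed_fullBlock
    have hup : ∀ {I J lo hi : ℕ}, UpClosed (s := s) (HasProducts z D P Y Z t I J lo hi) :=
      upClosed_hasProducts
    have e1 : ∀ x, 2 * x / 2 = x := by omega
    have e2 : ∀ x, (2 * x + 1) / 2 = x := by omega
    unfold mma
    refine Achieves.imp (.seq hpre hup (hr _ _ _ (e1 _) (e1 _) (e1 _)) <|
      .seq hpre hup (hr _ _ _ (e1 _) (e2 _) (e1 _)) <|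
      .seq hpre hup (hr _ _ _ (e1 _) (e1 _) (e2 _)) <|
      .seq hpre hup (hr _ _ _ (e1 _) (e2 _) (e2 _)) <|
      .seq hpre hup (hr _ _ _ (e2 _) (e1 _) (e1 _)) <|
      .seq hpre hup (hr _ _ _ (e2 _) (e2 _) (e1 _)) <|
      .seq hpre hup (hr _ _ _ (e2 _) (e1 _) (e2 _)) <|
      hr _ _ _ (e2 _) (e2 _) (e2 _)) (fun _ h => h) ?_
    rintro m ⟨h1, h2, h3, h4, h5, h6, h7, h8⟩ i k j hi hj hk1 hk2 hDY hDZ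
    rw [div_two_pow_succ] at hi hj
    have e3 : K * 2 ^ (t + 1) = 2 * K * 2 ^ t := by ring
    have e4 : (K + 1) * 2 ^ (t + 1) = (2 * K + 1 + 1) * 2 ^ t := by ring
    rw [e3] at hk1
    rw [e4] at hk2
    have hi' : i / 2 ^ t = 2 * I ∨ i / 2 ^ t = 2 * I + 1 := by omega
    have hj' : j / 2 ^ t = 2 * J ∨ j / 2 ^ t = 2 * J + 1 := by omega
    rcases hi' with hi' | hi' <;> rcases hj' with hj' | hj' <;>
      rcases lt_or_ge k ((2 * K + 1) * 2 ^ t) with hk | hk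
    · exact h1 i k j hi' hj' hk1 hk hDY hDZ
    · exact h2 i k j hi' hj' hk hk2 hDY hDZ
    · exact h3 i k j hi' hj' hk1 hk hDY hDZ
    · exact h4 i k j hi' hj' hk hk2 hDY hDZ
    · exact h5 i k j hi' hj' hk1 hk hDY hDZ
    · exact h6 i k j hi' hj' hk hk2 hDY hDZ
    · exact h7 i k j hi' hj' hk1 hk hDY hDZ
    · exact h8 i k j hi' hj' hk hk2 hDY hDZ

/-- For every right-hand side, block `(I, J)` of level `t` of its placeholder contains the products
with intermediate indices in the interval from `lo` to `hi - 1`. -/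
def HasAllProducts {s : ℕ} (z : Sizes) (inp : ℕ → BitVec s) (D : ℕ → ℕ → ℕ → Prop)
    (t I J lo hi : ℕ) (mem : ℕ → BitVec s) : Prop :=
  ∀ p < z.rhs, HasProducts z D (z.rhsPlaceholder inp p) (z.rhsFst inp p) (z.rhsSnd inp p)
    t I J lo hi mem

theorem upClosed_hasAllProducts {t I J lo hi : ℕ} : UpClosed (HasAllProducts z inp D t I J lo hi) :=
  fun x y hxy h p hp => upClosed_hasProducts x y hxy (h p hp)

theorem HasAllProducts.append {t I J lo mid hi : ℕ} {mem : ℕ → BitVec s}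
    (h : HasAllProducts z inp D t I J lo mid mem) (h' : HasAllProducts z inp D t I J mid hi mem) :
    HasAllProducts z inp D t I J lo hi mem := fun p hp i k j hi hj h1 h2 =>
  (lt_or_ge k mid).elim (fun hk => h p hp i k j hi hj h1 hk) fun hk => h' p hp i k j hi hj hk h2

theorem HasAllProducts.sub {t I J I' J' lo hi : ℕ} {mem : ℕ → BitVec s}
    (h : HasAllProducts z inp D (t + 1) I J lo hi mem) (hI : I' / 2 = I) (hJ : J' / 2 = J) :
    HasAllProducts z inp D t I' J' lo hi mem := fun p hp i k j hi hj =>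
  h p hp i k j (by rw [div_two_pow_succ, hi, hI]) (by rw [div_two_pow_succ, hj, hJ])

theorem forRightSides_mma_achieves (R : RuleSemantics z inp V D) {t I K J : ℕ}
    (hI : (I + 1) * 2 ^ t ≤ 2 ^ z.level) (hK : (K + 1) * 2 ^ t ≤ 2 ^ z.level)
    (hJ : (J + 1) * 2 ^ t ≤ 2 ^ z.level) :
    Achieves z inp V D (forRightSides z fun P Y Z => mma z P Y Z t I K J)
      (fun m => FullBlock z V D t I K m ∧ FullBlock z V D t K J m)
      (HasAllProducts z inp D t I J (K * 2 ^ t) ((K + 1) * 2 ^ t)) :=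
  forRightSides_achieves (upClosed_fullBlock.and upClosed_fullBlock)
    (fun _ _ => upClosed_hasProducts) fun p hp =>
    mma_achieves R.s_pos (R.rhsFst_lt p hp) (R.rhsSnd_lt p hp) (fun _ _ _ => R.mul p hp) hI hK hJ

theorem forRightSides_two_mma_achieves (R : RuleSemantics z inp V D) {t I K K' J : ℕ}
    (hI : (I + 1) * 2 ^ t ≤ 2 ^ z.level) (hK : (K + 1) * 2 ^ t ≤ 2 ^ z.level)
    (hK' : (K' + 1) * 2 ^ t ≤ 2 ^ z.level) (hJ : (J + 1) * 2 ^ t ≤ 2 ^ z.level) :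
    Achieves z inp V D
      (forRightSides z fun P Y Z => do mma z P Y Z t I K J; mma z P Y Z t I K' J)
      (fun m => (FullBlock z V D t I K m ∧ FullBlock z V D t K J m) ∧
        FullBlock z V D t I K' m ∧ FullBlock z V D t K' J m)
      (fun m => HasAllProducts z inp D t I J (K * 2 ^ t) ((K + 1) * 2 ^ t) m ∧
        HasAllProducts z inp D t I J (K' * 2 ^ t) ((K' + 1) * 2 ^ t) m) := by
  have hpre : UpClosed (s := s) fun m => (FullBlock z V D t I K m ∧ FullBlock z V D t K J m) ∧
      FullBlock z V D t I K' m ∧ FullBlock z V D t K' J m :=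
    (upClosed_fullBlock.and upClosed_fullBlock).and (upClosed_fullBlock.and upClosed_fullBlock)
  refine (forRightSides_achieves hpre
    (fun _ _ => upClosed_hasProducts.and upClosed_hasProducts) fun p hp =>
    Achieves.seq hpre upClosed_hasProducts
      ((mma_achieves R.s_pos (R.rhsFst_lt p hp) (R.rhsSnd_lt p hp) (fun _ _ _ => R.mul p hp)
        hI hK hJ).imp (fun _ h => h.1) fun _ h => h)
      ((mma_achieves R.s_pos (R.rhsFst_lt p hp) (R.rhsSnd_lt p hp) (fun _ _ _ => R.mul p hp)
        hI hK' hJ).imp (fun _ h => h.2) fun _ h => h)).imp (fun _ h => h) fun m h =>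
    ⟨fun p hp => (h p hp).1, fun p hp => (h p hp).2⟩

/-- The order of the rules is irrelevant: all placeholder bits needed are present from the start,
since they come from products of strictly shorter segments. -/
theorem updateVariables_achieves (R : RuleSemantics z inp V D) {I J : ℕ} (hI : I < 2 ^ z.level) (hJ : J < 2 ^ z.level) :
    Achieves z inp V D (updateVariables z I J)
      (HasAllProducts z inp D 0 I J (I + 1) J)
      (fun m => ∀ r < z.bin, ∀ p < z.rhs, z.binPlaceholder inp r = z.rhsPlaceholder inp p →
        ∀ k, D (z.rhsFst inp p) I k → D (z.rhsSnd inp p) k J →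
        HasBit z m (z.binLhs inp r) I J) := by
  refine .forM_range upClosed_hasAllProducts (fun r _ x y hxy h p hp hr k h1 h2 =>
    hxy.hasBit (h p hp hr k h1 h2)) fun r hr m hm hpr => ?_
  have hlt : z.binAddr r + 1 < z.matrixAddr := by
    simp only [Sizes.matrixAddr, Sizes.termAddr, Sizes.binAddr, Sizes.rhsAddr]; omega
  have h1 : (m.mem (z.binAddr r)).toNat = z.binLhs inp r :=
    congrArg BitVec.toNat (hm.input (z.binAddr r) (by omega))
  have h2 : (m.mem (z.binAddr r + 1)).toNat = z.binPlaceholder inp r :=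
    congrArg BitVec.toNat (hm.input (z.binAddr r + 1) (by omega))
  have key : SoundMemory z inp V D
      ((RAM.orBit (z.cell s (z.binLhs inp r) I J) (z.cell s (z.binPlaceholder inp r) I J) m).2.mem) ∧
    BitsLE m.mem
      ((RAM.orBit (z.cell s (z.binLhs inp r) I J) (z.cell s (z.binPlaceholder inp r) I J) m).2.mem) ∧
    (HasBit z m.mem (z.binPlaceholder inp r) I J →
      HasBit z ((RAM.orBit (z.cell s (z.binLhs inp r) I J)
        (z.cell s (z.binPlaceholder inp r) I J) m).2.mem) (z.binLhs inp r) I J) := by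
    change SoundMemory z inp V D (if _ then _ else _) ∧ BitsLE _ (if _ then _ else _) ∧
      (_ → HasBit _ (if _ then _ else _) _ _ _)
    split_ifs with hb
    · obtain ⟨k1, k2, k3⟩ := hm.update R.s_pos (v := z.binLhs inp r) hI hJ
        (R.bin r hr (hm.sound _ (R.binPlaceholder_lt r hr) I hI J hJ hb))
      exact ⟨k1, k2, fun _ => k3⟩
    · exact ⟨hm, .refl _, fun h => absurd h hb⟩
  rw [← h1, ← h2] at key
  refine ⟨key.1, key.2.1, fun p hp hrp k hk1 hk2 => ?_⟩
  rw [← h1]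
  refine key.2.2 ?_
  rw [h2, hrp]
  have hlt1 := R.lt hk1
  have hlt2 := R.lt hk2
  exact hpr p hp I k J (by simp) (by simp) hlt1 hlt2 hk1 hk2

/-- The products required beforehand are those with split points in the gap from `(I + 1) * 2 ^ t`
to `J * 2 ^ t - 1`. Split points inside block `I` or `J` are supplied during the recursion, as soon
as the factors they need are full. At level 0 the gap contains every split point between `I` and
`J`. -/
theorem cykStar_achieves (R : RuleSemantics z inp V D) {t I J : ℕ} (hIJ : I < J) (hI : (I + 1) * 2 ^ t ≤ 2 ^ z.level)
    (hJ : (J + 1) * 2 ^ t ≤ 2 ^ z.level) :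
    Achieves z inp V D (cykStar z t I J)
      (fun m => FullBlock z V D t I I m ∧ FullBlock z V D t J J m ∧ HasTerminals z inp m ∧
        HasAllProducts z inp D t I J ((I + 1) * 2 ^ t) (J * 2 ^ t) m)
      (FullBlock z V D t I J) := by
  induction t generalizing I J with
  | zero =>
    rintro m hm ⟨-, -, hT, hP⟩
    simp only [pow_zero, mul_one, Nat.succ_le_iff] at hI hJ hP
    obtain ⟨i1, l1, p1⟩ := updateVariables_achieves R hI hJ m hm hP
    refine ⟨i1, l1, fun v hv i j hi hj hD => ?_⟩
    simp only [pow_zero, Nat.div_one] at hi hj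
    subst hi hj
    rcases R.complete hD with ⟨r, hr, hi, rfl, rfl, hm⟩ | ⟨p, hp, rfl, k, h1, h2⟩ |
      ⟨r, hr, rfl, p, hp, hrp, k, h1, h2⟩
    · exact l1.hasBit (hT _ hi r hr hm)
    · have hlt1 := R.lt h1
      have hlt2 := R.lt h2
      exact l1.hasBit (hP p hp _ k _ (by simp) (by simp) hlt1 hlt2 h1 h2)
    · exact p1 r hr p hp hrp k h1 h2
  | succ t ih =>
    rintro m hm ⟨hII, hJJ, hT, hP⟩
    have e1 : ∀ x, 2 * x / 2 = x := by omega
    have e2 : ∀ x, (2 * x + 1) / 2 = x := by omega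
    have s1 := succ_mul_two_pow_le hI (e1 I)
    have s2 := succ_mul_two_pow_le hI (e2 I)
    have s3 := succ_mul_two_pow_le hJ (e1 J)
    have s4 := succ_mul_two_pow_le hJ (e2 J)
    have a1 : (I + 1) * 2 ^ (t + 1) = (2 * I + 1 + 1) * 2 ^ t := by ring
    have a2 : J * 2 ^ (t + 1) = 2 * J * 2 ^ t := by ring
    rw [a1, a2] at hP
    have up := fun {I J : ℕ} => upClosed_fullBlock (s := s) (z := z) (V := V) (D := D) (t := t)
      (I := I) (J := J)
    have upT := upClosed_hasTerminals (z := z) (inp := inp)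
    have upP := fun {I J lo hi : ℕ} => upClosed_hasAllProducts (z := z) (inp := inp) (D := D)
      (t := t) (I := I) (J := J) (lo := lo) (hi := hi)
    -- The inner blocks 2 and 3 border on the gap of the parent, so they have the same gap.
    obtain ⟨i1, l1, f23⟩ := ih (I := 2 * I + 1) (J := 2 * J) (by omega) s2 s3 m hm
      ⟨hII.sub (e2 I) (e2 I), hJJ.sub (e1 J) (e1 J), hT, hP.sub (e2 I) (e1 J)⟩
    obtain ⟨i2, l2, p13⟩ := forRightSides_mma_achieves R s1 s2 s3 _ i1
      ⟨up _ _ l1 (hII.sub (e1 I) (e2 I)), f23⟩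
    have L2 := l1.trans l2
    -- The gap between blocks 1 and 3 is block 2, just supplied by the product, followed by the gap
    -- of the parent.
    obtain ⟨i3, l3, f13⟩ := ih (I := 2 * I) (J := 2 * J) (by omega) s1 s3 _ i2
      ⟨up _ _ L2 (hII.sub (e1 I) (e1 I)), up _ _ L2 (hJJ.sub (e1 J) (e1 J)), upT _ _ L2 hT,
        p13.append (upP _ _ L2 (hP.sub (e1 I) (e1 J)))⟩
    have L3 := L2.trans l3
    obtain ⟨i4, l4, p24⟩ := forRightSides_mma_achieves R s2 s3 s4 _ i3
      ⟨up _ _ (l2.trans l3) f23, up _ _ L3 (hJJ.sub (e1 J) (e2 J))⟩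
    have L4 := L3.trans l4
    -- Symmetrically, the gap of the parent followed by block 3.
    obtain ⟨i5, l5, f24⟩ := ih (I := 2 * I + 1) (J := 2 * J + 1) (by omega) s2 s4 _ i4
      ⟨up _ _ L4 (hII.sub (e2 I) (e2 I)), up _ _ L4 (hJJ.sub (e2 J) (e2 J)), upT _ _ L4 hT,
        (upP _ _ L4 (hP.sub (e2 I) (e2 J))).append p24⟩
    have L5 := L4.trans l5
    obtain ⟨i6, l6, p14, p14'⟩ := forRightSides_two_mma_achieves R s1 s2 s3 s4 _ i5
      ⟨⟨up _ _ L5 (hII.sub (e1 I) (e2 I)), f24⟩, up _ _ (l4.trans l5) f13,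
        up _ _ L5 (hJJ.sub (e1 J) (e2 J))⟩
    have L6 := L5.trans l6
    -- Block 2, the gap of the parent, and block 3 together.
    obtain ⟨i7, l7, f14⟩ := ih (I := 2 * I) (J := 2 * J + 1) (by omega) s1 s4 _ i6
      ⟨up _ _ L6 (hII.sub (e1 I) (e1 I)), up _ _ L6 (hJJ.sub (e2 J) (e2 J)), upT _ _ L6 hT,
        (p14.append (upP _ _ L6 (hP.sub (e1 I) (e2 J)))).append p14'⟩
    refine ⟨i7, L6.trans l7, FullBlock.join fun I' J' hI' hJ' => ?_⟩
    have l67 := l6.trans l7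
    have l57 := l5.trans l67
    have hI'' : I' = 2 * I ∨ I' = 2 * I + 1 := by omega
    have hJ'' : J' = 2 * J ∨ J' = 2 * J + 1 := by omega
    rcases hI'' with rfl | rfl <;> rcases hJ'' with rfl | rfl
    · exact up _ _ (l4.trans l57) f13
    · exact f14
    · exact up _ _ (l2.trans (l3.trans (l4.trans l57))) f23
    · exact up _ _ l67 f24

theorem not_lower (R : RuleSemantics z inp V D) {v i j t I J : ℕ} (h : D v i j) (hIJ : J < I) (hi : i / 2 ^ t = I)
    (hj : j / 2 ^ t = J) : False := by
  have : i / 2 ^ t ≤ j / 2 ^ t := Nat.div_le_div_right (R.lt h).le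
  omega

/-- The only relevant entry belongs to a segment of length one, which has no split point; this is
why Closure has nothing to do at dimension 2. -/
theorem fullBlock_one (R : RuleSemantics z inp V D) {I : ℕ} {mem : ℕ → BitVec s} (hT : HasTerminals z inp mem) :
    FullBlock z V D 1 I I mem := by
  intro v hv i j hi hj hD
  have hlt := R.lt hD
  rw [pow_one] at hi hj
  have impossible : ∀ {p k}, D (z.rhsFst inp p) i k → D (z.rhsSnd inp p) k j → False := by
    intro p k h1 h2
    have := R.lt h1
    have := R.lt h2
    omega
  rcases R.complete hD with ⟨r, hr, hi, rfl, rfl, hm⟩ | ⟨p, hp, rfl, k, h1, h2⟩ |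
    ⟨r, hr, rfl, p, hp, hrp, k, h1, h2⟩
  · exact hT _ hi r hr hm
  · exact (impossible h1 h2).elim
  · exact (impossible h1 h2).elim

theorem cykClosure_achieves (R : RuleSemantics z inp V D) {t I : ℕ} (hI : (I + 1) * 2 ^ t ≤ 2 ^ z.level) :
    Achieves z inp V D (cykClosure z t I) (HasTerminals z inp) (FullBlock z V D t I I) := by
  induction t generalizing I with
  | zero =>
    refine fun m hm hT => ⟨hm, .refl _, fun v hv i j hi hj hD => ?_⟩
    have := R.lt hD
    simp only [pow_zero, Nat.div_one] at hi hj
    omega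
  | succ t ih =>
    rcases t with _ | t
    · exact fun m hm hT => ⟨hm, .refl _, fullBlock_one R hT⟩
    · intro m hm hT
      have e1 : 2 * I / 2 = I := by omega
      have e2 : (2 * I + 1) / 2 = I := by omega
      have s1 := succ_mul_two_pow_le hI e1
      have s2 := succ_mul_two_pow_le hI e2
      obtain ⟨i1, l1, f1⟩ := ih s1 m hm hT
      have hT1 := upClosed_hasTerminals _ _ l1 hT
      obtain ⟨i2, l2, f2⟩ := ih s2 _ i1 hT1
      obtain ⟨i3, l3, f3⟩ := cykStar_achieves R (by omega) s1 s2 _ i2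
        ⟨upClosed_fullBlock _ _ l2 f1, f2, upClosed_hasTerminals _ _ l2 hT1,
          -- The two diagonal blocks are adjacent, so the gap is empty and no products are required
          -- in advance.
          fun p hp i k j _ _ h1 h2 => absurd h1 (by omega)⟩
      refine ⟨i3, l1.trans (l2.trans l3), FullBlock.join fun I' J' hI' hJ' => ?_⟩
      have hI'' : I' = 2 * I ∨ I' = 2 * I + 1 := by omega
      have hJ'' : J' = 2 * I ∨ J' = 2 * I + 1 := by omega
      rcases hI'' with rfl | rfl <;> rcases hJ'' with rfl | rfl
      · exact upClosed_fullBlock _ _ (l2.trans l3) f1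
      · exact f3
      · exact fun v hv i j hi hj hD => (not_lower R hD (by omega) hi hj).elim
      · exact upClosed_fullBlock _ _ l3 f2

theorem cykInit_achieves (R : RuleSemantics z inp V D) :
    Achieves z inp V D (cykInit z) (fun _ => True) (HasTerminals z inp) := by
  refine (Achieves.forM_range upClosed_true
    (fun i _ x y hxy h r hr hm => hxy.hasBit (h r hr hm)) fun i hi => ?_)
  refine (Achieves.forM_range upClosed_true
    (fun r _ x y hxy h hm => hxy.hasBit (h hm)) fun r hr => ?_)
  intro m hm _
  have hlt : z.termAddr r + 1 < z.matrixAddr := by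
    simp only [Sizes.matrixAddr, Sizes.termAddr, Sizes.binAddr, Sizes.rhsAddr]; omega
  have hlt' : Sizes.strAddr i < z.matrixAddr := by
    simp only [Sizes.matrixAddr, Sizes.termAddr, Sizes.binAddr, Sizes.rhsAddr, Sizes.strAddr]; omega
  have h1 : (m.mem (z.termAddr r)).toNat = z.termLhs inp r :=
    congrArg BitVec.toNat (hm.input (z.termAddr r) (by omega))
  have h2 := hm.input (z.termAddr r + 1) hlt
  have h3 := hm.input (Sizes.strAddr i) hlt'
  have hlev := z.lt_two_pow_level
  set m1 : Machine s := ⟨m.mem, m.trace ++ [⟨[z.termAddr r + 1, Sizes.strAddr i], []⟩]⟩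
  -- Abstracting the continuation over the outcome of the comparison makes it possible to rewrite
  -- this outcome.
  let q : Bool → RAM s Unit := fun b => do
    if b then
      let A ← RAM.readWord (z.termAddr r)
      RAM.setBit (z.cell s A i (i + 1))
  change SoundMemory z inp V D (q (m.mem (z.termAddr r + 1) == m.mem (Sizes.strAddr i)) m1).2.mem ∧
    BitsLE _ (q (m.mem (z.termAddr r + 1) == m.mem (Sizes.strAddr i)) m1).2.mem ∧
    (_ → HasBit _ (q (m.mem (z.termAddr r + 1) == m.mem (Sizes.strAddr i)) m1).2.mem _ _ _)
  rw [h2, h3]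
  by_cases hb : (inp (z.termAddr r + 1) == inp (Sizes.strAddr i)) = true
  · rw [hb]
    have hmatch : z.Matches inp r i := by simpa [Sizes.Matches] using hb
    obtain ⟨k1, k2, k3⟩ := hm.update R.s_pos (v := z.termLhs inp r) (i := i) (j := i + 1)
      (by omega) (by omega) (R.term r hr i hi hmatch)
    rw [← h1] at k1 k2 k3
    refine ⟨k1, k2, fun _ => ?_⟩
    rw [← h1]
    exact k3
  · rw [Bool.not_eq_true] at hb
    rw [hb]
    exact ⟨hm, .refl _, fun h => absurd h (by simpa [Sizes.Matches] using hb)⟩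

theorem cyk_answer (R : RuleSemantics z inp V D) {m : Machine s} (hm : SoundMemory z inp V D m.mem) (hn : z.n ≠ 0)
    (hV : (inp Sizes.startAddr).toNat < V) :
    (cyk z m).1 = true ↔ D (inp Sizes.startAddr).toNat 0 z.n := by
  obtain ⟨i1, l1, f1⟩ := cykInit_achieves R m hm trivial
  obtain ⟨i2, l2, f2⟩ := cykClosure_achieves R (t := z.level) (I := 0) (by simp) _ i1 f1
  have hs := i2.input Sizes.startAddr
    (by simp only [Sizes.matrixAddr, Sizes.termAddr, Sizes.binAddr, Sizes.rhsAddr,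
      Sizes.startAddr]; omega)
  have hlev := z.lt_two_pow_level
  have e : (cyk z m).1 = (((cykClosure z z.level 0 : RAM s Unit) ((cykInit z : RAM s Unit) m).2).2.mem
      (z.cell s (inp Sizes.startAddr).toNat 0 z.n).1).getLsbD
      (z.cell s (inp Sizes.startAddr).toNat 0 z.n).2 := by
    rw [← hs, cyk, if_neg hn]
    rfl
  rw [e]
  exact ⟨fun h => i2.sound _ hV 0 (by omega) z.n hlev h,
    fun h => f2 _ hV 0 z.n (by simp) (Nat.div_eq_of_lt hlev) h⟩

end Correct

/-! ### Derivations in Chomsky normal form -/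

section Grammar

variable {Sg : Type u} {G : ContextFreeGrammar.{u} Sg}

/-- The variable `A` derives the string `u`. -/
def Yields (G : ContextFreeGrammar.{u} Sg) (A : G.NT) (u : List Sg) : Prop :=
  G.Derives [Symbol.nonterminal A] (u.map Symbol.terminal)

/-- Context-freeness: each rewriting step acts on a single symbol, which belongs to one of the two
parts. -/
theorem derives_append_split {a b x y : List (Symbol Sg G.NT)} (h : G.Derives a b)
    (ha : a = x ++ y) : ∃ x' y', b = x' ++ y' ∧ G.Derives x x' ∧ G.Derives y y' := by
  induction h using Relation.ReflTransGen.head_induction_on generalizing x y with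
  | refl => exact ⟨x, y, ha, .refl _, .refl _⟩
  | @head a c hac _ ih =>
    obtain ⟨r, hr, hrw⟩ := hac
    obtain ⟨p, q, hp, rfl⟩ := hrw.exists_parts
    rw [ha, List.append_assoc, List.append_eq_append_iff] at hp
    rcases hp with ⟨t, ht, hy⟩ | ⟨t, ht, hy⟩
    · obtain ⟨x', y', e, hx, hy'⟩ := ih (x := x) (y := t ++ r.output ++ q) (by simp [ht])
      refine ⟨x', y', e, hx, .head ⟨r, hr, ?_⟩ hy'⟩
      rw [hy, ← List.append_assoc]
      exact r.rewrites_of_exists_parts t q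
    -- If `t` is empty, the rewritten symbol is the first one of `y` and not part of `x`.
    · rcases t with _ | ⟨c, t⟩
      · simp only [List.append_nil, List.nil_append] at ht hy
        obtain ⟨x', y', e, hx, hy'⟩ := ih (x := x) (y := r.output ++ q) (by simp [ht])
        refine ⟨x', y', e, hx, .head ⟨r, hr, ?_⟩ hy'⟩
        rw [← hy]
        exact .head q
      · simp only [List.cons_append, List.nil_append, List.cons.injEq] at hy
        obtain ⟨rfl, rfl⟩ := hy
        obtain ⟨x', y', e, hx, hy'⟩ := ih (x := p ++ r.output ++ t) (y := y) (by simp)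
        refine ⟨x', y', e, .head ⟨r, hr, ?_⟩ hx, hy'⟩
        rw [ht]
        simpa using r.rewrites_of_exists_parts p t

theorem eq_of_terminals_derives {u : List Sg} {b : List (Symbol Sg G.NT)}
    (h : G.Derives (u.map Symbol.terminal) b) : b = u.map Symbol.terminal := by
  rcases h.eq_or_head with h | ⟨v, ⟨r, _, hr⟩, _⟩
  · exact h.symm
  · simpa using hr.nonterminal_input_mem

/-- Only the start variable can be erased, and it occurs on no right-hand side, so its absence is
preserved along a derivation. -/
theorem IsCNF.derives_ne_nil (hG : IsCNF G) {a b : List (Symbol Sg G.NT)} (h : G.Derives a b)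
    (ha : a ≠ []) (hi : Symbol.nonterminal G.initial ∉ a) : b ≠ [] := by
  suffices b ≠ [] ∧ Symbol.nonterminal G.initial ∉ b from this.1
  induction h with
  | refl => exact ⟨ha, hi⟩
  | tail _ hbc ih =>
    obtain ⟨r, hr, hrw⟩ := hbc
    obtain ⟨p, q, rfl, rfl⟩ := hrw.exists_parts
    have hne : r.input ≠ G.initial := fun h => ih.2 (by simp [h])
    have hpq : Symbol.nonterminal G.initial ∉ p ∧ Symbol.nonterminal G.initial ∉ q := by
      have := ih.2; simp at this; tauto
    rcases hG r hr with ⟨Y, Z, hY, hZ, h⟩ | ⟨a, h⟩ | ⟨h, _⟩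
    · simp [h, hpq, hY.symm, hZ.symm]
    · simp [h, hpq]
    · exact absurd h hne

theorem Yields.exists_rule {A : G.NT} {u : List Sg} (h : Yields G A u) :
    ∃ v, ContextFreeRule.mk A v ∈ G.rules ∧ G.Derives v (u.map Symbol.terminal) := by
  rcases ContextFreeGrammar.Derives.eq_or_head h with h | ⟨v, ⟨r, hr, hrw⟩, hv⟩
  · cases u <;> simp at h
  · cases hrw with
    | head => exact ⟨r.output, hr, by simpa using hv⟩
    | cons _ h => cases h

/-- Both parts of a binary split are nonempty because neither variable on the right is the start
variable. -/
theorem IsCNF.yields_cases (hG : IsCNF G) {A : G.NT} {u : List Sg} (hu : u ≠ [])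
    (h : Yields G A u) : (∃ a, (A, a) ∈ terminalRules G ∧ u = [a]) ∨
      ∃ Y Z, (A, (Y, Z)) ∈ binaryRules G ∧ ∃ x y, x ≠ [] ∧ y ≠ [] ∧ u = x ++ y ∧
        Yields G Y x ∧ Yields G Z y := by
  obtain ⟨v, hr, hv⟩ := h.exists_rule
  rcases hG _ hr with ⟨Y, Z, hY, hZ, rfl⟩ | ⟨a, rfl⟩ | ⟨_, rfl⟩
  · obtain ⟨x', y', e, hx, hy⟩ := derives_append_split (x := [Symbol.nonterminal Y])
      (y := [Symbol.nonterminal Z]) hv rfl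
    obtain ⟨x, y, rfl, rfl, rfl⟩ := List.map_eq_append_iff.1 e
    have hx0 := hG.derives_ne_nil hx (by simp) (by simpa using hY.symm)
    have hy0 := hG.derives_ne_nil hy (by simp) (by simpa using hZ.symm)
    exact .inr ⟨Y, Z, hr, x, y, by simpa using hx0, by simpa using hy0, rfl, hx, hy⟩
  · have := eq_of_terminals_derives (u := [a]) hv
    refine .inl ⟨a, hr, List.map_injective_iff.2 (fun _ _ h => by simpa using h) this⟩
  · have := eq_of_terminals_derives (u := []) hv
    simp at this
    exact absurd this hu

theorem yields_terminal {A : G.NT} {a : Sg} (h : (A, a) ∈ terminalRules G) : Yields G A [a] :=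
  .single ⟨_, h, ContextFreeRule.Rewrites.input_output⟩

theorem yields_binary {A Y Z : G.NT} {x y : List Sg} (h : (A, (Y, Z)) ∈ binaryRules G)
    (hx : Yields G Y x) (hy : Yields G Z y) : Yields G A (x ++ y) := by
  refine .head ⟨_, h, ContextFreeRule.Rewrites.input_output⟩ ?_
  rw [List.map_append]
  exact (ContextFreeGrammar.Derives.append_right hx [Symbol.nonterminal Z]).trans
    (ContextFreeGrammar.Derives.append_left hy _)

theorem IsCNF.yields_nil_iff (hG : IsCNF G) :
    Yields G G.initial [] ↔ ContextFreeRule.mk G.initial [] ∈ G.rules := by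
  constructor
  · intro h
    obtain ⟨v, hr, hv⟩ := h.exists_rule
    rcases hG _ hr with ⟨Y, Z, hY, hZ, rfl⟩ | ⟨a, rfl⟩ | ⟨_, rfl⟩
    · exact absurd rfl (hG.derives_ne_nil hv (by simp) (by simp [hY.symm, hZ.symm]))
    · exact absurd rfl (hG.derives_ne_nil hv (by simp) (by simp))
    · exact hr
  · exact fun h => .single ⟨_, h, ContextFreeRule.Rewrites.input_output⟩

end Grammar

/-! ### Segments of the string and records in memory -/

section Segments

variable {α : Type u}

/-- The entries `i, …, j - 1` of a list. -/
def listSegment (w : List α) (i j : ℕ) : List α := (w.take j).drop i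

theorem length_listSegment {w : List α} {i j : ℕ} (hj : j ≤ w.length) :
    (listSegment w i j).length = j - i := by simp [listSegment, hj]

theorem listSegment_append {w : List α} {i k j : ℕ} (h1 : i ≤ k) (h2 : k ≤ j) (hj : j ≤ w.length) :
    listSegment w i k ++ listSegment w k j = listSegment w i j := by
  have h : w.take j = w.take k ++ (w.take j).drop k := by
    conv_lhs => rw [← List.take_append_drop k (w.take j), List.take_take, min_eq_left h2]
  have h' : listSegment w i j = (w.take k ++ (w.take j).drop k).drop i := by rw [← h]; rfl
  rw [h', List.drop_append_of_le_length (by rw [List.length_take]; omega)]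
  rfl

theorem listSegment_succ {w : List α} {i : ℕ} (hi : i < w.length) : listSegment w i (i + 1) = [w[i]] := by
  rw [listSegment, List.take_add_one, List.drop_append_of_le_length (by simp; omega)]
  simp [hi]

theorem getD_flatMap {β γ : Type*} {f : β → List γ} {k : ℕ} (hf : ∀ x, (f x).length = k)
    {l : List β} {i j : ℕ} (hi : i < l.length) (hj : j < k) (d : γ) :
    (l.flatMap f).getD (k * i + j) d = (f l[i]).getD j d := by
  induction l generalizing i with
  | nil => simp at hi
  | cons x l ih =>
    rw [List.flatMap_cons]
    rcases i with _ | i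
    · rw [List.getD_append _ _ _ _ (by simp [hf, hj])]; simp
    · rw [List.getD_append_right _ _ _ _ (by rw [hf, mul_add]; omega), hf,
        show k * (i + 1) + j - k = k * i + j by rw [mul_add]; omega,
        ih (by simpa using hi)]
      simp

theorem length_flatMap_const {β γ : Type*} {f : β → List γ} {k : ℕ} (hf : ∀ x, (f x).length = k)
    (l : List β) : (l.flatMap f).length = k * l.length := by
  induction l with
  | nil => simp
  | cons x l ih => rw [List.flatMap_cons, List.length_append, ih, hf, List.length_cons]; ring

end Segments

/-! ### The initial memory as a representation of the grammar -/

namespace Encoding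

variable {Sg : Type u} {G : ContextFreeGrammar.{u} Sg} [Fintype G.NT] {s : ℕ}
  (e : Encoding G s) (w : List Sg)

theorem toNat_varWord (A : G.NT) : (e.varWord A).toNat = e.var A := by
  rw [varWord, BitVec.toNat_ofNat, Nat.mod_eq_of_lt]
  have := (e.var A).isLt
  have := e.fits
  omega

theorem toNat_placeholderWord {p : ℕ} (hp : p < e.rhs.length) :
    (e.placeholderWord p).toNat = Fintype.card G.NT + p := by
  rw [placeholderWord, BitVec.toNat_ofNat, Nat.mod_eq_of_lt]
  have := e.fits
  omega

theorem getD_append_add {α : Type*} (l l' : List α) (i : ℕ) (d : α) :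
    (l ++ l').getD (l.length + i) d = l'.getD i d := by
  rw [List.getD_append_right _ _ _ _ (by omega), Nat.add_sub_cancel_left]

theorem initial_mem (a : ℕ) : (e.initial w).mem a = (e.inputWords w).getD a 0 := rfl

theorem getLsbD_eps : ((e.initial w).mem Sizes.epsAddr).getLsbD 0 = e.eps := by
  simp [initial_mem, inputWords, Sizes.epsAddr, e.s_pos]

theorem initial_start : (e.initial w).mem Sizes.startAddr = e.varWord G.initial := by
  simp [initial_mem, inputWords, Sizes.startAddr]

theorem initial_letter {i : ℕ} (hi : i < w.length) :
    (e.initial w).mem (Sizes.strAddr i) = e.letter w[i] := by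
  rw [initial_mem, inputWords, List.append_assoc, List.append_assoc, List.append_assoc]
  refine (getD_append_add [_, _] _ i 0).trans ?_
  rw [List.getD_append _ _ _ _ (by simpa using hi)]
  simp [hi]

theorem initial_rhs {p j : ℕ} (hp : p < e.rhs.length) (hj : j < 3) :
    (e.initial w).mem ((e.sizes w).rhsAddr p + j) =
      [e.placeholderWord p, e.varWord e.rhs[p].1, e.varWord e.rhs[p].2].getD j 0 := by
  have ha : (e.sizes w).rhsAddr p + j =
      ([BitVec.ofBool e.eps |>.setWidth s, e.varWord G.initial] ++ w.map e.letter).length +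
        (3 * p + j) := by
    simp only [Sizes.rhsAddr, sizes, List.length_append, List.length_map, List.length_cons,
      List.length_nil]
    omega
  rw [initial_mem, inputWords, ha, List.append_assoc, List.append_assoc, getD_append_add,
    List.getD_append, getD_flatMap (k := 3) (fun _ => rfl) (by simpa using hp) hj]
  · simp
  · rw [length_flatMap_const (k := 3) (fun _ => rfl), List.length_zipIdx]; omega

theorem initial_bin {r j : ℕ} (hr : r < e.bin.length) (hj : j < 2) :
    (e.initial w).mem ((e.sizes w).binAddr r + j) =
      [e.varWord e.bin[r].1, e.placeholderWord e.bin[r].2].getD j 0 := by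
  have ha : (e.sizes w).binAddr r + j =
      ([BitVec.ofBool e.eps |>.setWidth s, e.varWord G.initial] ++ w.map e.letter ++
        e.rhs.zipIdx.flatMap (fun x => [e.placeholderWord x.2, e.varWord x.1.1, e.varWord x.1.2])
        ).length + (2 * r + j) := by
    rw [List.length_append, length_flatMap_const (k := 3) (fun _ => rfl)]
    simp only [Sizes.rhsAddr, Sizes.binAddr, sizes, List.length_append, List.length_map,
      List.length_cons, List.length_nil, List.length_zipIdx]
    omega
  rw [initial_mem, inputWords, ha, List.append_assoc, getD_append_add,
    List.getD_append, getD_flatMap (k := 2) (fun _ => rfl) hr hj]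
  rw [length_flatMap_const (k := 2) (fun _ => rfl)]; omega

theorem initial_term {r j : ℕ} (hr : r < e.term.length) (hj : j < 2) :
    (e.initial w).mem ((e.sizes w).termAddr r + j) =
      [e.varWord e.term[r].1, e.letter e.term[r].2].getD j 0 := by
  have ha : (e.sizes w).termAddr r + j =
      ([BitVec.ofBool e.eps |>.setWidth s, e.varWord G.initial] ++ w.map e.letter ++
        e.rhs.zipIdx.flatMap (fun x => [e.placeholderWord x.2, e.varWord x.1.1, e.varWord x.1.2]) ++
        e.bin.flatMap (fun x => [e.varWord x.1, e.placeholderWord x.2])).length + (2 * r + j) := by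
    rw [List.length_append, List.length_append, length_flatMap_const (k := 3) (fun _ => rfl),
      length_flatMap_const (k := 2) (fun _ => rfl)]
    simp only [Sizes.rhsAddr, Sizes.binAddr, Sizes.termAddr, sizes, List.length_append,
      List.length_map, List.length_cons, List.length_nil, List.length_zipIdx]
    omega
  rw [initial_mem, inputWords, ha, getD_append_add, getD_flatMap (k := 2) (fun _ => rfl) hr hj]

theorem initial_unused {a : ℕ} (ha : (e.sizes w).matrixAddr ≤ a) : (e.initial w).mem a = 0 := by
  rw [initial_mem, List.getD_eq_default]
  refine le_trans (le_of_eq ?_) ha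
  rw [inputWords, List.length_append, List.length_append, List.length_append,
    length_flatMap_const (k := 3) (fun _ => rfl), length_flatMap_const (k := 2) (fun _ => rfl),
    length_flatMap_const (k := 2) (fun _ => rfl)]
  simp only [Sizes.matrixAddr, Sizes.rhsAddr, Sizes.binAddr, Sizes.termAddr, sizes,
    List.length_append, List.length_map, List.length_cons, List.length_nil, List.length_zipIdx]

theorem rhsPlaceholder_eq {p : ℕ} (hp : p < e.rhs.length) :
    (e.sizes w).rhsPlaceholder (e.initial w).mem p = Fintype.card G.NT + p := by
  have := e.initial_rhs w (j := 0) hp (by norm_num)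
  rw [Nat.add_zero] at this
  rw [Sizes.rhsPlaceholder, this]
  exact e.toNat_placeholderWord hp

theorem rhsFst_eq {p : ℕ} (hp : p < e.rhs.length) :
    (e.sizes w).rhsFst (e.initial w).mem p = e.var e.rhs[p].1 := by
  rw [Sizes.rhsFst, e.initial_rhs w hp (by norm_num)]
  exact e.toNat_varWord _

theorem rhsSnd_eq {p : ℕ} (hp : p < e.rhs.length) :
    (e.sizes w).rhsSnd (e.initial w).mem p = e.var e.rhs[p].2 := by
  rw [Sizes.rhsSnd, e.initial_rhs w hp (by norm_num)]
  exact e.toNat_varWord _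

theorem binLhs_eq {r : ℕ} (hr : r < e.bin.length) :
    (e.sizes w).binLhs (e.initial w).mem r = e.var e.bin[r].1 := by
  have := e.initial_bin w (j := 0) hr (by norm_num)
  rw [Nat.add_zero] at this
  rw [Sizes.binLhs, this]
  exact e.toNat_varWord _

theorem binPlaceholder_eq {r : ℕ} (hr : r < e.bin.length) :
    (e.sizes w).binPlaceholder (e.initial w).mem r = Fintype.card G.NT + e.bin[r].2 := by
  rw [Sizes.binPlaceholder, e.initial_bin w hr (by norm_num)]
  exact e.toNat_placeholderWord e.bin[r].2.isLt

theorem termLhs_eq {r : ℕ} (hr : r < e.term.length) :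
    (e.sizes w).termLhs (e.initial w).mem r = e.var e.term[r].1 := by
  have := e.initial_term w (j := 0) hr (by norm_num)
  rw [Nat.add_zero] at this
  rw [Sizes.termLhs, this]
  exact e.toNat_varWord _

theorem matches_iff {r i : ℕ} (hr : r < e.term.length) (hi : i < w.length) :
    (e.sizes w).Matches (e.initial w).mem r i ↔ e.term[r].2 = w[i] := by
  rw [Sizes.Matches, e.initial_term w hr (by norm_num), e.initial_letter w hi]
  exact e.letter.injective.eq_iff

/-- The variable with index `v`, or the right-hand side with placeholder `v`, derives the
characters `i, …, j - 1` of the string `w`. -/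
def Generates (v i j : ℕ) : Prop :=
  i < j ∧ j ≤ w.length ∧
    ((∃ A, v = e.var A ∧ Yields G A (listSegment w i j)) ∨
      ∃ (p : ℕ) (hp : p < e.rhs.length), v = Fintype.card G.NT + p ∧ ∃ k, i < k ∧ k < j ∧
        Yields G e.rhs[p].1 (listSegment w i k) ∧ Yields G e.rhs[p].2 (listSegment w k j))

theorem generates_var_iff {A : G.NT} {i j : ℕ} :
    e.Generates w (e.var A) i j ↔ i < j ∧ j ≤ w.length ∧ Yields G A (listSegment w i j) := by
  constructor
  · rintro ⟨h1, h2, ⟨A', h, hA⟩ | ⟨p, hp, h, _⟩⟩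
    · rw [e.var.injective (Fin.val_injective h)]
      exact ⟨h1, h2, hA⟩
    · have := (e.var A).isLt
      omega
  · rintro ⟨h1, h2, h⟩
    exact ⟨h1, h2, .inl ⟨A, rfl, h⟩⟩

theorem generates_placeholder_iff {p i j : ℕ} (hp : p < e.rhs.length) :
    e.Generates w (Fintype.card G.NT + p) i j ↔
      ∃ k, e.Generates w (e.var e.rhs[p].1) i k ∧ e.Generates w (e.var e.rhs[p].2) k j := by
  simp only [generates_var_iff]
  constructor
  · rintro ⟨h1, h2, ⟨A, h, _⟩ | ⟨q, hq, h, k, h3, h4, h5⟩⟩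
    · have := (e.var A).isLt
      omega
    · obtain rfl : p = q := by omega
      exact ⟨k, ⟨h3, by omega, h5.1⟩, h4, h2, h5.2⟩
  · rintro ⟨k, ⟨h1, h2, h3⟩, h4, h5, h6⟩
    exact ⟨by omega, h5, .inr ⟨p, hp, rfl, k, h1, h4, h3, h6⟩⟩

/-- The bridge from grammar to machine: derivability of segments satisfies exactly the closure
properties that the correctness argument uses. Completeness is `IsCNF.yields_cases`, read off in
terms of positions in the string. -/
theorem ruleSemantics (hG : IsCNF G) :
    RuleSemantics (e.sizes w) (e.initial w).mem (Fintype.card G.NT + e.rhs.length)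
      (e.Generates w) where
  s_pos := e.s_pos
  lt h := h.1
  rhsPlaceholder_lt p hp := by rw [e.rhsPlaceholder_eq w hp]; exact Nat.add_lt_add_left hp _
  rhsFst_lt p hp := by rw [e.rhsFst_eq w hp]; exact Nat.lt_add_right _ (Fin.isLt _)
  rhsSnd_lt p hp := by rw [e.rhsSnd_eq w hp]; exact Nat.lt_add_right _ (Fin.isLt _)
  binLhs_lt r hr := by rw [e.binLhs_eq w hr]; exact Nat.lt_add_right _ (Fin.isLt _)
  binPlaceholder_lt r hr := by
    rw [e.binPlaceholder_eq w hr]; exact Nat.add_lt_add_left (Fin.isLt _) _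
  termLhs_lt r hr := by rw [e.termLhs_eq w hr]; exact Nat.lt_add_right _ (Fin.isLt _)
  mul p hp i k j h1 h2 := by
    rw [e.rhsFst_eq w hp] at h1
    rw [e.rhsSnd_eq w hp] at h2
    rw [e.rhsPlaceholder_eq w hp, e.generates_placeholder_iff w hp]
    exact ⟨k, h1, h2⟩
  bin r hr i j h := by
    rw [e.binPlaceholder_eq w hr, e.generates_placeholder_iff w (Fin.isLt _)] at h
    obtain ⟨k, h1, h2⟩ := h
    rw [generates_var_iff] at h1 h2
    rw [e.binLhs_eq w hr, generates_var_iff]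
    refine ⟨by omega, h2.2.1, ?_⟩
    rw [← listSegment_append h1.1.le h2.1.le h2.2.1]
    exact yields_binary ((e.mem_bin _).1 (List.getElem_mem hr)) h1.2.2 h2.2.2
  term r hr i hi hm := by
    rw [e.matches_iff w hr hi] at hm
    rw [e.termLhs_eq w hr, generates_var_iff]
    refine ⟨by omega, hi, ?_⟩
    rw [listSegment_succ hi, ← hm]
    exact yields_terminal ((e.mem_term _).1 (List.getElem_mem hr))
  complete {v i j} h := by
    obtain ⟨h1, h2, ⟨A, rfl, hA⟩ | ⟨p, hp, rfl, k, h3, h4, h5, h6⟩⟩ := h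
    · have hlen := length_listSegment (i := i) h2
      rcases hG.yields_cases (by rw [← List.length_pos_iff]; omega) hA with
        ⟨a, ha, hw⟩ | ⟨Y, Z, hr, x, y, hx, hy, hw, hYx, hZy⟩
      · rw [hw, List.length_singleton] at hlen
        obtain rfl : j = i + 1 := by omega
        obtain ⟨r, hr, har⟩ := List.getElem_of_mem ((e.mem_term _).2 ha)
        refine .inl ⟨r, hr, h2, rfl, ?_, ?_⟩
        · rw [e.termLhs_eq w hr, har]
        · rw [e.matches_iff w hr h2, har]
          rw [listSegment_succ h2] at hw
          simpa using hw.symm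
      · have hx' := List.length_pos_iff.2 hx
        have hy' := List.length_pos_iff.2 hy
        rw [hw, List.length_append] at hlen
        have hsplit := listSegment_append (w := w) (i := i) (k := i + x.length) (j := j)
          (by omega) (by omega) h2
        obtain ⟨e1, e2⟩ := List.append_inj (hsplit.trans hw)
          (by rw [length_listSegment (by omega)]; omega)
        obtain ⟨p, hp, hpr⟩ := List.getElem_of_mem ((e.mem_rhs (Y, Z)).2 ⟨_, hr, rfl⟩)
        obtain ⟨r, hr', hrr⟩ := List.getElem_of_mem ((e.mem_bin (A, ⟨p, hp⟩)).2
          (by simpa [hpr] using hr))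
        -- The split point is where the first factor `x` ends.
        refine .inr (.inr ⟨r, hr', ?_, p, hp, ?_, i + x.length, ?_, ?_⟩)
        · rw [e.binLhs_eq w hr', hrr]
        · rw [e.binPlaceholder_eq w hr', e.rhsPlaceholder_eq w hp, hrr]
        · rw [e.rhsFst_eq w hp, hpr, generates_var_iff, e1]
          exact ⟨by omega, by omega, hYx⟩
        · rw [e.rhsSnd_eq w hp, hpr, generates_var_iff, e2]
          exact ⟨by omega, h2, hZy⟩
    · refine .inr (.inl ⟨p, hp, (e.rhsPlaceholder_eq w hp).symm, k, ?_, ?_⟩)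
      · rw [e.rhsFst_eq w hp, generates_var_iff]
        exact ⟨h3, by omega, h5⟩
      · rw [e.rhsSnd_eq w hp, generates_var_iff]
        exact ⟨h4, h2, h6⟩

theorem soundMemory_initial :
    SoundMemory (e.sizes w) (e.initial w).mem (Fintype.card G.NT + e.rhs.length) (e.Generates w)
      (e.initial w).mem where
  input _ _ := rfl
  sound v _ i _ j _ h := by
    rw [HasBit, e.initial_unused w (Sizes.matrixAddr_le_cell _ _ _)] at h
    simp at h

theorem cykAnswer_iff (hG : IsCNF G) : e.cykAnswer w = true ↔ w ∈ G.language := by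
  change (cyk (e.sizes w) (e.initial w)).1 = true ↔ Yields G G.initial w
  rcases eq_or_ne w [] with rfl | hw
  · rw [hG.yields_nil_iff, ← e.eps_iff, ← e.getLsbD_eps []]
    rfl
  · have hstart : ((e.initial w).mem Sizes.startAddr).toNat = e.var G.initial := by
      rw [initial_start, toNat_varWord]
    have hlen := List.length_pos_iff.2 hw
    rw [cyk_answer (e.ruleSemantics w hG) (e.soundMemory_initial w) hlen.ne'
      (by rw [hstart]; exact Nat.lt_add_right _ (Fin.isLt _)), hstart, generates_var_iff]
    simp only [sizes, listSegment, List.take_length, List.drop_zero, le_refl, true_and]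
    exact and_iff_right hlen

theorem length_rhs : e.rhs.length = numRightSides G := by
  classical
  rw [numRightSides, ← List.toFinset_card_of_nodup e.rhs_nodup, ← Set.ncard_coe_finset]
  congr 1
  ext x
  simp [e.mem_rhs]

theorem length_term : e.term.length = numTerminal G := by
  classical
  rw [numTerminal, ← List.toFinset_card_of_nodup e.term_nodup, ← Set.ncard_coe_finset]
  congr 1
  ext x
  simp [e.mem_term]

theorem binaryRules_eq : binaryRules G =
    (fun x : G.NT × Fin e.rhs.length => (x.1, e.rhs.get x.2)) '' {x | x ∈ e.bin} := by
  ext ⟨A, Y⟩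
  constructor
  · intro h
    obtain ⟨p, hp⟩ := List.get_of_mem ((e.mem_rhs Y).2 ⟨_, h, rfl⟩)
    exact ⟨(A, p), (e.mem_bin _).2 (by rwa [hp]), by simp only [hp]⟩
  · rintro ⟨x, hx, h⟩
    rw [← h]
    exact (e.mem_bin x).1 hx

/-- Right-hand sides are listed without repetition, so a rule determines its placeholder and is not
counted twice. -/
theorem length_bin : e.bin.length = numBinary G := by
  classical
  rw [numBinary, e.binaryRules_eq, Set.ncard_image_of_injective]
  · rw [← List.toFinset_card_of_nodup e.bin_nodup, ← Set.ncard_coe_finset]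
    congr 1
    ext x
    simp
  · rintro ⟨A, p⟩ ⟨A', p'⟩ h
    simp only [Prod.mk.injEq] at h
    rw [h.1, (List.nodup_iff_injective_get.1 e.rhs_nodup) h.2]

theorem length_rhs_le_length_bin : e.rhs.length ≤ e.bin.length := by
  refine (length_rhs e).trans_le (le_trans ?_ (length_bin e).ge)
  refine Set.ncard_image_le ?_
  rw [e.binaryRules_eq]
  exact (List.finite_toSet e.bin).image _

theorem div_lt_wordsPerSet {v : ℕ} (hv : v < Fintype.card G.NT + e.rhs.length) :
    v / s < wordsPerSet G s := by
  have hs := e.s_pos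
  rw [wordsPerSet, ← e.length_rhs, Nat.lt_iff_add_one_le, ← Nat.add_div_right _ hs]
  exact Nat.div_le_div_right (by omega)

end Encoding

/-! ### Assembling the bound -/

theorem RuleSemantics.validRules {s V W : ℕ} {z : Sizes} {inp : ℕ → BitVec s}
    {D : ℕ → ℕ → ℕ → Prop} (R : RuleSemantics z inp V D) (hW : ∀ v < V, v / s < W) :
    ValidRules z inp W := by
  intro a h1 h2
  refine hW _ ?_
  rcases lt_or_ge a (z.binAddr 0) with h | h
  · have hp : (a - z.rhsAddr 0) / 3 < z.rhs := by
      simp only [Sizes.binAddr, Sizes.rhsAddr] at *; omega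
    have ha : a = z.rhsAddr ((a - z.rhsAddr 0) / 3) ∨ a = z.rhsAddr ((a - z.rhsAddr 0) / 3) + 1 ∨
        a = z.rhsAddr ((a - z.rhsAddr 0) / 3) + 2 := by
      simp only [Sizes.rhsAddr] at *; omega
    rcases ha with ha | ha | ha <;> rw [ha]
    · exact R.rhsPlaceholder_lt _ hp
    · exact R.rhsFst_lt _ hp
    · exact R.rhsSnd_lt _ hp
  · have hr : (a - z.binAddr 0) / 2 < z.bin := by
      simp only [Sizes.binAddr, Sizes.termAddr] at *; omega
    have ha : a = z.binAddr ((a - z.binAddr 0) / 2) ∨ a = z.binAddr ((a - z.binAddr 0) / 2) + 1 := by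
      simp only [Sizes.binAddr] at *; omega
    rcases ha with ha | ha <;> rw [ha]
    · exact R.binLhs_lt _ hr
    · exact R.binPlaceholder_lt _ hr

theorem RuleSemantics.validTerms {s V W : ℕ} {z : Sizes} {inp : ℕ → BitVec s}
    {D : ℕ → ℕ → ℕ → Prop} (R : RuleSemantics z inp V D) (hW : ∀ v < V, v / s < W) :
    ValidTerms z inp W := fun r hr => hW _ (R.termLhs_lt r hr)

theorem cyk_costs {s M B W : ℕ} {z : Sizes} {inp : ℕ → BitVec s} (hV : ValidRules z inp W)
    (hT : ValidTerms z inp W) (hΓ : z.rhs ≤ z.bin) (hB : 0 < B) (hW : 0 < W)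
    (h : (B = 1 ∧ 3 ≤ M) ∨ (1000 * W * B ≤ M ∧ W ≤ 4 * z.bin)) :
    ∃ S, Costs M B z.matrixAddr inp ∅ (cyk z) S (1500 * ioBound z M B + 50) fun _ => True := by
  have hBM : B ≤ M := by
    rcases h with ⟨rfl, h⟩ | ⟨h, _⟩
    · omega
    · refine le_trans ?_ h
      exact Nat.le_mul_of_pos_left _ (by positivity)
  have hio := ioBound_nonneg z M B
  have hread : ∀ {α : Type} {p : RAM s α} {a : ℕ} {Q : α → Prop}, (∀ S : Finset ℕ, a / B ∈ S →
      Costs M B z.matrixAddr inp S p S 0 Q) → Costs M B z.matrixAddr inp ∅ p ∅ 1 Q := by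
    intro α p a Q h
    exact (Costs.with_blocks {a / B} (h _ (by simp)) (by simpa using hBM)).mono (by simp)
  unfold cyk
  split_ifs with hn
  · exact ⟨∅, (hread (a := Sizes.epsAddr) fun S h => .testBit _ h).mono (by linarith)⟩
  · have hlast : Costs M B z.matrixAddr inp ∅ (do
        let A ← RAM.readWord Sizes.startAddr
        RAM.testBit (z.cell s A 0 z.n)) ∅ (1 + 1) fun _ => True :=
      (hread (a := Sizes.startAddr) fun S h => .readWord _ h).bind fun A _ =>
        hread (a := (z.cell s A 0 z.n).1) fun S h => .testBit _ h
    refine ⟨∅, ?_⟩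
    rcases h with ⟨rfl, h⟩ | ⟨h, hWR⟩
    · exact ((cykInit_costs_single h).bind fun _ _ =>
        (cykClosure_costs_single hV h hn hΓ).bind fun _ _ => hlast).mono (by linarith)
    · obtain ⟨S, h1⟩ := cykInit_costs_blocks hT hB hW h hWR hn
      obtain ⟨D, hD, h2⟩ := cykClosure_costs_blocks hV hB hW h hWR hn hΓ
      have hDM : D.card * B ≤ M := by
        refine le_trans (Nat.mul_le_mul_right B (hD.trans ?_)) h
        omega
      have hDS : ((D \ S).card : ℝ) ≤ 6 := by
        exact_mod_cast (Finset.card_le_card Finset.sdiff_subset).trans hD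
      -- Between the phases at most six blocks, those kept by the scan of the binary rules, have to
      -- be loaded.
      exact (h1.bind fun _ _ => (h2.before hDM hDS).bind
        fun _ _ => hlast.before (by simp) (r' := 0) (by simp)).mono (by linarith)

theorem theorem5 :
    ∃ c C : ℕ, ∀ (Sg : Type u) (G : ContextFreeGrammar.{u} Sg) [Fintype G.NT] (s : ℕ)
      (e : Encoding G s) (w : List Sg), IsCNF G →
      (e.cykAnswer w = true ↔ w ∈ G.language) ∧
      ∀ M B : ℕ, 1 ≤ B →
        ((B = 1 ∧ 3 ≤ M) ∨
          (c * wordsPerSet G s * B ≤ M ∧ wordsPerSet G s ≤ 4 * numBinary G)) →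
        ∃ q : ℕ, RunsWithTransfers M B (e.cykTrace w) q ∧
          (q : ℝ) ≤ C *
            (((w.length : ℝ) ^ 3 * numRightSides G / √(M : ℝ)
              + (w.length : ℝ) ^ 2 * numRightSides G * Real.logb 2 M
              + (w.length : ℝ) ^ 2 * numBinary G
              + (w.length : ℝ) * numTerminal G) / B + 1) := by
  -- 3000 is twice the 1500 of `cyk_costs`, because of the write-backs.
  refine ⟨1000, 3000, fun Sg G _ s e w hG => ⟨e.cykAnswer_iff w hG, fun M B hB h => ?_⟩⟩
  have R := e.ruleSemantics w hG
  have hlt : ∀ v < Fintype.card G.NT + e.rhs.length, v / s < wordsPerSet G s :=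
    fun v hv => e.div_lt_wordsPerSet hv
  have hW : 0 < wordsPerSet G s :=
    (Nat.zero_le _).trans_lt (hlt (e.var G.initial) (Nat.lt_add_right _ (Fin.isLt _)))
  rw [← e.length_bin] at h
  obtain ⟨S, hS⟩ := cyk_costs (z := e.sizes w) (R.validRules hlt) (R.validTerms hlt)
    e.length_rhs_le_length_bin hB hW h
  obtain ⟨-, -, τ, q, hτ, hf, hq⟩ := hS (e.initial w) fun _ _ => rfl
  obtain ⟨q', hq', hs⟩ := hf.schedule ∅ subset_rfl
  have htrace : e.cykTrace w = τ := hτ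
  refine ⟨q', by rw [htrace]; exact hs, ?_⟩
  have hq2 : (q' : ℝ) ≤ 2 * q := by
    rw [Finset.card_empty, add_zero] at hq'
    exact_mod_cast hq'
  rw [← e.length_rhs, ← e.length_bin, ← e.length_term]
  change (q' : ℝ) ≤ (3000 : ℕ) * (ioBound (e.sizes w) M B + 1)
  push_cast
  linarith
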